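/- **Setting.** Let $\Sigma$ be a compact connected oriented surface of genus $g\ge 1$ with one boundary circle $C$; let $E=H_1(C\times S^1,\mathbb R)$, $R=H_1(C\times S^1,\mathbb Z)$, $\mu=[C]$, $\lambda=[S^1]$, let $(p,q)$ be the linear coordinates of $E$ dual to $(\mu,\lambda)$, $\omega=4\pi\,dp\wedge dq$, and $M=E/R$. Let $L_E=E\times\mathbb C$ with the connection $d+\frac1i\alpha$, $\alpha_x(y)=\frac12\omega(x,y)$, and let $L_M$ be its quotient by the action $r\cdot(x,v)=(r+x,e^{i\omega(r,x)/2}v)$ of $R$. Let $j$ be a linear complex structure of $E$ compatible with $\omega$, $(\delta,\varphi:\delta^{\otimes2}\simeq K_j)$ a half-form line, where $K_j=\{\alpha\in E^*\otimes\mathbb C:\alpha(j\,\cdot)=i\alpha\}$ has the scalar product $(\alpha,\beta)=i\alpha\wedge\bar\beta/\omega$ and $\delta$ the metric making $\varphi$ unitary; let $\delta_M=M\times\delta$ and let $\mathcal H_k=H^0(M,L_M^k\otimes\delta_M)$, with the scalar product obtained by integrating the pointwise one against $\omega$. For $x\in\frac1{2k}R$ let $T_x^*$ be the pull-back by the translation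 action $(x,1)\cdot(y,v)=(x+y,e^{ik\omega(x,y)/2}v)$ on $L_M^k$. Let $(\Psi_\ell)_{\ell\in\mathbb Z/2k\mathbb Z}$ be the orthonormal basis of $\mathcal H_k$ with $T^*_{\mu/2k}\Psi_\ell=e^{i\pi\ell/k}\Psi_\ell$, $T^*_{\lambda/2k}\Psi_\ell=\Psi_{\ell+1}$ and $\Psi_0(0)\in\mathbb R_{>0}\,\Omega_\mu$, where $\Omega_\mu\in\delta$ satisfies $\varphi(\Omega_\mu^2)(\mu)=1$. For $1\le\ell\le k-1$, let $N^{g,k}_\ell$ be the dimension of the space associated by $SU(2)$ Chern–Simons theory at level $k-2$ to a genus $g$ surface with one marked point coloured by $\ell$, i.e. the number of admissible colourings, by $\{1,\dots,k-1\}$, of any pants decomposition of $\Sigma$ with $C$ coloured by $\ell$ ($a,b,c$ is admissible at a pair of pants if $a+b+c$ is odd and smaller than $2k$, and $a<b+c$, $b<a+c$, $c<a+b$). The vector of $\Sigma\times S^1$ is $$Z_k(\Sigma\times S^1)=\sum_{\ell=1}^{k-1}N^{g,k}_\ell\,\tfrac1{\sqrt2}(\Psi_\ell-\Psi_{-\ell})\in\mathcal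 H_k .$$ Let $A_1=\{[p\mu]:p\in\mathbb R\}$, $A_2=\{[q\lambda],[\frac12\mu+q\lambda]:q\in\mathbb R\}$, $U_1=M\setminus A_2$, $U_2=M\setminus A_1$. **Lagrangian states.** A family $\xi=(\xi_k\in\mathcal H_k)_{k\ge1}$ is admissible if $\|\xi_k\|\le Ck^{N}$ for some $C,N$. Its microsupport $\mathrm{MS}(\xi)$ is the complement of the set of points having a neighbourhood on which $|\xi_k|=O(k^{-\infty})$ uniformly. Let $U\subset M$ be open, $\Gamma$ a one-dimensional submanifold of $U$, $\Theta$ a flat section of $L_M\to\Gamma$ of norm $1$, $\sigma$ a section of $\delta_M\to\Gamma$, $N\in\mathbb R$. The restriction of an admissible $\xi$ to $U$ is a Lagrangian state with associated data $(\Gamma,\Theta,\sigma,N)$ if $\mathrm{MS}(\xi)\cap U\subset\Gamma$ and every $x_0\in\Gamma$ has an open neighbourhood $V$ on which $$\xi_k=\Bigl(\frac{k}{2\pi}\Bigr)^{1/4+N}\mathcal E^k f(\cdot,k)+O(k^{-\infty})\quad\text{uniformly},$$ where $\mathcal E$ is a smooth section of $L_M$ over $V$ with $\mathcal E=\Theta$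 on $\Gamma\cap V$, $|\mathcal E|<1$ outside $\Gamma$, $\bar\partial\mathcal E$ vanishing to infinite order along $\Gamma$, and $f(\cdot,k)\in C^\infty(V,\delta_M)$ has an asymptotic expansion $f_0+k^{-1}f_1+\cdots$ in $C^\infty(V,\delta_M)$ with $f_0=\sigma$ on $\Gamma\cap V$. **Theorem.** There is a flat section $\Theta_A$ of $L_M\to A_1\cup A_2$, of norm $1$ and equal to $1$ at the origin, such that the following holds. 1. The restriction of $(Z_k(\Sigma\times S^1))_{k\ge1}$ to $U_1$ is a Lagrangian state with associated data $(A_1\setminus A_2,\Theta_A,\sigma_1,g)$, where, up to a global sign, $$\sigma_1(p\mu)=i\sqrt2\,\pi^g\,[\sin(2\pi p)]^{1-2g}\,(dp)^{1/2},\qquad p\in\mathbb R\setminus\tfrac12\mathbb Z .$$ 2. There is a unique family of real polynomials $P_{g,0},\dots,P_{g,g-1}$ such that for all $k\ge1$ and all odd $\ell$ with $1\le\ell\le k-1$, $$N^{g,k}_\ell=\Bigl(\frac{k}{2\pi}\Bigr)^{3g-2}\sum_{m=0}^{g-1}k^{-2m}P_{g,m}\Bigl(\frac{\ell}{k}\Bigr),$$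 and the restriction of $(Z_k(\Sigma\times S^1))_{k\ge1}$ to $U_2$ is a Lagrangian state with associated data $(A_2\setminus A_1,\Theta_A,\sigma_2,3g-\frac32)$, where, up to a global sign, $$\sigma_2(q\lambda)=e^{i\pi/4}\Bigl(\frac{\pi}{2}\Bigr)^{1/2}P_{g,0}(2q)\,(dq)^{1/2},\qquad q\in(0,1),$$ and $\sigma_2(q\lambda+\frac12\mu)=-\sigma_2(q\lambda)$ for $q\in(0,1)$. Here $(dp)^{1/2}$ and $(dq)^{1/2}$ denote elements $\Omega_\mu,\Omega_\lambda$ of $\delta$ with $\varphi(\Omega_\mu^2)(\mu)=1$ and $\varphi(\Omega_\lambda^2)(\lambda)=1$. -/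

import Mathlib

open scoped ContDiff

noncomputable section

namespace TorusQuantization

/-! ### The torus and its prequantum bundle

The plane `E = H₁(C × S¹, ℝ)` is identified with `ℝ × ℝ` through the basis `(μ, lam)`, the vector
`p μ + q lam` being `(p, q)`. -/

/-- The plane `E`, with coordinates `(p, q)`. -/
abbrev Plane : Type := ℝ × ℝ

/-- The vector `μ`. -/
def mu : Plane := (1, 0)

/-- The vector `lam`. -/
def lam : Plane := (0, 1)

/-- The symplectic form `ω = 4π dp ∧ dq`, so that `ω(μ, lam) = 4π`. -/
def omega (x y : Plane) : ℝ := 4 * Real.pi * (x.1 * y.2 - x.2 * y.1)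

/-- The lattice `R = ℤ μ + ℤ lam`. -/
def lattice : AddSubgroup Plane :=
  AddSubgroup.prod (Int.castAddHom ℝ).range (Int.castAddHom ℝ).range

/-- The torus `M = E / R`. -/
abbrev Torus : Type := Plane ⧸ lattice

/-- The projection `x ↦ [x]` from `E` to `M`. -/
def proj (x : Plane) : Torus := QuotientAddGroup.mk x

/-- The multiplier of the action of `(r, 1)` on `L_E^k`: the point `(x, v)` is sent to
`(r + x, e^{i k ω(r, x) / 2} v)`. -/
def multiplier (k : ℕ) (r x : Plane) : ℂ :=
  Complex.exp (Complex.I * ((k : ℂ) * (omega r x : ℂ) / 2))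

/-- Sections of `L_M^k` over a subset `S` of `M = E / R` are functions on the preimage of `S` in `E`
that are equivariant under the action of `R × {1}`. -/
def IsSectionOn (k : ℕ) (S : Set Torus) (f : Plane → ℂ) : Prop :=
  ∀ r ∈ lattice, ∀ x, proj x ∈ S → f (r + x) = multiplier k r x * f x

/-- The covariant derivative `∇_v f` at `x` of a section `f` of `L_E^k`, for the connection
`d + (k / i) α` with `α_x(v) = ω(x, v) / 2`. -/
def nabla (k : ℕ) (f : Plane → ℂ) (x v : Plane) : ℂ :=
  fderiv ℝ f x v + ((k : ℂ) / Complex.I) * ((omega x v / 2 : ℝ) : ℂ) * f x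

/-- The pull-back `T_x^* f` of a section `f` of `L^k` by the action of `(x, 1)`. -/
def pullback (k : ℕ) (x : Plane) (f : Plane → ℂ) : Plane → ℂ :=
  fun y => (multiplier k x y)⁻¹ * f (x + y)

/-! ### Complex structure, half-forms and the quantum spaces -/

/-- `j` is a linear complex structure of `E` compatible with `ω`. -/
structure IsCompatible (j : Plane →ₗ[ℝ] Plane) : Prop where
  sq : ∀ x, j (j x) = -x
  symp : ∀ x y, omega (j x) (j y) = omega x y
  pos : ∀ x, x ≠ 0 → 0 < omega x (j x)

/-- The value of `∂̄ f` at `x` on the antiholomorphic vector `v + i j v`. -/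
def dbar (j : Plane →ₗ[ℝ] Plane) (k : ℕ) (f : Plane → ℂ) (v x : Plane) : ℂ :=
  nabla k f x v + Complex.I * nabla k f x (j v)

/-- A half-form line. A basis vector of the complex line `δ` identifies it with `ℂ`; the isomorphism
`φ : δ ⊗ δ → K_j` is then `φ (u ⊗ v) = u v κ` for some non zero `κ` in
`K_j = {α : E → ℂ ; α (j ·) = i α}`. -/
structure IsHalfFormLine (j : Plane →ₗ[ℝ] Plane) (kappa : Plane →ₗ[ℝ] ℂ) : Prop where
  ne_zero : kappa ≠ 0
  type_one_zero : ∀ x, kappa (j x) = Complex.I * kappa x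

/-- `Ω` in `δ` is such that `φ(Ω²)(v) = 1`. If `t` is the linear coordinate of the line `ℝ v`, then
`φ(Ω²)` restricts to `dt` on this line, so that `Ω` is one of the two square roots `(dt)^{1/2}`. -/
def IsHalfForm (kappa : Plane →ₗ[ℝ] ℂ) (v : Plane) (Om : ℂ) : Prop :=
  Om ^ 2 * kappa v = 1

/-- The squared norm of `1` in `δ = ℂ`, for the metric of `δ` such that `φ` is unitary, the scalar
product of `K_j` being `(α, β) = i α ∧ β̄ / ω`. -/
def halfFormNormSq (kappa : Plane →ₗ[ℝ] ℂ) : ℝ :=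
  Real.sqrt ((Complex.I * (kappa mu * (starRingEnd ℂ) (kappa lam)
    - kappa lam * (starRingEnd ℂ) (kappa mu))).re / omega mu lam)

/-- The space `H_k` of holomorphic sections of `L_M^k ⊗ δ_M`. -/
def quantumSpace (j : Plane →ₗ[ℝ] Plane) (k : ℕ) : Set (Plane → ℂ) :=
  {f | ContDiff ℝ ∞ f ∧ IsSectionOn k Set.univ f ∧ ∀ v x, dbar j k f v x = 0}

/-- The scalar product of `H_k`: the integral over `M` of the pointwise scalar product against
`ω = 4π dp ∧ dq`. -/
def quantumInner (kappa : Plane →ₗ[ℝ] ℂ) (f h : Plane → ℂ) : ℂ :=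
  ∫ p in (0 : ℝ)..1, ∫ q in (0 : ℝ)..1,
    ((4 * Real.pi * halfFormNormSq kappa : ℝ) : ℂ) * (f (p, q) * (starRingEnd ℂ) (h (p, q)))

/-- The norm of `H_k`. -/
def quantumNorm (kappa : Plane →ₗ[ℝ] ℂ) (f : Plane → ℂ) : ℝ :=
  Real.sqrt (quantumInner kappa f f).re

/-- `(Ψ_ℓ, ℓ ∈ ℤ/2kℤ)` is the orthonormal basis of `H_k` associated to `(μ, lam)`, with the
normalization `Ψ_0(0) = c Ω_μ`, `c > 0`. -/
structure IsPsiBasis (j : Plane →ₗ[ℝ] Plane) (kappa : Plane →ₗ[ℝ] ℂ) (Om : ℂ) (k : ℕ)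
    (Psi : ZMod (2 * k) → Plane → ℂ) : Prop where
  mem : ∀ l, Psi l ∈ quantumSpace j k
  orthonormal : ∀ l m, quantumInner kappa (Psi l) (Psi m) = if l = m then 1 else 0
  span : quantumSpace j k ⊆ (Submodule.span ℂ (Set.range Psi) : Set (Plane → ℂ))
  pullback_mu : ∀ l : ℤ, pullback k ((1 / (2 * (k : ℝ))) • mu) (Psi (l : ZMod (2 * k)))
    = Complex.exp (Complex.I * Real.pi * l / k) • Psi (l : ZMod (2 * k))
  pullback_lam : ∀ l : ZMod (2 * k),
    pullback k ((1 / (2 * (k : ℝ))) • lam) (Psi l) = Psi (l + 1)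
  normalization : ∃ c : ℝ, 0 < c ∧ Psi 0 0 = c * Om

/-! ### Lagrangian states -/

/-- `Γ` is a one dimensional submanifold of the open subset `U` of `M`: locally, the zero set of a
smooth function without critical points. -/
def IsCurveIn (U G : Set Torus) : Prop :=
  G ⊆ U ∧ ∀ x, proj x ∈ G → ∃ W : Set Plane, IsOpen W ∧ x ∈ W ∧ ∃ h : Plane → ℝ,
    ContDiffOn ℝ ∞ h W ∧ (∀ y ∈ W, fderiv ℝ h y ≠ 0) ∧ ∀ y ∈ W, (proj y ∈ G ↔ h y = 0)

/-- `Θ` is a section of `L_M → Γ` with constant pointwise norm `1`, flat along every smooth curve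
contained in `Γ`. -/
structure IsFlatUnitSection (G : Set Torus) (Theta : Plane → ℂ) : Prop where
  isSection : IsSectionOn 1 G Theta
  norm_eq_one : ∀ x, proj x ∈ G → ‖Theta x‖ = 1
  flat : ∀ c : ℝ → Plane, ContDiff ℝ ∞ c → (∀ t, proj (c t) ∈ G) → ∀ t,
    HasDerivAt (fun s => Theta (c s))
      (Complex.I * ((omega (c t) (deriv c t) / 2 : ℝ) : ℂ) * Theta (c t)) t

/-- Admissible families: `ξ_k ∈ H_k` and `‖ξ_k‖ ≤ C k^N` for some `N` and `C`. -/
def IsAdmissible (j : Plane →ₗ[ℝ] Plane) (kappa : Plane →ₗ[ℝ] ℂ) (xi : ℕ → Plane → ℂ) : Prop :=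
  (∀ k, 1 ≤ k → xi k ∈ quantumSpace j k) ∧
    ∃ (N : ℕ) (C : ℝ), ∀ k : ℕ, 1 ≤ k → quantumNorm kappa (xi k) ≤ C * (k : ℝ) ^ N

/-- The family of functions `r_k` is `O(k^{-∞})`, uniformly on `S`. -/
def IsNegligibleOn (S : Set Plane) (r : ℕ → Plane → ℂ) : Prop :=
  ∀ N : ℕ, ∃ C : ℝ, ∀ k : ℕ, 1 ≤ k → ∀ y ∈ S, ‖r k y‖ ≤ C * ((k : ℝ) ^ N)⁻¹

/-- The microsupport of a family. -/
def microsupport (xi : ℕ → Plane → ℂ) : Set Torus :=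
  {x | ¬ ∃ W ∈ nhds x, IsNegligibleOn (proj ⁻¹' W) xi}

/-- The sequence `f(·, k)` of smooth functions on the open set `V` has the asymptotic expansion
`F_0 + k⁻¹ F_1 + k⁻² F_2 + …`, with smooth coefficients, in the topology of `C^∞(V)`: all
derivatives, uniformly on compact sets. -/
def HasSmoothExpansion (V : Set Plane) (f F : ℕ → Plane → ℂ) : Prop :=
  (∀ k, 1 ≤ k → ContDiffOn ℝ ∞ (f k) V) ∧ (∀ l, ContDiffOn ℝ ∞ (F l) V) ∧
    ∀ (L m : ℕ) (K : Set Plane), IsCompact K → K ⊆ V → ∃ C : ℝ, ∀ k : ℕ, 1 ≤ k → ∀ y ∈ K,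
      ‖iteratedFDeriv ℝ m
          (fun z => f k z - ∑ l ∈ Finset.range L, ((k : ℂ) ^ l)⁻¹ * F l z) y‖
        ≤ C * ((k : ℝ) ^ L)⁻¹

/-- The restriction of the family `ξ` to `U` is a Lagrangian state with associated data
`(Γ, Θ, σ, N)`.

In the local description, the neighbourhood `V` of a point of `Γ` is taken in the covering `E` of `M`
around any lift of this point; sections of `L_M` and `δ_M` over a small open subset of `M` are the
same as complex functions on such a lift. -/
structure IsLagrangianState (j : Plane →ₗ[ℝ] Plane) (kappa : Plane →ₗ[ℝ] ℂ)
    (U G : Set Torus) (Theta : Plane → ℂ) (sigma : Torus → ℂ) (N : ℝ)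
    (xi : ℕ → Plane → ℂ) : Prop where
  isOpen : IsOpen U
  isCurve : IsCurveIn U G
  flat : IsFlatUnitSection G Theta
  admissible : IsAdmissible j kappa xi
  microsupport_subset : microsupport xi ∩ U ⊆ G
  localForm : ∀ x₀, proj x₀ ∈ G → ∃ V : Set Plane, IsOpen V ∧ x₀ ∈ V ∧ V ⊆ proj ⁻¹' U ∧
    ∃ (e : Plane → ℂ) (f F : ℕ → Plane → ℂ),
      ContDiffOn ℝ ∞ e V ∧
      (∀ y ∈ V, proj y ∈ G → e y = Theta y) ∧
      (∀ y ∈ V, proj y ∉ G → ‖e y‖ < 1) ∧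
      (∀ (v : Plane) (n : ℕ), ∀ y ∈ V, proj y ∈ G → iteratedFDeriv ℝ n (dbar j 1 e v) y = 0) ∧
      HasSmoothExpansion V f F ∧
      (∀ y ∈ V, proj y ∈ G → F 0 y = sigma (proj y)) ∧
      IsNegligibleOn V (fun k y =>
        xi k y - ((((k : ℝ) / (2 * Real.pi)) ^ (1 / 4 + N) : ℝ) : ℂ) * (e y) ^ k * f k y)

/-- `A₁ = {[p μ]}`. -/
def A1 : Set Torus := {x | ∃ p : ℝ, x = proj (p • mu)}

/-- `A₂ = {[q lam], [μ/2 + q lam]}`. -/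
def A2 : Set Torus :=
  {x | ∃ q : ℝ, x = proj (q • lam) ∨ x = proj ((1 / 2 : ℝ) • mu + q • lam)}

/-! ### The Verlinde numbers and the state of `Σ × S¹` -/

/-- A pants decomposition of the compact connected oriented surface of genus `g` with one boundary
circle. Its Euler characteristic being `1 - 2g`, there are `2g - 1` pairs of pants; `(v, i)`,
`i = 0, 1, 2`, are the boundary circles of the pair of pants `v`. The involution `glue` says which
circles are glued together, the circle `bdry` being the only one that remains free. -/
structure PantsDecomposition (g : ℕ) where
  glue : Fin (2 * g - 1) × Fin 3 → Fin (2 * g - 1) × Fin 3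
  glue_glue : ∀ h, glue (glue h) = h
  bdry : Fin (2 * g - 1) × Fin 3
  glue_eq_self_iff : ∀ h, glue h = h ↔ h = bdry
  connected : ∀ v w, Relation.ReflTransGen (fun a b => ∃ i, (glue (a, i)).1 = b) v w

/-- Admissible triples of colors for `SU(2)` at level `k - 2`. The color `a ∈ {1, …, k - 1}` is the
dimension of the corresponding representation of `SU(2)`. -/
def IsAdmissibleTriple (k a b c : ℕ) : Prop :=
  Odd (a + b + c) ∧ a < b + c ∧ b < a + c ∧ c < a + b ∧ a + b + c < 2 * k

/-- Admissible colorings of a pants decomposition by colors in `{1, …, k - 1}`, the boundary circle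
of the surface being colored by `l`. -/
def IsAdmissibleColoring {g : ℕ} (G : PantsDecomposition g) (k l : ℕ)
    (c : Fin (2 * g - 1) × Fin 3 → Fin k) : Prop :=
  (∀ h, 1 ≤ (c h : ℕ)) ∧ (∀ h, c (G.glue h) = c h) ∧ (c G.bdry : ℕ) = l ∧
    ∀ v, IsAdmissibleTriple k (c (v, 0)) (c (v, 1)) (c (v, 2))

/-- The number `N_l^{g,k}`: the dimension of the space associated to a genus `g` surface with one
marked point colored by `l`, which has a basis indexed by the admissible colorings of any pants
decomposition. -/
def verlindeNumber {g : ℕ} (G : PantsDecomposition g) (k l : ℕ) : ℕ :=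
  Nat.card {c : Fin (2 * g - 1) × Fin 3 → Fin k // IsAdmissibleColoring G k l c}

/-- The vector `Z_k(Σ × S¹) = ∑_{0 < l < k} N_l^{g,k} e_l` with `e_l = (Ψ_l - Ψ_{-l}) / √2`. -/
def stateZ {g : ℕ} (G : PantsDecomposition g) (Psi : (k : ℕ) → ZMod (2 * k) → Plane → ℂ)
    (k : ℕ) : Plane → ℂ :=
  ∑ l ∈ Finset.Ico 1 k, (verlindeNumber G k l : ℂ) •
    (((Real.sqrt 2 : ℝ) : ℂ)⁻¹ • (Psi k (l : ZMod (2 * k)) - Psi k (-(l : ZMod (2 * k)))))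

/-- `(P_{g,0}, …, P_{g,g-1})` are the polynomials such that
`N_l^{g,k} = (k / 2π)^{3g-2} ∑_m k^{-2m} P_{g,m}(l / k)` for all `k ≥ 1` and all odd `l < k`. -/
def IsCountingFamily {g : ℕ} (G : PantsDecomposition g) (P : Fin g → Polynomial ℝ) : Prop :=
  ∀ k l : ℕ, 1 ≤ k → Odd l → l < k →
    (verlindeNumber G k l : ℝ) = ((k : ℝ) / (2 * Real.pi)) ^ (3 * g - 2) *
      ∑ m : Fin g, ((k : ℝ) ^ (2 * (m : ℕ)))⁻¹ * (P m).eval ((l : ℝ) / k)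

end TorusQuantization

end

open TorusQuantization

/-!
The state is a finite sum of theta functions, hence a sum over `ℤ` of Gaussians weighted by Verlinde
numbers; reading this sum directly gives its form near `A₂`, reading it after Poisson summation gives
its form near `A₁`.

*Verlinde numbers.* The matrix with entries proportional to `sin (π a b / k)` diagonalizes the fusion
coefficients. Gluing the pairs of pants (`sum_colorings`) turns the number of admissible colourings
into the single sum `verlindeNumber_eq` of `sin (π n l / k) / sin (π n / k) ^ (2 g - 1)`. Multiplying
the summand by `sin² (π n / k)` amounts to taking a second difference in `l`; inverting this
difference operator on odd polynomials yields, by induction on `g`, the polynomials of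
`exists_isCountingFamily`. They are unique because the arguments `l / k` and the powers of `k` separate
their coefficients (`isCountingFamily_ext`).

*The state.* The basis `Ψ_l` consists of theta series, up to a phase exponentially close to `1`
(`exists_psi_eq`). So `Z_k` is `(k / 2π) ^ (1 / 4)` times the Gaussian sum `gaussZ`, up to constants
(`exists_stateZ_eq`). By `gaussZ_eq_gaussSum` and `coeffZ_eq_sum`, the coefficients of `gaussZ` are
polynomials in `l / k`, periodized, times the projection `(1 - (-1) ^ l) / 2` on odd colours. This
projection splits the sum into two with opposite signs, whose frequencies differ by one half: they
live on the two circles of `A₂`, whence `σ₂ (q λ + μ / 2) = -σ₂ (q λ)`. By Poisson summation the same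
function is a Gaussian sum in the other direction, whose coefficients are the values of
`sin ^ (1 - 2 g)` at the points `π n / k` (`gaussZ_eq_gaussSum_sineCoeff`); it lives on `A₁`.

*Gaussian sums.* Both representations are instances of the same problem: a Gaussian sum, centred at
`P` and with frequency `Q`, whose coefficients sample near `P` a holomorphic function `b`. Instead of
a Taylor expansion, `b` is expanded in characters (`exists_character_expansion`), for then Poisson
summation (`tsum_gaussTerm`) is exact on each term. The sum is therefore `O(k^{-∞})` when `Q` stays
away from `ℤ` (`IsSampled.exists_gaussSum_le`). When `Q` is near `0`, it is the product of an
exponential of a quadratic polynomial, raised to the power `k`, with a Gaussian average of `b` around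
the complex point `P + 2 i π Q / c` (`IsSampled.exists_gaussSum_sub_le`). These averages are
holomorphic functions of that point, and the Laplace method expands them in powers of `k⁻¹`
(`exists_holExp_localAverage`); by Cauchy's estimates the expansion holds with all derivatives
(`HolExp.hasSmoothExpansion`).

*Lagrangian states.* The quadratic exponentials are holomorphic sections of the prequantum bundle
(`positionPhase_eq_holoSection`, `momentumPhase_eq_holoSection`), so that the condition on `∂̄ 𝓔` holds
identically and not only to infinite order. They restrict on the circles to the explicit flat section
`flatSection`, and the values of `b` on the circles are the symbols. The constants in the symbols
involve square roots, namely the integral of a complex Gaussian and the half-forms, which are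
determined here through their squares (`gaussMass_sq`, `IsHalfForm`): this is the origin of the global
signs.
-/

namespace TorusQuantization

/-! ### Sums of roots of unity and orthogonality of sines -/

lemma sum_exp_eq (k : ℕ) (hk : 1 ≤ k) (d : ℤ) :
    ∑ n ∈ Finset.range (2 * k), Complex.exp (Complex.I * Real.pi * d * n / k)
      = if (2 * k : ℤ) ∣ d then (2 * k : ℂ) else 0 := by
  have hk0 : (k : ℂ) ≠ 0 := by exact_mod_cast (by omega : k ≠ 0)
  have hpi : (Real.pi : ℂ) ≠ 0 := by exact_mod_cast Real.pi_ne_zero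
  set ζ : ℂ := Complex.exp (Complex.I * Real.pi * d / k) with hζ
  have hpow : ∀ n : ℕ, Complex.exp (Complex.I * Real.pi * d * n / k) = ζ ^ n := by
    intro n
    rw [hζ, ← Complex.exp_nat_mul]
    congr 1
    ring
  have hone : ζ = 1 ↔ (2 * k : ℤ) ∣ d := by
    rw [hζ, Complex.exp_eq_one_iff]
    constructor
    · rintro ⟨n, hn⟩
      refine ⟨n, ?_⟩
      have : (d : ℂ) = 2 * k * n := by
        field_simp at hn
        linear_combination hn
      exact_mod_cast this
    · rintro ⟨n, rfl⟩
      refine ⟨n, ?_⟩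
      push_cast
      field_simp
  have htop : ζ ^ (2 * k) = 1 := by
    rw [hζ, ← Complex.exp_nat_mul, Complex.exp_eq_one_iff]
    refine ⟨d, ?_⟩
    push_cast
    field_simp
  simp only [hpow]
  split_ifs with h
  · rw [hone.2 h]
    simp
  · have hne : ζ ≠ 1 := fun h' => h (hone.1 h')
    rw [geom_sum_eq hne, htop]
    simp

lemma sum_cos_eq (k : ℕ) (hk : 1 ≤ k) (d : ℤ) :
    ∑ n ∈ Finset.range (2 * k), Real.cos (Real.pi * d * n / k)
      = if (2 * k : ℤ) ∣ d then (2 * k : ℝ) else 0 := by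
  have h := congrArg Complex.re (sum_exp_eq k hk d)
  rw [Complex.re_sum] at h
  have e : ∀ n : ℕ, (Complex.exp (Complex.I * Real.pi * d * n / k)).re
      = Real.cos (Real.pi * d * n / k) := by
    intro n
    rw [show Complex.I * Real.pi * d * n / k
      = ((Real.pi * d * n / k : ℝ) : ℂ) * Complex.I by push_cast; ring, Complex.exp_ofReal_mul_I_re]
  simp only [e] at h
  rw [h]
  split_ifs <;> simp

/-- A function symmetric about `k` and vanishing at `0` and `k` has, over a full period, twice its
sum over a half period. -/
lemma sum_range_two_mul_of_symm (k : ℕ) (F : ℕ → ℝ) (h0 : F 0 = 0) (hk : F k = 0)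
    (hs : ∀ n, n ≤ 2 * k → F (2 * k - n) = F n) :
    ∑ n ∈ Finset.range (2 * k), F n = 2 * ∑ n ∈ Finset.range k, F n := by
  rw [two_mul, Finset.sum_range_add]
  have h1 : ∑ x ∈ Finset.range k, F (k + x) = ∑ x ∈ Finset.range k, F (x + 1) := by
    rw [← Finset.sum_range_reflect]
    refine Finset.sum_congr rfl fun x hx => ?_
    rw [Finset.mem_range] at hx
    rw [← hs (x + 1) (by omega)]
    congr 1
    omega
  have h2 := Finset.sum_range_succ' F k
  rw [Finset.sum_range_succ, hk, h0] at h2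
  rw [h1]
  linarith

lemma sum_sin_mul_sin (k : ℕ) (hk : 1 ≤ k) (a b : ℤ) :
    ∑ n ∈ Finset.range k, Real.sin (Real.pi * a * n / k) * Real.sin (Real.pi * b * n / k)
      = k / 2 * ((if (2 * k : ℤ) ∣ a - b then 1 else 0) - if (2 * k : ℤ) ∣ a + b then 1 else 0) := by
  have hk0 : (k : ℝ) ≠ 0 := by exact_mod_cast (by omega : k ≠ 0)
  have hsk : ∀ a : ℤ, Real.sin (Real.pi * a * (k : ℕ) / k) = 0 := by
    intro a
    rw [mul_div_assoc, div_self hk0, mul_one, mul_comm]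
    exact Real.sin_int_mul_pi a
  have hsym : ∀ (a : ℤ) (n : ℕ), n ≤ 2 * k →
      Real.sin (Real.pi * a * (2 * k - n : ℕ) / k) = - Real.sin (Real.pi * a * n / k) := by
    intro a n hn
    rw [Nat.cast_sub hn]
    push_cast
    rw [show Real.pi * a * (2 * k - n) / k = a * (2 * Real.pi) - Real.pi * a * n / k by
      field_simp, Real.sin_int_mul_two_pi_sub]
  have h := sum_range_two_mul_of_symm k
    (fun n => Real.sin (Real.pi * a * n / k) * Real.sin (Real.pi * b * n / k))
    (by simp) (by simp [hsk]) (by intro n hn; simp only [hsym _ n hn]; ring)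
  have h2 : ∑ n ∈ Finset.range (2 * k),
      Real.sin (Real.pi * a * n / k) * Real.sin (Real.pi * b * n / k)
      = (∑ n ∈ Finset.range (2 * k), Real.cos (Real.pi * (a - b : ℤ) * n / k)
        - ∑ n ∈ Finset.range (2 * k), Real.cos (Real.pi * (a + b : ℤ) * n / k)) / 2 := by
    rw [← Finset.sum_sub_distrib, Finset.sum_div]
    refine Finset.sum_congr rfl fun n _ => ?_
    push_cast
    rw [show Real.pi * (a - b) * n / k = Real.pi * a * n / k - Real.pi * b * n / k by ring,
      show Real.pi * (a + b) * n / k = Real.pi * a * n / k + Real.pi * b * n / k by ring,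
      Real.cos_sub, Real.cos_add]
    ring
  rw [sum_cos_eq k hk, sum_cos_eq k hk] at h2
  rw [h2] at h
  have : ∑ n ∈ Finset.range k, Real.sin (Real.pi * a * n / k) * Real.sin (Real.pi * b * n / k)
    = ((if (2 * k : ℤ) ∣ a - b then (2 * k : ℝ) else 0)
      - if (2 * k : ℤ) ∣ a + b then (2 * k : ℝ) else 0) / 2 / 2 := by linarith
  rw [this]
  split_ifs <;> ring

/-! ### Fusion coefficients -/

/-- The Clebsch-Gordan formula for the characters `sin (b θ) / sin θ` of `SU(2)`. -/
lemma sin_mul_sin_eq_sum (a b : ℕ) (θ : ℝ) :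
    Real.sin (a * θ) * Real.sin (b * θ)
      = Real.sin θ * ∑ i ∈ Finset.range b, Real.sin (((a : ℤ) - b + 1 + 2 * i : ℤ) * θ) := by
  have h : ∀ m : ℕ, 2 * (Real.sin θ * ∑ i ∈ Finset.range m, Real.sin (((a : ℤ) - b + 1 + 2 * i : ℤ) * θ))
      = Real.cos ((a - b) * θ) - Real.cos ((a - b + 2 * m) * θ) := by
    intro m
    induction m with
    | zero => simp
    | succ m ih =>
      rw [Finset.sum_range_succ, mul_add, mul_add, ih]
      push_cast
      have h1 := Real.cos_sub ((a - b + 1 + 2 * m) * θ) θ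
      have h2 := Real.cos_add ((a - b + 1 + 2 * m) * θ) θ
      rw [show ((a : ℝ) - b + 1 + 2 * m) * θ - θ = (a - b + 2 * m) * θ by ring] at h1
      rw [show ((a : ℝ) - b + 1 + 2 * m) * θ + θ = (a - b + 2 * (m + 1)) * θ by ring] at h2
      rw [h1, h2]
      ring
  have hb := h b
  have h1 := Real.cos_sub (a * θ) (b * θ)
  have h2 := Real.cos_add (a * θ) (b * θ)
  rw [← sub_mul] at h1
  rw [← add_mul] at h2
  rw [show ((a : ℝ) - b + 2 * b) = a + b by ring, h1, h2] at hb
  linarith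

lemma sin_pos_of_color {k n : ℕ} (h0 : 1 ≤ n) (hn : n < k) : 0 < Real.sin (Real.pi * n / k) := by
  have hk : (0 : ℝ) < k := by exact_mod_cast (by omega : 0 < k)
  have hn' : (n : ℝ) < k := by exact_mod_cast hn
  have h0' : (0 : ℝ) < n := by exact_mod_cast h0
  apply Real.sin_pos_of_pos_of_lt_pi
  · positivity
  · rw [div_lt_iff₀ hk]
    exact mul_lt_mul_of_pos_left hn' Real.pi_pos

/-- Verlinde's formula for the pair of pants. -/
lemma sum_sin_eq_fusion (k a b c : ℕ) (ha : a < k) (hb : b < k) (hc : c < k) :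
    ∑ n ∈ Finset.range k, Real.sin (Real.pi * a * n / k) * Real.sin (Real.pi * b * n / k)
        * Real.sin (Real.pi * c * n / k) * (Real.sin (Real.pi * n / k))⁻¹
      = k / 2 * (open Classical in if IsAdmissibleTriple k a b c then 1 else 0) := by
  have hk : 1 ≤ k := by omega
  have h1 : ∀ n ∈ Finset.range k,
      Real.sin (Real.pi * a * n / k) * Real.sin (Real.pi * b * n / k)
        * Real.sin (Real.pi * c * n / k) * (Real.sin (Real.pi * n / k))⁻¹
      = ∑ i ∈ Finset.range b, Real.sin (Real.pi * ((a : ℤ) - b + 1 + 2 * i : ℤ) * n / k) *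
          Real.sin (Real.pi * (c : ℤ) * n / k) := by
    intro n hn
    rw [Finset.mem_range] at hn
    rcases Nat.eq_zero_or_pos n with rfl | hpos
    · simp
    have hs := (sin_pos_of_color hpos hn).ne'
    have := sin_mul_sin_eq_sum a b (Real.pi * n / k)
    rw [show Real.pi * a * n / k = a * (Real.pi * n / k) by ring,
      show Real.pi * b * n / k = b * (Real.pi * n / k) by ring, this, ← Finset.sum_mul]
    have e : ∀ i : ℕ, Real.sin (Real.pi * ((a : ℤ) - b + 1 + 2 * i : ℤ) * n / k)
        = Real.sin (((a : ℤ) - b + 1 + 2 * i : ℤ) * (Real.pi * n / k)) := by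
      intro i; congr 1; ring
    simp only [e, Int.cast_natCast]
    field_simp
  rw [Finset.sum_congr rfl h1, Finset.sum_comm]
  simp only [sum_sin_mul_sin k hk]
  rw [← Finset.mul_sum]
  congr 1
  have e1 : ∀ i ∈ Finset.range b,
      ((if (2 * k : ℤ) ∣ ((a : ℤ) - b + 1 + 2 * i) - c then (1 : ℝ) else 0)
        - if (2 * k : ℤ) ∣ ((a : ℤ) - b + 1 + 2 * i) + c then (1 : ℝ) else 0)
      = ((if (a : ℤ) - b + 1 + 2 * i = c then (1 : ℝ) else 0)
        - if (a : ℤ) - b + 1 + 2 * i = - c then (1 : ℝ) else 0)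
        - (if (a : ℤ) - b + 1 + 2 * i = 2 * k - c then (1 : ℝ) else 0) := by
    intro i hi
    rw [Finset.mem_range] at hi
    have d1 : (2 * k : ℤ) ∣ ((a : ℤ) - b + 1 + 2 * i) - c ↔ (a : ℤ) - b + 1 + 2 * i = c := by
      constructor
      · rintro ⟨t, ht⟩
        have : t = 0 := by
          have h2 : t < 1 := by by_contra! h; nlinarith
          have h3 : -1 < t := by by_contra! h; nlinarith
          omega
        subst this; omega
      · intro h; rw [h]; simp
    have d2 : (2 * k : ℤ) ∣ ((a : ℤ) - b + 1 + 2 * i) + c ↔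
        ((a : ℤ) - b + 1 + 2 * i = -c ∨ (a : ℤ) - b + 1 + 2 * i = 2 * k - c) := by
      constructor
      · rintro ⟨t, ht⟩
        have : t = 0 ∨ t = 1 := by
          have h2 : t < 2 := by by_contra! h; nlinarith
          have h3 : -1 < t := by by_contra! h; nlinarith
          omega
        rcases this with rfl | rfl
        · left; omega
        · right; omega
      · rintro (h | h)
        · rw [h]; simp
        · rw [h]; simp
    simp only [d1, d2]
    split_ifs <;> first | omega | norm_num
  rw [Finset.sum_congr rfl e1, Finset.sum_sub_distrib, Finset.sum_sub_distrib]
  have cnt : ∀ x : ℤ, ∑ i ∈ Finset.range b, (if (a : ℤ) - b + 1 + 2 * i = x then (1 : ℝ) else 0)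
      = if (Odd (x + a + b) ∧ (a : ℤ) - b < x ∧ x < a + b) then 1 else 0 := by
    intro x
    split_ifs with h
    · obtain ⟨⟨m, hm⟩, h1, h2⟩ := h
      rw [Finset.sum_eq_single ((m - a).toNat)]
      · rw [if_pos (by omega)]
      · intro i _ hne
        rw [if_neg (by omega)]
      · intro hnm
        rw [Finset.mem_range] at hnm
        omega
    · apply Finset.sum_eq_zero
      intro i hi
      rw [Finset.mem_range] at hi
      rw [if_neg]
      intro hx
      exact h ⟨⟨a + i, by omega⟩, by omega, by omega⟩
  rw [cnt, cnt, cnt]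
  simp only [IsAdmissibleTriple, Int.odd_iff, Nat.odd_iff]
  split_ifs <;> first | omega | norm_num

/-! ### Sums over the edges of a trivalent graph -/

section Gluing

variable {g : ℕ} (G : PantsDecomposition g)

/-- One circle of each pair of circles glued together. -/
def edges : Finset (Fin (2 * g - 1) × Fin 3) :=
  Finset.univ.filter fun h => toLex h < toLex (G.glue h)

lemma mem_edges {h : Fin (2 * g - 1) × Fin 3} : h ∈ edges G ↔ toLex h < toLex (G.glue h) := by
  simp [edges]

lemma bdry_notMem_edges : G.bdry ∉ edges G := by
  rw [mem_edges, (G.glue_eq_self_iff _).2 rfl]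
  exact lt_irrefl _

lemma glue_mem_edges_iff {h : Fin (2 * g - 1) × Fin 3} (hb : h ≠ G.bdry) :
    G.glue h ∈ edges G ↔ h ∉ edges G := by
  have hne : G.glue h ≠ h := fun e => hb ((G.glue_eq_self_iff h).1 e)
  rw [mem_edges, mem_edges, G.glue_glue, not_lt]
  exact ⟨le_of_lt, fun hle => lt_of_le_of_ne hle fun e => hne (toLex.injective e)⟩

lemma ne_bdry_of_mem_edges {h : Fin (2 * g - 1) × Fin 3} (hh : h ∈ edges G) : h ≠ G.bdry :=
  fun e => bdry_notMem_edges G (e ▸ hh)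

/-- A product over all circles groups the circles glued together. -/
lemma prod_circles (φ : Fin (2 * g - 1) × Fin 3 → ℝ) :
    ∏ h, φ h = φ G.bdry * ∏ h ∈ edges G, (φ h * φ (G.glue h)) := by
  classical
  have hcompl : (edges G)ᶜ = insert G.bdry ((edges G).image G.glue) := by
    ext h
    rw [Finset.mem_compl, Finset.mem_insert, Finset.mem_image]
    constructor
    · intro hh
      by_cases hb : h = G.bdry
      · exact Or.inl hb
      · exact Or.inr ⟨G.glue h, (glue_mem_edges_iff G hb).2 hh, G.glue_glue h⟩
    · rintro (rfl | ⟨h', h1, rfl⟩)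
      · exact bdry_notMem_edges G
      · rw [glue_mem_edges_iff G (ne_bdry_of_mem_edges G h1)]
        exact fun h2 => h2 h1
  have hnot : G.bdry ∉ (edges G).image G.glue := by
    intro hm
    obtain ⟨h', h1, h2⟩ := Finset.mem_image.1 hm
    have : h' = G.bdry := by
      rw [← G.glue_glue h', h2, (G.glue_eq_self_iff _).2 rfl]
    exact ne_bdry_of_mem_edges G h1 this
  rw [← Finset.prod_mul_prod_compl (edges G), hcompl, Finset.prod_insert hnot,
    Finset.prod_image (fun x _ y _ hxy => by rw [← G.glue_glue x, hxy, G.glue_glue]),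
    Finset.prod_mul_distrib]
  ring

/-- Colorings compatible with the gluing, with prescribed color on the boundary, are the same as
functions on the edges. -/
def coloringEquiv {K : Type*} (l : K) :
    {c : Fin (2 * g - 1) × Fin 3 → K // (∀ h, c (G.glue h) = c h) ∧ c G.bdry = l}
      ≃ (edges G → K) where
  toFun c h := c.1 h.1
  invFun d := ⟨fun h => if hh : h ∈ edges G then d ⟨h, hh⟩ else
    if hg : G.glue h ∈ edges G then d ⟨G.glue h, hg⟩ else l, by
      constructor
      · intro h
        by_cases hb : h = G.bdry
        · subst hb
          rw [(G.glue_eq_self_iff _).2 rfl]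
        · by_cases hh : h ∈ edges G
          · have : G.glue h ∉ edges G := fun h' => (glue_mem_edges_iff G hb).1 h' hh
            simp [hh, this, G.glue_glue]
          · have := (glue_mem_edges_iff G hb).2 hh
            simp [hh, this]
      · have h1 := bdry_notMem_edges G
        have h2 : G.glue G.bdry ∉ edges G := by rwa [(G.glue_eq_self_iff _).2 rfl]
        simp [h1, h2]⟩
  left_inv := by
    rintro ⟨c, hc, hl⟩
    ext h
    simp only
    split_ifs with h1 h2
    · rfl
    · exact hc h
    · by_cases hb : h = G.bdry
      · rw [hb, hl]
      · exact absurd ((glue_mem_edges_iff G hb).2 h1) h2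
  right_inv := by
    intro d
    ext h
    simp

/-- A function of the vertices, compatible with all the gluings, is constant. -/
lemma eq_of_compatible {K : Type*} (ν : Fin (2 * g - 1) → K)
    (hν : ∀ h ∈ edges G, ν h.1 = ν (G.glue h).1) (v w : Fin (2 * g - 1)) : ν v = ν w := by
  induction G.connected v w with
  | refl => rfl
  | @tail b c _ hstep ih =>
    obtain ⟨i, rfl⟩ := hstep
    rw [ih]
    by_cases hb : (b, i) = G.bdry
    · rw [(G.glue_eq_self_iff (b, i)).2 hb]
    · by_cases hh : (b, i) ∈ edges G
      · exact hν _ hh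
      · have := hν _ ((glue_mem_edges_iff G hb).2 hh)
        rw [G.glue_glue] at this
        exact this.symm

/-- Gluing: if the fusion coefficients are diagonalized by an orthogonal matrix `S`, the number of
admissible colorings is given by a single sum over the spectrum. -/
lemma sum_colorings {K : Type*} [Fintype K] [DecidableEq K] (hg : 1 ≤ g) (S : K → K → ℝ)
    (w : K → ℝ) (A : K → K → K → ℝ) (hA : ∀ a b c, ∑ n, S a n * S b n * S c n * w n = A a b c)
    (hS : ∀ m n, ∑ c, S c m * S c n = if m = n ∧ w m ≠ 0 then 1 else 0) (l : K) :
    ∑ c : {c : Fin (2 * g - 1) × Fin 3 → K // (∀ h, c (G.glue h) = c h) ∧ c G.bdry = l},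
        ∏ v, A (c.1 (v, 0)) (c.1 (v, 1)) (c.1 (v, 2))
      = ∑ n, S l n * w n ^ (2 * g - 1) := by
  classical
  have hpos : 0 < 2 * g - 1 := by omega
  set v0 : Fin (2 * g - 1) := ⟨0, hpos⟩
  have h1 : ∀ c : Fin (2 * g - 1) × Fin 3 → K, ∏ v, A (c (v, 0)) (c (v, 1)) (c (v, 2))
      = ∑ ν : Fin (2 * g - 1) → K, (∏ v, w (ν v)) * ∏ h, S (c h) (ν h.1) := by
    intro c
    simp only [← hA]
    rw [Finset.prod_univ_sum, Fintype.piFinset_univ]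
    refine Finset.sum_congr rfl fun ν _ => ?_
    rw [Fintype.prod_prod_type, ← Finset.prod_mul_distrib]
    refine Finset.prod_congr rfl fun v _ => ?_
    rw [Fin.prod_univ_three]
    ring
  simp only [h1]
  rw [Finset.sum_comm]
  have h2 : ∀ ν : Fin (2 * g - 1) → K,
      ∑ c : {c : Fin (2 * g - 1) × Fin 3 → K // (∀ h, c (G.glue h) = c h) ∧ c G.bdry = l},
        (∏ v, w (ν v)) * ∏ h, S (c.1 h) (ν h.1)
      = (∏ v, w (ν v)) * (S l (ν G.bdry.1) *
          ∏ h ∈ edges G, if ν h.1 = ν (G.glue h).1 ∧ w (ν h.1) ≠ 0 then 1 else 0) := by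
    intro ν
    rw [← Finset.mul_sum]
    congr 1
    have h3 : ∀ c : {c : Fin (2 * g - 1) × Fin 3 → K // (∀ h, c (G.glue h) = c h) ∧ c G.bdry = l},
        ∏ h, S (c.1 h) (ν h.1)
        = S l (ν G.bdry.1) * ∏ h : edges G, (S (coloringEquiv G l c h) (ν h.1.1)
          * S (coloringEquiv G l c h) (ν (G.glue h.1).1)) := by
      rintro ⟨c, hc, hl⟩
      rw [prod_circles G, Finset.prod_coe_sort_eq_attach, ← Finset.prod_attach]
      simp only [coloringEquiv, Equiv.coe_fn_mk, hl, hc]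
    simp only [h3]
    rw [← Finset.mul_sum, Equiv.sum_comp (coloringEquiv G l) (fun d : edges G → K =>
      ∏ h : edges G, (S (d h) (ν h.1.1) * S (d h) (ν (G.glue h.1).1)))]
    congr 1
    have h4 := Finset.prod_univ_sum (fun _ : edges G => (Finset.univ : Finset K))
      (fun h c => S c (ν h.1.1) * S c (ν (G.glue h.1).1))
    rw [Fintype.piFinset_univ] at h4
    rw [← h4]
    simp only [hS]
    exact Finset.prod_coe_sort (edges G)
      (fun h => if ν h.1 = ν (G.glue h).1 ∧ w (ν h.1) ≠ 0 then (1 : ℝ) else 0)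
  simp only [h2]
  rw [← Finset.sum_subset (Finset.subset_univ
    (Finset.univ.image (fun n : K => fun _ : Fin (2 * g - 1) => n)))]
  · rw [Finset.sum_image]
    · refine Finset.sum_congr rfl fun n _ => ?_
      rw [Finset.prod_const, Finset.card_univ, Fintype.card_fin]
      by_cases hw : w n = 0
      · rw [hw, zero_pow hpos.ne']
        simp
      · simp [hw]
        ring
    · intro m _ n _ hmn
      exact congrFun hmn v0
  · intro ν _ hν
    by_contra hne
    apply hν
    rw [Finset.mem_image]
    refine ⟨ν v0, Finset.mem_univ _, ?_⟩
    ext v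
    refine eq_of_compatible G ν (fun h hh => ?_) v0 v
    have h5 := (mul_ne_zero_iff.1 (mul_ne_zero_iff.1 hne).2).2
    rw [Finset.prod_ne_zero_iff] at h5
    by_contra hcon
    exact h5 h hh (if_neg (fun h6 => hcon h6.1))

end Gluing

/-- **Verlinde's formula** for a surface of genus `g` with one marked point. -/
lemma verlindeNumber_eq {g : ℕ} (hg : 1 ≤ g) (G : PantsDecomposition g) {k l : ℕ} (hl : l < k) :
    (verlindeNumber G k l : ℝ) = ((k : ℝ) / 2) ^ (g - 1) *
      ∑ n ∈ Finset.range k,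
        Real.sin (Real.pi * l * n / k) * (Real.sin (Real.pi * n / k) ^ (2 * g - 1))⁻¹ := by
  classical
  have hk : 1 ≤ k := by omega
  have hk0 : (0 : ℝ) < k := by exact_mod_cast hk
  set r : ℝ := Real.sqrt (2 / k) with hr
  have hr2 : r * r = 2 / k := Real.mul_self_sqrt (by positivity)
  have hr0 : r ≠ 0 := by
    intro h
    rw [h] at hr2
    have : (0 : ℝ) < 2 / k := by positivity
    linarith
  set S : Fin k → Fin k → ℝ := fun a n => r * Real.sin (Real.pi * (a : ℕ) * (n : ℕ) / k) with hSdef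
  set w : Fin k → ℝ := fun n => (r * Real.sin (Real.pi * (n : ℕ) / k))⁻¹ with hwdef
  have hw : ∀ n : Fin k, w n ≠ 0 ↔ 1 ≤ (n : ℕ) := by
    intro n
    rw [hwdef]
    constructor
    · intro h
      by_contra! h'
      have : (n : ℕ) = 0 := by omega
      simp [this] at h
    · intro h
      exact inv_ne_zero (mul_ne_zero hr0 (sin_pos_of_color h n.2).ne')
  set A : Fin k → Fin k → Fin k → ℝ :=
    fun a b c => if IsAdmissibleTriple k a b c then 1 else 0 with hAdef
  have hA : ∀ a b c, ∑ n, S a n * S b n * S c n * w n = A a b c := by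
    intro a b c
    have h := sum_sin_eq_fusion k a b c a.2 b.2 c.2
    rw [← Fin.sum_univ_eq_sum_range (fun n : ℕ => Real.sin (Real.pi * (a : ℕ) * n / k) *
      Real.sin (Real.pi * (b : ℕ) * n / k)
        * Real.sin (Real.pi * (c : ℕ) * n / k) * (Real.sin (Real.pi * n / k))⁻¹)] at h
    have h' : A a b c = (2 / k) * (k / 2 * A a b c) := by field_simp
    rw [h', hAdef]
    simp only
    rw [← h, Finset.mul_sum]
    refine Finset.sum_congr rfl fun n _ => ?_
    rw [hSdef, hwdef, ← hr2]
    simp only [mul_inv]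
    field_simp
  have hS : ∀ m n, ∑ c, S c m * S c n = if m = n ∧ w m ≠ 0 then 1 else 0 := by
    intro m n
    have h := sum_sin_mul_sin k hk (m : ℕ) (n : ℕ)
    rw [← Fin.sum_univ_eq_sum_range (fun c : ℕ => Real.sin (Real.pi * ((m : ℕ) : ℤ) * c / k) *
      Real.sin (Real.pi * ((n : ℕ) : ℤ) * c / k))] at h
    have d1 : (2 * k : ℤ) ∣ ((m : ℕ) : ℤ) - (n : ℕ) ↔ m = n := by
      constructor
      · intro hd
        have := Int.eq_zero_of_abs_lt_dvd hd (by rw [abs_lt]; have := m.2; have := n.2; omega)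
        ext; omega
      · rintro rfl; simp
    have d2 : (2 * k : ℤ) ∣ ((m : ℕ) : ℤ) + (n : ℕ) ↔ ((m : ℕ) = 0 ∧ (n : ℕ) = 0) := by
      constructor
      · intro hd
        have := Int.eq_zero_of_abs_lt_dvd hd (by rw [abs_lt]; have := m.2; have := n.2; omega)
        omega
      · rintro ⟨h1, h2⟩; rw [h1, h2]; simp
    have e : ∑ c, S c m * S c n = (2 / k) * ∑ c : Fin k,
        Real.sin (Real.pi * ((m : ℕ) : ℤ) * (c : ℕ) / k) *
          Real.sin (Real.pi * ((n : ℕ) : ℤ) * (c : ℕ) / k) := by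
      rw [Finset.mul_sum]
      refine Finset.sum_congr rfl fun c _ => ?_
      rw [hSdef, ← hr2]
      simp only [Int.cast_natCast]
      rw [show Real.pi * (c : ℕ) * (m : ℕ) / k = Real.pi * (m : ℕ) * (c : ℕ) / k by ring,
        show Real.pi * (c : ℕ) * (n : ℕ) / k = Real.pi * (n : ℕ) * (c : ℕ) / k by ring]
      ring
    rw [e, h]
    simp only [d1, d2, hw]
    rw [← mul_assoc, show (2 / k : ℝ) * (k / 2) = 1 by field_simp, one_mul]
    by_cases hmn : m = n
    · subst hmn
      by_cases h0 : (m : ℕ) = 0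
      · simp [h0]
      · have : 1 ≤ (m : ℕ) := by omega
        simp [this, h0]
    · have : ¬ ((m : ℕ) = 0 ∧ (n : ℕ) = 0) := fun h => hmn (Fin.ext (by omega))
      simp [hmn, this]
  have key := sum_colorings G hg S w A hA hS ⟨l, hl⟩
  have hcard : (verlindeNumber G k l : ℝ)
      = ∑ c : {c : Fin (2 * g - 1) × Fin 3 → Fin k // (∀ h, c (G.glue h) = c h)
          ∧ c G.bdry = ⟨l, hl⟩}, ∏ v, A (c.1 (v, 0)) (c.1 (v, 1)) (c.1 (v, 2)) := by
    have hprod : ∀ c : {c : Fin (2 * g - 1) × Fin 3 → Fin k // (∀ h, c (G.glue h) = c h)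
          ∧ c G.bdry = ⟨l, hl⟩}, ∏ v, A (c.1 (v, 0)) (c.1 (v, 1)) (c.1 (v, 2))
        = if ∀ v, IsAdmissibleTriple k (c.1 (v, 0)) (c.1 (v, 1)) (c.1 (v, 2)) then 1 else 0 := by
      intro c
      simp [hAdef, Finset.prod_boole]
    rw [Finset.sum_congr rfl fun c _ => hprod c, Finset.sum_boole, Nat.cast_inj, verlindeNumber,
      ← Fintype.card_subtype, ← Nat.card_eq_fintype_card]
    refine Nat.card_congr ⟨fun c => ⟨⟨c.1, c.2.2.1, Fin.ext c.2.2.2.1⟩, c.2.2.2.2⟩,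
      fun c => ⟨c.1.1, ?_, c.1.2.1, ?_, c.2⟩, fun _ => rfl, fun _ => rfl⟩
    · rintro ⟨v, i⟩
      have := c.2 v
      unfold IsAdmissibleTriple at this
      fin_cases i <;> simp only [Fin.zero_eta, Fin.mk_one, Fin.reduceFinMk] <;> omega
    · rw [c.1.2.2]
  rw [hcard, key, Finset.mul_sum,
    ← Fin.sum_univ_eq_sum_range (fun n : ℕ => ((k : ℝ) / 2) ^ (g - 1) *
      (Real.sin (Real.pi * l * n / k) * (Real.sin (Real.pi * n / k) ^ (2 * g - 1))⁻¹))]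
  refine Finset.sum_congr rfl fun n _ => ?_
  rw [hSdef, hwdef]
  simp only
  have hpow : r * (r ^ (2 * g - 1))⁻¹ = (k / 2) ^ (g - 1) := by
    obtain ⟨h, rfl⟩ : ∃ h, g = h + 1 := ⟨g - 1, by omega⟩
    rw [show 2 * (h + 1) - 1 = 2 * h + 1 by omega, pow_succ, pow_mul, sq, hr2, Nat.add_sub_cancel,
      mul_inv, ← inv_pow, inv_div]
    field_simp
  rw [inv_pow, mul_pow, mul_inv, ← hpow]
  ring

/-! ### Verlinde numbers as polynomials -/

/-- The sums of Verlinde's formula, with a colour `l` that may be any integer. -/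
noncomputable def sineSum (s k : ℕ) (l : ℤ) : ℝ :=
  ∑ n ∈ Finset.range k, Real.sin (Real.pi * l * n / k) * (Real.sin (Real.pi * n / k) ^ s)⁻¹

lemma sineSum_neg (s k : ℕ) (l : ℤ) : sineSum s k (-l) = - sineSum s k l := by
  rw [sineSum, sineSum, ← Finset.sum_neg_distrib]
  refine Finset.sum_congr rfl fun n _ => ?_
  push_cast
  rw [show Real.pi * -(l : ℝ) * n / k = -(Real.pi * l * n / k) by ring, Real.sin_neg]
  ring

lemma sineSum_add_period (s k : ℕ) (l j : ℤ) : sineSum s k (l + 2 * k * j) = sineSum s k l := by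
  rw [sineSum, sineSum]
  refine Finset.sum_congr rfl fun n hn => ?_
  have hk : (k : ℝ) ≠ 0 := by
    rw [Finset.mem_range] at hn
    exact_mod_cast (by omega : k ≠ 0)
  push_cast
  rw [show Real.pi * ((l : ℝ) + 2 * k * j) * n / k
    = Real.pi * l * n / k + (j * n : ℤ) * (2 * Real.pi) by push_cast; field_simp,
    Real.sin_add_int_mul_two_pi]

lemma sineSum_period_sub (s k : ℕ) (l : ℤ) : sineSum s k (2 * k - l) = - sineSum s k l := by
  rw [← sineSum_neg, ← sineSum_add_period s k (-l) 1]
  congr 1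
  ring

/-- The reflection `n ↦ k - n` shows that the sum vanishes when the colour is even. -/
lemma sineSum_even (s k : ℕ) (l : ℤ) (hl : Even l) : sineSum s k l = 0 := by
  rcases Nat.eq_zero_or_pos k with rfl | hk
  · simp [sineSum]
  have hk0 : (k : ℝ) ≠ 0 := by exact_mod_cast hk.ne'
  obtain ⟨k', rfl⟩ : ∃ k', k = k' + 1 := ⟨k - 1, by omega⟩
  obtain ⟨m, rfl⟩ := hl
  have h : sineSum s (k' + 1) (m + m) = - sineSum s (k' + 1) (m + m) := by
    rw [sineSum, Finset.sum_range_succ']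
    simp only [Nat.cast_zero, mul_zero, zero_div, Real.sin_zero, zero_mul, add_zero]
    conv_lhs => rw [← Finset.sum_range_reflect]
    rw [← Finset.sum_neg_distrib]
    refine Finset.sum_congr rfl fun n hn => ?_
    rw [Finset.mem_range] at hn
    have e : ((k' - 1 - n + 1 : ℕ) : ℝ) = (k' + 1 : ℕ) - (n + 1 : ℕ) := by
      rw [← Nat.cast_sub (by omega)]
      congr 1
      omega
    rw [e, show Real.pi * ((k' + 1 : ℕ) - (n + 1 : ℕ) : ℝ) / (k' + 1 : ℕ)
      = Real.pi - Real.pi * (n + 1 : ℕ) / (k' + 1 : ℕ) by field_simp, Real.sin_pi_sub,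
      show Real.pi * (m + m : ℤ) * ((k' + 1 : ℕ) - (n + 1 : ℕ) : ℝ) / (k' + 1 : ℕ)
        = m * (2 * Real.pi) - Real.pi * (m + m : ℤ) * (n + 1 : ℕ) / (k' + 1 : ℕ) by
        push_cast; field_simp; ring,
      Real.sin_int_mul_two_pi_sub]
    ring
  linarith

lemma sineSum_second_difference (s k : ℕ) (l : ℤ) :
    sineSum (s + 2) k (l + 2) - 2 * sineSum (s + 2) k l + sineSum (s + 2) k (l - 2)
      = -4 * sineSum s k l := by
  simp only [sineSum, Finset.mul_sum]
  rw [← Finset.sum_sub_distrib, ← Finset.sum_add_distrib]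
  refine Finset.sum_congr rfl fun n hn => ?_
  rw [Finset.mem_range] at hn
  rcases Nat.eq_zero_or_pos n with rfl | hpos
  · simp
  have hs := (sin_pos_of_color hpos hn).ne'
  set θ := Real.pi * n / k with hθ
  push_cast
  rw [show Real.pi * ((l : ℝ) + 2) * n / k = Real.pi * l * n / k + 2 * θ by rw [hθ]; ring,
    show Real.pi * ((l : ℝ) - 2) * n / k = Real.pi * l * n / k - 2 * θ by rw [hθ]; ring,
    Real.sin_add, Real.sin_sub, Real.cos_two_mul, pow_add]
  have h2 := Real.sin_sq_add_cos_sq θ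
  have h3 : Real.cos θ ^ 2 = 1 - Real.sin θ ^ 2 := by linarith
  rw [h3]
  field_simp
  ring

lemma sineSum_one (k : ℕ) (i : ℕ) (hi : i < k) :
    sineSum 1 k (2 * i + 1) = -(((2 * i + 1 : ℤ) : ℝ) - k) := by
  have hk : 1 ≤ k := by omega
  have hk0 : (k : ℝ) ≠ 0 := by exact_mod_cast (by omega : k ≠ 0)
  induction i with
  | zero =>
    have : ∀ n ∈ Finset.range k, Real.sin (Real.pi * ((2 * (0 : ℕ) + 1 : ℤ) : ℝ) * n / k) *
        (Real.sin (Real.pi * n / k) ^ 1)⁻¹ = 1 - if n = 0 then 1 else 0 := by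
      intro n hn
      rw [Finset.mem_range] at hn
      rcases Nat.eq_zero_or_pos n with rfl | hpos
      · simp
      have hs := (sin_pos_of_color hpos hn).ne'
      rw [if_neg hpos.ne']
      simp [hs]
    rw [sineSum, Finset.sum_congr rfl this, Finset.sum_sub_distrib]
    have h0 : 0 < k := hk
    simp [h0]
  | succ i ih =>
    have ih := ih (by omega)
    have hd : sineSum 1 k (2 * (i + 1 : ℕ) + 1) - sineSum 1 k (2 * i + 1) = -2 := by
      simp only [sineSum]
      rw [← Finset.sum_sub_distrib]
      have h1 : ∀ n ∈ Finset.range k, Real.sin (Real.pi * ((2 * (i + 1 : ℕ) + 1 : ℤ) : ℝ) * n / k) *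
          (Real.sin (Real.pi * n / k) ^ 1)⁻¹ - Real.sin (Real.pi * ((2 * i + 1 : ℤ) : ℝ) * n / k) *
          (Real.sin (Real.pi * n / k) ^ 1)⁻¹
          = 2 * Real.cos (Real.pi * (2 * (i + 1) : ℤ) * n / k) - if n = 0 then 2 else 0 := by
        intro n hn
        rw [Finset.mem_range] at hn
        rcases Nat.eq_zero_or_pos n with rfl | hpos
        · simp
        have hs := (sin_pos_of_color hpos hn).ne'
        rw [if_neg hpos.ne']
        set θ := Real.pi * n / k with hθ
        push_cast
        rw [show Real.pi * (2 * ((i : ℝ) + 1) + 1) * n / k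
            = Real.pi * (2 * ((i : ℝ) + 1)) * n / k + θ by rw [hθ]; ring,
          show Real.pi * (2 * (i : ℝ) + 1) * n / k
            = Real.pi * (2 * ((i : ℝ) + 1)) * n / k - θ by rw [hθ]; ring,
          Real.sin_add, Real.sin_sub]
        field_simp
        ring
      rw [Finset.sum_congr rfl h1, Finset.sum_sub_distrib, ← Finset.mul_sum]
      have h2 := sum_cos_eq k hk (2 * (i + 1))
      rw [two_mul k, Finset.sum_range_add] at h2
      have h3 : ∀ n ∈ Finset.range k, Real.cos (Real.pi * (2 * ((i : ℤ) + 1) : ℤ) * (k + n : ℕ) / k)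
          = Real.cos (Real.pi * (2 * ((i : ℤ) + 1) : ℤ) * n / k) := by
        intro n _
        push_cast
        rw [show Real.pi * (2 * ((i : ℝ) + 1)) * (k + n) / k
          = Real.pi * (2 * ((i : ℝ) + 1)) * n / k + (i + 1 : ℕ) * (2 * Real.pi) by
            push_cast; field_simp; ring, Real.cos_add_nat_mul_two_pi]
      rw [Finset.sum_congr rfl h3, if_neg] at h2
      · have h0 : 0 < k := hk
        simp only [Finset.sum_ite_eq', Finset.mem_range, h0, if_true]
        linarith
      · intro hdvd
        have := Int.le_of_dvd (by omega) hdvd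
        omega
    push_cast at hd ih ⊢
    linarith

/-! ### Inverting the second difference operator on odd polynomials -/

/-- The odd central factorial polynomial `y (y² - 4) (y² - 16) ⋯`. -/
def centralFactorial : ℕ → ℝ → ℝ
  | 0, y => y
  | b + 1, y => centralFactorial b y * (y ^ 2 - (2 * (b + 1 : ℝ)) ^ 2)

/-- The even polynomial `(x² - 1) (x² - 9) ⋯`. -/
def evenFactorial : ℕ → ℝ → ℝ
  | 0, _ => 1
  | b + 1, x => evenFactorial b x * (x ^ 2 - (2 * (b : ℝ) + 1) ^ 2)

lemma centralFactorial_neg (b : ℕ) (y : ℝ) : centralFactorial b (-y) = -centralFactorial b y := by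
  induction b with
  | zero => rfl
  | succ b ih => rw [centralFactorial, centralFactorial, ih]; ring

lemma centralFactorial_add_two (b : ℕ) (y : ℝ) :
    centralFactorial b (y + 2) * (y - 2 * b) = centralFactorial b y * (y + 2 * b + 2) := by
  induction b with
  | zero => simp [centralFactorial]; ring
  | succ b ih =>
    rw [centralFactorial, centralFactorial]
    push_cast
    linear_combination ((y + 2 * b + 4) * (y - 2 * (b + 1))) * ih

lemma centralFactorial_succ_add_two (b : ℕ) (y : ℝ) :
    centralFactorial (b + 1) (y + 2) = centralFactorial b y * (y + 2 * b + 2) * (y + 2 * b + 4) := by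
  rw [centralFactorial, ← centralFactorial_add_two]
  ring

lemma centralFactorial_second_difference (b : ℕ) (y : ℝ) :
    centralFactorial (b + 1) (y + 2) - 2 * centralFactorial (b + 1) y
      + centralFactorial (b + 1) (y - 2)
      = 4 * (2 * b + 2) * (2 * b + 3) * centralFactorial b y := by
  have h := centralFactorial_succ_add_two b (-y)
  rw [show -y + 2 = -(y - 2) by ring, centralFactorial_neg, centralFactorial_neg] at h
  have h' : centralFactorial (b + 1) (y - 2)
      = centralFactorial b y * (-y + 2 * b + 2) * (-y + 2 * b + 4) := by linarith
  rw [centralFactorial_succ_add_two, h', centralFactorial]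
  ring

lemma centralFactorial_add_one (b : ℕ) (x : ℝ) :
    centralFactorial b (x + 1) = evenFactorial b x * (x + (2 * b + 1)) := by
  induction b with
  | zero => simp [centralFactorial, evenFactorial]
  | succ b ih =>
    rw [centralFactorial, evenFactorial, ih]
    push_cast
    ring

lemma evenFactorial_neg (b : ℕ) (x : ℝ) : evenFactorial b (-x) = evenFactorial b x := by
  induction b with
  | zero => rfl
  | succ b ih => rw [evenFactorial, evenFactorial, ih]; ring

lemma centralFactorial_symm_sum (b : ℕ) (x : ℝ) :
    centralFactorial b (x + 1) + centralFactorial b (x - 1) = 2 * x * evenFactorial b x := by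
  have h := centralFactorial_add_one b (-x)
  rw [show -x + 1 = -(x - 1) by ring, centralFactorial_neg, evenFactorial_neg] at h
  rw [centralFactorial_add_one, show centralFactorial b (x - 1)
    = - (evenFactorial b x * (-x + (2 * b + 1))) by linarith]
  ring

/-- The span of the `k^(2a) p_b(y)`, `a + b < g`, with `p_b` the central factorials. -/
def factorialSpan (g : ℕ) : Submodule ℝ (ℝ → ℝ → ℝ) :=
  Submodule.span ℝ {f | ∃ a b : ℕ, a + b < g ∧ f = fun k y => k ^ (2 * a) * centralFactorial b y}

/-- The span of the monomials `k^(2a) y^(2b+1)`, `a + b < g`. -/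
def monomialSpan (g : ℕ) : Submodule ℝ (ℝ → ℝ → ℝ) :=
  Submodule.span ℝ {f | ∃ a b : ℕ, a + b < g ∧ f = fun k y => k ^ (2 * a) * y ^ (2 * b + 1)}

lemma evenFactorial_mem_factorialSpan (b : ℕ) : ∀ a g : ℕ, a + b < g →
    (fun k y => k ^ (2 * a) * evenFactorial b k * y) ∈ factorialSpan g := by
  induction b with
  | zero =>
    intro a g h
    refine Submodule.subset_span ⟨a, 0, h, ?_⟩
    ext k y
    simp [evenFactorial, centralFactorial]
  | succ b ih =>
    intro a g h
    have h1 := ih (a + 1) g (by omega)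
    have h2 := Submodule.smul_mem _ ((2 * (b : ℝ) + 1) ^ 2) (ih a g (by omega))
    convert Submodule.sub_mem _ h1 h2 using 1
    ext k y
    simp only [Pi.sub_apply, Pi.smul_apply, smul_eq_mul, evenFactorial]
    ring

lemma centralFactorial_mem_monomialSpan (b : ℕ) : ∀ a c g : ℕ, a + b + c < g →
    (fun k y => k ^ (2 * a) * (centralFactorial b y * y ^ (2 * c))) ∈ monomialSpan g := by
  induction b with
  | zero =>
    intro a c g h
    refine Submodule.subset_span ⟨a, c, by omega, ?_⟩
    ext k y
    simp only [centralFactorial]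
    ring
  | succ b ih =>
    intro a c g h
    have h1 := ih a (c + 1) g (by omega)
    have h2 := Submodule.smul_mem _ ((2 * ((b : ℝ) + 1)) ^ 2) (ih a c g (by omega))
    convert Submodule.sub_mem _ h1 h2 using 1
    ext k y
    simp only [Pi.sub_apply, Pi.smul_apply, smul_eq_mul, centralFactorial]
    ring

lemma factorialSpan_le_monomialSpan (g : ℕ) : factorialSpan g ≤ monomialSpan g := by
  rw [factorialSpan, Submodule.span_le]
  rintro f ⟨a, b, h, rfl⟩
  have := centralFactorial_mem_monomialSpan b a 0 g (by omega)
  simpa using this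

lemma neg_of_mem_factorialSpan {g : ℕ} {f : ℝ → ℝ → ℝ} (hf : f ∈ factorialSpan g) (k y : ℝ) :
    f k (-y) = - f k y := by
  induction hf using Submodule.span_induction with
  | mem x h =>
    obtain ⟨a, b, -, rfl⟩ := h
    simp only [centralFactorial_neg]
    ring
  | zero => simp
  | add x y _ _ hx hy => simp only [Pi.add_apply, hx, hy]; ring
  | smul a x _ hx => simp only [Pi.smul_apply, smul_eq_mul, hx]; ring

/-- The second difference equation, with the boundary condition satisfied by Verlinde numbers. -/
lemma exists_second_difference_eq {g : ℕ} {f : ℝ → ℝ → ℝ} (hf : f ∈ factorialSpan g) :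
    ∃ F ∈ factorialSpan (g + 1), (∀ k y, F k (y + 2) - 2 * F k y + F k (y - 2) = f k y) ∧
      ∀ k, F k (k + 1) + F k (k - 1) = 0 := by
  induction hf using Submodule.span_induction with
  | mem x h =>
    obtain ⟨a, b, hab, rfl⟩ := h
    set c : ℝ := 4 * (2 * b + 2) * (2 * b + 3) with hc
    have hc0 : c ≠ 0 := by positivity
    refine ⟨c⁻¹ • ((fun k y => k ^ (2 * a) * centralFactorial (b + 1) y)
      - fun k y => k ^ (2 * a) * evenFactorial (b + 1) k * y), ?_, ?_, ?_⟩
    · refine Submodule.smul_mem _ _ (Submodule.sub_mem _ ?_ ?_)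
      · exact Submodule.subset_span ⟨a, b + 1, by omega, rfl⟩
      · exact evenFactorial_mem_factorialSpan _ _ _ (by omega)
    · intro k y
      have h := centralFactorial_second_difference b y
      rw [← hc] at h
      simp only [Pi.sub_apply, Pi.smul_apply, smul_eq_mul]
      rw [inv_mul_eq_div, inv_mul_eq_div, inv_mul_eq_div]
      field_simp
      linear_combination (k ^ (2 * a)) * h
    · intro k
      have h := centralFactorial_symm_sum (b + 1) k
      simp only [Pi.sub_apply, Pi.smul_apply, smul_eq_mul]
      linear_combination (c⁻¹ * k ^ (2 * a)) * h
  | zero => exact ⟨0, Submodule.zero_mem _, by simp, by simp⟩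
  | add x y _ _ hx hy =>
    obtain ⟨F, hF, h1, h2⟩ := hx
    obtain ⟨F', hF', h1', h2'⟩ := hy
    refine ⟨F + F', Submodule.add_mem _ hF hF', fun k y => ?_, fun k => ?_⟩
    · simp only [Pi.add_apply]; linarith [h1 k y, h1' k y]
    · simp only [Pi.add_apply]; linarith [h2 k, h2' k]
  | smul a x _ hx =>
    obtain ⟨F, hF, h1, h2⟩ := hx
    refine ⟨a • F, Submodule.smul_mem _ _ hF, fun k y => ?_, fun k => ?_⟩
    · simp only [Pi.smul_apply, smul_eq_mul]; linear_combination a * h1 k y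
    · simp only [Pi.smul_apply, smul_eq_mul]; linear_combination a * h2 k

lemma exists_sineSum_eq (g : ℕ) : ∃ f ∈ factorialSpan (g + 1), ∀ k i : ℕ, i < k →
    sineSum (2 * g + 1) k (2 * i + 1) = f k (((2 * i + 1 : ℤ) : ℝ) - k) := by
  induction g with
  | zero =>
    refine ⟨-(fun k y => k ^ (2 * 0) * centralFactorial 0 y),
      Submodule.neg_mem _ (Submodule.subset_span ⟨0, 0, by omega, rfl⟩), fun k i hi => ?_⟩
    rw [show 2 * 0 + 1 = 1 from rfl, sineSum_one k i hi]
    simp [centralFactorial]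
  | succ g ih =>
    obtain ⟨f, hf, hfe⟩ := ih
    obtain ⟨F, hF, h1, h2⟩ := exists_second_difference_eq hf
    refine ⟨(-4 : ℝ) • F, Submodule.smul_mem _ _ hF, fun k i hi => ?_⟩
    have hk0 : (0 : ℝ) < k := by exact_mod_cast (by omega : 0 < k)
    -- the difference of the two sides is affine in the colour, odd about `0` and about `k`
    set d : ℤ → ℝ := fun l => sineSum (2 * g + 3) k l + 4 * F k ((l : ℝ) - k) with hd
    have hdd : ∀ i : ℕ, i < k → d (2 * i + 1 + 2) - 2 * d (2 * i + 1) + d (2 * i + 1 - 2) = 0 := by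
      intro i hi
      have e1 := sineSum_second_difference (2 * g + 1) k (2 * i + 1)
      have e2 := h1 k (((2 * i + 1 : ℤ) : ℝ) - k)
      rw [hfe k i hi] at e1
      simp only [hd]
      push_cast at e1 e2 ⊢
      rw [show (2 * (i : ℝ) + 1 - k + 2) = 2 * i + 1 + 2 - k by ring,
        show (2 * (i : ℝ) + 1 - k - 2) = 2 * i + 1 - 2 - k by ring] at e2
      linarith
    have hodd : d (-1) = - d 1 := by
      simp only [hd]
      have e1 := sineSum_neg (2 * g + 3) k 1
      have e2 := h2 k
      have e3 := neg_of_mem_factorialSpan hF k (k + 1)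
      have e4 := neg_of_mem_factorialSpan hF k (k - 1)
      rw [e1]
      push_cast
      rw [show (-1 - (k : ℝ)) = -(k + 1) by ring, show (1 - (k : ℝ)) = -(k - 1) by ring, e3, e4]
      linarith
    have haff : ∀ i : ℕ, i ≤ k → d (2 * i + 1) = (2 * i + 1) * d 1 ∧
        d (2 * i + 1 - 2) = (2 * i - 1) * d 1 := by
      intro i
      induction i with
      | zero => intro _; simp [hodd]
      | succ i ih =>
        intro hi
        obtain ⟨ih1, ih2⟩ := ih (by omega)
        have := hdd i (by omega)
        rw [ih1, ih2] at this
        have e1 : (2 * ((i + 1 : ℕ) : ℤ) + 1) = 2 * i + 1 + 2 := by push_cast; ring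
        constructor
        · rw [e1]; push_cast; linarith
        · rw [e1, add_sub_cancel_right, ih1]; push_cast; ring
    have hrefl : d (2 * k - 1) = - d 1 := by
      simp only [hd]
      rw [sineSum_period_sub]
      have e4 := neg_of_mem_factorialSpan hF k (k - 1)
      push_cast
      rw [show (2 * (k : ℝ) - 1 - k) = k - 1 by ring, show (1 - (k : ℝ)) = -(k - 1) by ring, e4]
      ring
    have hd1 : d 1 = 0 := by
      have := (haff k le_rfl).2
      rw [show (2 * (k : ℤ) + 1 - 2) = 2 * k - 1 by ring, hrefl] at this
      have : (2 * k) * d 1 = 0 := by linarith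
      rcases mul_eq_zero.1 this with h | h
      · linarith
      · exact h
    have := (haff i hi.le).1
    rw [hd1, mul_zero] at this
    simp only [hd] at this
    rw [show 2 * (g + 1) + 1 = 2 * g + 3 by ring]
    simp only [Pi.smul_apply, smul_eq_mul]
    linarith

lemma exists_polynomials_of_mem_monomialSpan {g : ℕ} {f : ℝ → ℝ → ℝ} (hf : f ∈ monomialSpan g) :
    ∃ P : Fin g → Polynomial ℝ, ∀ k x : ℝ, k ≠ 0 →
      f k (k * (x - 1)) = k ^ (2 * g - 1) * ∑ m : Fin g, (k ^ (2 * (m : ℕ)))⁻¹ * (P m).eval x := by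
  induction hf using Submodule.span_induction with
  | mem x h =>
    obtain ⟨a, b, hab, rfl⟩ := h
    refine ⟨fun m => if (m : ℕ) = g - 1 - (a + b) then (Polynomial.X - Polynomial.C 1) ^ (2 * b + 1)
      else 0, fun k x hk => ?_⟩
    rw [Finset.sum_eq_single (⟨g - 1 - (a + b), by omega⟩ : Fin g)]
    · simp only [if_true, Polynomial.eval_pow, Polynomial.eval_sub, Polynomial.eval_X,
        Polynomial.eval_C]
      have : k ^ (2 * g - 1) = k ^ (2 * (g - 1 - (a + b))) * k ^ (2 * a + (2 * b + 1)) := by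
        rw [← pow_add]; congr 1; omega
      rw [this, mul_pow, pow_add _ (2 * a)]
      have := pow_ne_zero (2 * (g - 1 - (a + b))) hk
      generalize k ^ (2 * (g - 1 - (a + b))) = u at *
      generalize k ^ (2 * b + 1) = v at *
      field_simp
    · intro m _ hm
      simp only
      rw [if_neg (fun h => hm (Fin.ext h))]
      simp
    · simp
  | zero => exact ⟨0, by simp⟩
  | add x y _ _ hx hy =>
    obtain ⟨P, hP⟩ := hx
    obtain ⟨P', hP'⟩ := hy
    refine ⟨P + P', fun k x hk => ?_⟩
    simp only [Pi.add_apply, Polynomial.eval_add, mul_add, Finset.sum_add_distrib]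
    rw [hP k x hk, hP' k x hk]
  | smul a x _ hx =>
    obtain ⟨P, hP⟩ := hx
    refine ⟨a • P, fun k x hk => ?_⟩
    simp only [Pi.smul_apply, smul_eq_mul, Polynomial.eval_smul]
    rw [hP k x hk, Finset.mul_sum, Finset.mul_sum, Finset.mul_sum]
    exact Finset.sum_congr rfl fun _ _ => by ring

/-- Verlinde's sums are given by polynomials for all the odd colours between `0` and `2 k`. -/
lemma exists_sineSum_polynomials {g : ℕ} (hg : 1 ≤ g) : ∃ P : Fin g → Polynomial ℝ,
    ∀ k i : ℕ, i < k → ((k : ℝ) / 2) ^ (g - 1) * sineSum (2 * g - 1) k (2 * i + 1)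
      = ((k : ℝ) / (2 * Real.pi)) ^ (3 * g - 2) *
        ∑ m : Fin g, ((k : ℝ) ^ (2 * (m : ℕ)))⁻¹ * (P m).eval ((2 * i + 1 : ℝ) / k) := by
  obtain ⟨h, rfl⟩ : ∃ h, g = h + 1 := ⟨g - 1, by omega⟩
  obtain ⟨f, hf, hfe⟩ := exists_sineSum_eq h
  obtain ⟨P, hP⟩ := exists_polynomials_of_mem_monomialSpan (factorialSpan_le_monomialSpan _ hf)
  refine ⟨fun m => Polynomial.C ((2 * Real.pi) ^ (3 * h + 1) / 2 ^ h) * P m, fun k i hi => ?_⟩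
  have hk0 : (k : ℝ) ≠ 0 := by exact_mod_cast (by omega : k ≠ 0)
  have e := hfe k i hi
  rw [show 2 * (h + 1) - 1 = 2 * h + 1 by omega, e,
    show (((2 * i + 1 : ℤ) : ℝ) - k) = k * ((2 * i + 1 : ℝ) / k - 1) by push_cast; field_simp,
    hP _ _ hk0, show 3 * (h + 1) - 2 = 3 * h + 1 by omega, Nat.add_sub_cancel,
    show 2 * (h + 1) - 1 = 2 * h + 1 by omega]
  simp only [Polynomial.eval_mul, Polynomial.eval_C, Finset.mul_sum]
  refine Finset.sum_congr rfl fun m _ => ?_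
  have hpi := Real.pi_ne_zero
  rw [div_pow, div_pow, show 3 * h + 1 = h + (2 * h + 1) by ring, pow_add (k : ℝ) h (2 * h + 1)]
  generalize (k : ℝ) ^ (2 * h + 1) = v
  generalize (k : ℝ) ^ h = u
  field_simp

lemma verlindeNumber_eq_sineSum {g : ℕ} (hg : 1 ≤ g) (G : PantsDecomposition g) {k l : ℕ}
    (hl : l < k) :
    (verlindeNumber G k l : ℝ) = ((k : ℝ) / 2) ^ (g - 1) * sineSum (2 * g - 1) k l := by
  rw [verlindeNumber_eq hg G hl, sineSum]
  simp

lemma eq_zero_of_expansion_eq_zero {g : ℕ} (D : Fin g → Polynomial ℝ)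
    (hD : ∀ k l : ℕ, 1 ≤ k → Odd l → l < k →
      ∑ m : Fin g, ((k : ℝ) ^ (2 * (m : ℕ)))⁻¹ * (D m).eval ((l : ℝ) / k) = 0) : D = 0 := by
  -- at fixed `l / k`, letting `k` grow separates the coefficients
  have key : ∀ k : ℕ, 2 ≤ k → ∀ m, (D m).eval ((1 : ℝ) / k) = 0 := by
    intro k hk
    have hk0 : (0 : ℝ) < k := by exact_mod_cast (by omega : 0 < k)
    set Q : Polynomial ℝ := ∑ m : Fin g, Polynomial.C ((D m).eval ((1 : ℝ) / k))
      * Polynomial.X ^ (m : ℕ) with hQ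
    have hroot : ∀ i : ℕ, Q.eval ((((2 * i + 1 : ℕ) * k : ℕ) : ℝ) ^ 2)⁻¹ = 0 := by
      intro i
      have h := hD ((2 * i + 1) * k) (2 * i + 1) (by nlinarith) ⟨i, rfl⟩ (by nlinarith)
      rw [hQ, Polynomial.eval_finsetSum, ← h]
      refine Finset.sum_congr rfl fun m _ => ?_
      have e : (((2 * i + 1 : ℕ) : ℝ)) / (((2 * i + 1) * k : ℕ) : ℝ) = 1 / k := by
        have : (((2 * i + 1 : ℕ) : ℝ)) ≠ 0 := by positivity
        rw [Nat.cast_mul]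
        field_simp
      rw [e, pow_mul, Polynomial.eval_mul, Polynomial.eval_C, Polynomial.eval_pow,
        Polynomial.eval_X, inv_pow, mul_comm]
    have hQ0 : Q = 0 := by
      refine Polynomial.eq_zero_of_infinite_isRoot Q ?_
      refine Set.infinite_of_injective_forall_mem
        (f := fun i : ℕ => ((((2 * i + 1 : ℕ) * k : ℕ) : ℝ) ^ 2)⁻¹) ?_ hroot
      intro i i' h
      have h1 := inv_injective h
      have h2 := (pow_left_inj₀ (Nat.cast_nonneg _) (Nat.cast_nonneg _) two_ne_zero).1 h1
      have h3 := Nat.eq_of_mul_eq_mul_right (by omega) (Nat.cast_injective h2)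
      omega
    intro m
    have := congrArg (fun R => Polynomial.coeff R (m : ℕ)) hQ0
    simp only [hQ, Polynomial.finsetSum_coeff, Polynomial.coeff_C_mul, Polynomial.coeff_X_pow,
      Polynomial.coeff_zero] at this
    rw [Finset.sum_eq_single m] at this
    · simpa using this
    · intro m' _ hne
      rw [if_neg (fun h => hne (Fin.ext h.symm)), mul_zero]
    · simp
  ext1 m
  refine Polynomial.eq_zero_of_infinite_isRoot (D m) ?_
  refine Set.infinite_of_injective_forall_mem (f := fun i : ℕ => (1 : ℝ) / ((i + 2 : ℕ) : ℝ)) ?_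
    (fun i => key (i + 2) (by omega) m)
  intro i i' h
  simp only [one_div] at h
  have := inv_injective h
  have : i + 2 = i' + 2 := by exact_mod_cast this
  omega

lemma isCountingFamily_ext {g : ℕ} {G : PantsDecomposition g} {P P' : Fin g → Polynomial ℝ}
    (hP : IsCountingFamily G P) (hP' : IsCountingFamily G P') : P = P' := by
  rw [← sub_eq_zero]
  refine eq_zero_of_expansion_eq_zero _ fun k l hk hl hlk => ?_
  have h := (hP k l hk hl hlk).symm.trans (hP' k l hk hl hlk)
  have hk0 : (0 : ℝ) < k := by exact_mod_cast hk
  have hpi := Real.pi_pos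
  have := mul_left_cancel₀ (by positivity) h
  simp only [Pi.sub_apply, Polynomial.eval_sub, mul_sub, Finset.sum_sub_distrib]
  linarith

lemma exists_isCountingFamily {g : ℕ} (hg : 1 ≤ g) (G : PantsDecomposition g) :
    ∃ P : Fin g → Polynomial ℝ, IsCountingFamily G P ∧
      ∀ k i : ℕ, i < k → ((k : ℝ) / 2) ^ (g - 1) * sineSum (2 * g - 1) k (2 * i + 1)
        = ((k : ℝ) / (2 * Real.pi)) ^ (3 * g - 2) *
          ∑ m : Fin g, ((k : ℝ) ^ (2 * (m : ℕ)))⁻¹ * (P m).eval ((2 * i + 1 : ℝ) / k) := by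
  obtain ⟨P, hP⟩ := exists_sineSum_polynomials hg
  refine ⟨P, ?_, hP⟩
  rintro k l hk ⟨i, rfl⟩ hl
  rw [verlindeNumber_eq_sineSum hg G hl]
  have := hP k i (by omega)
  push_cast
  exact this

/-! ### The circles `A₁` and `A₂` and their flat section -/

lemma mem_lattice_iff {r : Plane} : r ∈ lattice ↔ ∃ m n : ℤ, r = ((m : ℝ), (n : ℝ)) := by
  rw [lattice, AddSubgroup.mem_prod]
  constructor
  · rintro ⟨⟨m, hm⟩, ⟨n, hn⟩⟩
    exact ⟨m, n, Prod.ext hm.symm hn.symm⟩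
  · rintro ⟨m, n, rfl⟩
    exact ⟨⟨m, rfl⟩, ⟨n, rfl⟩⟩

lemma proj_eq_proj_iff {x y : Plane} :
    proj x = proj y ↔ ∃ m n : ℤ, y = (x.1 + m, x.2 + n) := by
  rw [proj, proj, QuotientAddGroup.eq, mem_lattice_iff]
  refine exists_congr fun m => exists_congr fun n => ?_
  simp only [Prod.ext_iff, Prod.fst_add, Prod.snd_add, Prod.fst_neg, Prod.snd_neg]
  constructor <;> rintro ⟨h1, h2⟩ <;> constructor <;> linarith

lemma proj_mem_A1_iff {x : Plane} : proj x ∈ A1 ↔ ∃ n : ℤ, x.2 = n := by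
  simp only [A1, Set.mem_ofPred_eq, proj_eq_proj_iff, mu]
  constructor
  · rintro ⟨p, m, n, h⟩
    refine ⟨-n, ?_⟩
    have := congrArg Prod.snd h
    simp only [Prod.smul_mk, smul_eq_mul, mul_zero] at this
    push_cast
    linarith
  · rintro ⟨n, hn⟩
    refine ⟨x.1, 0, -n, ?_⟩
    ext <;> simp [hn]

lemma proj_mem_A2_iff {x : Plane} : proj x ∈ A2 ↔ ∃ m : ℤ, 2 * x.1 = m := by
  simp only [A2, Set.mem_ofPred_eq, proj_eq_proj_iff, mu, lam]
  constructor
  · rintro ⟨q, ⟨m, n, h⟩ | ⟨m, n, h⟩⟩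
    · refine ⟨-2 * m, ?_⟩
      have := congrArg Prod.fst h
      simp only [Prod.smul_mk, smul_eq_mul, mul_zero] at this
      push_cast
      linarith
    · refine ⟨1 - 2 * m, ?_⟩
      have := congrArg Prod.fst h
      simp only [Prod.smul_mk, smul_eq_mul, mul_zero, Prod.mk_add_mk] at this
      push_cast
      linarith
  · rintro ⟨m, hm⟩
    rcases Int.even_or_odd' m with ⟨c, rfl | rfl⟩
    · refine ⟨x.2, Or.inl ⟨-c, 0, ?_⟩⟩
      push_cast at hm
      ext <;> simp
      linarith
    · refine ⟨x.2, Or.inr ⟨-c, 0, ?_⟩⟩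
      push_cast at hm
      ext <;> simp
      linarith

lemma eventually_eq_of_int (a : ℝ) : ∀ᶠ b : ℝ in nhds a, (∃ n : ℤ, b = n) → b = a := by
  have h1 : ((⌈a⌉ - 1 : ℤ) : ℝ) < a := by push_cast; linarith [Int.ceil_lt_add_one a]
  have h2 : a < ((⌊a⌋ + 1 : ℤ) : ℝ) := by push_cast; linarith [Int.lt_floor_add_one a]
  filter_upwards [Ioo_mem_nhds h1 h2] with b hb
  rintro ⟨n, rfl⟩
  have h3 : ⌈a⌉ - 1 < n := by exact_mod_cast hb.1
  have h4 : n < ⌊a⌋ + 1 := by exact_mod_cast hb.2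
  exact le_antisymm ((Int.cast_le.2 (by omega : n ≤ ⌊a⌋)).trans (Int.floor_le a))
    ((Int.le_ceil a).trans (Int.cast_le.2 (by omega : ⌈a⌉ ≤ n)))

lemma eventually_mem_circles (x : Plane) : ∀ᶠ y in nhds x,
    (proj y ∈ A1 → y.2 = x.2) ∧ (proj y ∈ A2 → y.1 = x.1) := by
  have h1 := (continuous_snd (X := ℝ) (Y := ℝ)).continuousAt (x := x) |>.eventually
    (eventually_eq_of_int x.2)
  have h2 := ((continuous_const.mul continuous_fst : Continuous fun y : Plane => 2 * y.1)).continuousAt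
    (x := x) |>.eventually (eventually_eq_of_int (2 * x.1))
  filter_upwards [h1, h2] with y hy1 hy2
  rw [proj_mem_A1_iff, proj_mem_A2_iff]
  exact ⟨hy1, fun h => mul_left_cancel₀ two_ne_zero (hy2 h)⟩

/-- The flat section of `L_M` over `A₁ ∪ A₂`, of norm `1`, equal to `1` at the origin. It is constant
on the lines `ℝ μ` and `ℝ lam`, and is extended to the preimage of `A₁ ∪ A₂` by equivariance. -/
noncomputable def flatSection (x : Plane) : ℂ :=
  open Classical in
  if ∃ m : ℤ, 2 * x.1 = m then Complex.exp (Complex.I * (2 * Real.pi * (x.1 * x.2) : ℝ))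
  else Complex.exp (Complex.I * (-(2 * Real.pi * (x.1 * x.2)) : ℝ))

lemma flatSection_of_fst {x : Plane} (h : ∃ m : ℤ, 2 * x.1 = m) :
    flatSection x = Complex.exp (Complex.I * (2 * Real.pi * (x.1 * x.2) : ℝ)) := if_pos h

lemma exp_eq_exp_of_int {a b : ℝ} (n : ℤ) (h : a = b + 2 * Real.pi * n) :
    Complex.exp (Complex.I * a) = Complex.exp (Complex.I * b) := by
  rw [Complex.exp_eq_exp_iff_exists_int]
  refine ⟨n, ?_⟩
  rw [h]
  push_cast
  ring

lemma flatSection_of_snd {x : Plane} (h : ∃ n : ℤ, x.2 = n) :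
    flatSection x = Complex.exp (Complex.I * (-(2 * Real.pi * (x.1 * x.2)) : ℝ)) := by
  by_cases h1 : ∃ m : ℤ, 2 * x.1 = m
  · rw [flatSection_of_fst h1]
    obtain ⟨m, hm⟩ := h1
    obtain ⟨n, hn⟩ := h
    refine exp_eq_exp_of_int (m * n) ?_
    push_cast
    rw [← hm, ← hn]
    ring
  · exact if_neg h1

lemma flatSection_zero : flatSection 0 = 1 := by
  rw [flatSection_of_fst ⟨0, by simp⟩]
  simp

lemma norm_flatSection (x : Plane) : ‖flatSection x‖ = 1 := by
  rw [flatSection]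
  split_ifs <;> rw [mul_comm, Complex.norm_exp_ofReal_mul_I]

lemma multiplier_eq (k : ℕ) (r x : Plane) :
    multiplier k r x = Complex.exp (Complex.I * (k * omega r x / 2 : ℝ)) := by
  rw [multiplier]
  push_cast
  rfl

lemma norm_multiplier (k : ℕ) (r x : Plane) : ‖multiplier k r x‖ = 1 := by
  rw [multiplier_eq, mul_comm, Complex.norm_exp_ofReal_mul_I]

lemma isSectionOn_flatSection : IsSectionOn 1 (A1 ∪ A2) flatSection := by
  intro r hr x hx
  obtain ⟨m, n, rfl⟩ := mem_lattice_iff.1 hr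
  rw [multiplier_eq]
  rcases hx with hx | hx
  · obtain ⟨b, hb⟩ := proj_mem_A1_iff.1 hx
    rw [flatSection_of_snd ⟨b, hb⟩,
      flatSection_of_snd ⟨n + b, by simp only [Prod.snd_add, hb]; push_cast; ring⟩,
      ← Complex.exp_add, ← mul_add, ← Complex.ofReal_add]
    refine exp_eq_exp_of_int (-(2 * m * b + m * n)) ?_
    simp only [omega, Prod.fst_add, Prod.snd_add, hb]
    push_cast
    ring
  · obtain ⟨a, ha⟩ := proj_mem_A2_iff.1 hx
    rw [flatSection_of_fst ⟨a, ha⟩,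
      flatSection_of_fst ⟨2 * m + a, by simp only [Prod.fst_add, mul_add, ha]; push_cast; ring⟩,
      ← Complex.exp_add, ← mul_add, ← Complex.ofReal_add]
    refine exp_eq_exp_of_int (a * n + m * n) ?_
    simp only [omega, Prod.fst_add, Prod.snd_add]
    push_cast
    rw [← ha]
    ring

/-- Even near a point where the two circles cross, the flat section is the
restriction of a function whose logarithm is linear. -/
lemma eventually_flatSection_eq (x : Plane) : ∀ᶠ y in nhds x,
    proj y ∈ A1 ∪ A2 →
      flatSection y = flatSection x * Complex.exp (Complex.I * (omega x y / 2 : ℝ)) := by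
  filter_upwards [eventually_mem_circles x] with y hy
  rintro (h | h)
  · have h2 := hy.1 h
    rw [flatSection_of_snd (proj_mem_A1_iff.1 h),
      flatSection_of_snd (x := x) (h2 ▸ proj_mem_A1_iff.1 h), ← Complex.exp_add, ← mul_add,
      ← Complex.ofReal_add, omega, h2]
    congr 3
    ring
  · have h1 := hy.2 h
    rw [flatSection_of_fst (proj_mem_A2_iff.1 h),
      flatSection_of_fst (x := x) (h1 ▸ proj_mem_A2_iff.1 h), ← Complex.exp_add, ← mul_add,
      ← Complex.ofReal_add, omega, h1]
    congr 3
    ring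

lemma isFlatUnitSection_flatSection : IsFlatUnitSection (A1 ∪ A2) flatSection where
  isSection := isSectionOn_flatSection
  norm_eq_one x _ := norm_flatSection x
  flat c hc hmem t := by
    have hct : HasDerivAt c (deriv c t) t :=
      (hc.differentiable (by simp)).differentiableAt.hasDerivAt
    have h1 : HasDerivAt (fun s => (c s).1) (deriv c t).1 t := hct.fst
    have h2 : HasDerivAt (fun s => (c s).2) (deriv c t).2 t := hct.snd
    have h3 : HasDerivAt (fun s => omega (c t) (c s) / 2) (omega (c t) (deriv c t) / 2) t := by
      unfold omega
      exact (((h2.const_mul _).sub (h1.const_mul _)).const_mul _).div_const _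
    have h4 := ((h3.ofReal_comp.const_mul Complex.I).cexp).const_mul (flatSection (c t))
    have h5 : omega (c t) (c t) = 0 := by unfold omega; ring
    have h6 : (fun s => flatSection (c s)) =ᶠ[nhds t] fun s => flatSection (c t) *
        Complex.exp (Complex.I * (omega (c t) (c s) / 2 : ℝ)) := by
      have := hc.continuous.continuousAt.eventually (eventually_flatSection_eq (c t))
      filter_upwards [this] with s hs using hs (hmem s)
    refine (h4.congr_of_eventuallyEq h6).congr_deriv ?_
    rw [h5]
    simp
    ring

lemma IsFlatUnitSection.mono {G G' : Set Torus} {Th : Plane → ℂ} (h : IsFlatUnitSection G Th)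
    (hG : G' ⊆ G) : IsFlatUnitSection G' Th where
  isSection r hr x hx := h.isSection r hr x (hG hx)
  norm_eq_one x hx := h.norm_eq_one x (hG hx)
  flat c hc hmem t := h.flat c hc (fun s => hG (hmem s)) t

lemma continuous_proj : Continuous proj := continuous_quotient_mk'

lemma isOpenMap_proj : IsOpenMap proj := QuotientAddGroup.isOpenMap_coe

lemma isOpen_of_isOpen_preimage {U : Set Torus} (h : IsOpen (proj ⁻¹' U)) : IsOpen U :=
  isOpen_coinduced.2 h

lemma isOpen_compl_A1 : IsOpen (A1ᶜ : Set Torus) := by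
  refine isOpen_of_isOpen_preimage (isOpen_iff_eventually.2 fun x hx => ?_)
  filter_upwards [eventually_mem_circles x] with y hy h
  refine hx ?_
  rw [proj_mem_A1_iff] at h ⊢
  exact (hy.1 (proj_mem_A1_iff.2 h)) ▸ h

lemma isOpen_compl_A2 : IsOpen (A2ᶜ : Set Torus) := by
  refine isOpen_of_isOpen_preimage (isOpen_iff_eventually.2 fun x hx => ?_)
  filter_upwards [eventually_mem_circles x] with y hy h
  refine hx ?_
  rw [proj_mem_A2_iff] at h ⊢
  exact (hy.2 (proj_mem_A2_iff.2 h)) ▸ h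

lemma isCurveIn_A1 : IsCurveIn A2ᶜ (A1 \ A2) := by
  refine ⟨fun x hx => hx.2, fun x hx => ?_⟩
  have hev := (eventually_mem_circles x).and
    ((isOpen_compl_A2.preimage continuous_proj).mem_nhds hx.2)
  obtain ⟨W, hW, hWo, hxW⟩ := eventually_nhds_iff.1 hev
  refine ⟨W, hWo, hxW, fun y => y.2 - x.2, by fun_prop, fun y _ => ?_, fun y hy => ?_⟩
  · rw [fderiv_sub_const, fderiv_snd]
    intro h
    simpa using DFunLike.congr_fun h ((0, 1) : Plane)
  · obtain ⟨⟨h1, -⟩, h2⟩ := hW y hy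
    refine ⟨fun h => sub_eq_zero.2 (h1 h.1), fun h => ⟨?_, h2⟩⟩
    obtain ⟨n, hn⟩ := proj_mem_A1_iff.1 hx.1
    exact proj_mem_A1_iff.2 ⟨n, by linarith⟩

lemma isCurveIn_A2 : IsCurveIn A1ᶜ (A2 \ A1) := by
  refine ⟨fun x hx => hx.2, fun x hx => ?_⟩
  have hev := (eventually_mem_circles x).and
    ((isOpen_compl_A1.preimage continuous_proj).mem_nhds hx.2)
  obtain ⟨W, hW, hWo, hxW⟩ := eventually_nhds_iff.1 hev
  refine ⟨W, hWo, hxW, fun y => y.1 - x.1, by fun_prop, fun y _ => ?_, fun y hy => ?_⟩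
  · rw [fderiv_sub_const, fderiv_fst]
    intro h
    simpa using DFunLike.congr_fun h ((1, 0) : Plane)
  · obtain ⟨⟨-, h1⟩, h2⟩ := hW y hy
    refine ⟨fun h => sub_eq_zero.2 (h1 h.1), fun h => ⟨?_, h2⟩⟩
    obtain ⟨n, hn⟩ := proj_mem_A2_iff.1 hx.1
    exact proj_mem_A2_iff.2 ⟨n, by linarith⟩

/-- A family of sections that is negligible near a point of the plane is negligible near its
projection to the torus, since the multipliers have modulus one. -/
lemma notMem_microsupport {xi : ℕ → Plane → ℂ}
    (hsec : ∀ k, 1 ≤ k → IsSectionOn k Set.univ (xi k)) {V : Set Plane} (hV : IsOpen V) {x : Plane}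
    (hx : x ∈ V) (h : IsNegligibleOn V xi) : proj x ∉ microsupport xi := by
  rw [microsupport, Set.mem_ofPred_eq, not_not]
  refine ⟨proj '' V, (isOpenMap_proj V hV).mem_nhds ⟨x, hx, rfl⟩, fun N => ?_⟩
  obtain ⟨C, hC⟩ := h N
  refine ⟨C, fun k hk y hy => ?_⟩
  obtain ⟨v, hv, hvy⟩ := hy
  obtain ⟨m, n, hmn⟩ := proj_eq_proj_iff.1 hvy
  have e : y = ((m : ℝ), (n : ℝ)) + v := by rw [hmn]; ext <;> simp [add_comm]
  rw [e, hsec k hk _ (mem_lattice_iff.2 ⟨m, n, rfl⟩) v (Set.mem_univ _), norm_mul, norm_multiplier,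
    one_mul]
  exact hC k hk v hv

/-! ### Holomorphic sections -/

/-- The holomorphic coordinate `p + τ q` of the plane. -/
noncomputable def zcoord (τ : ℂ) : Plane →L[ℝ] ℂ :=
  Complex.ofRealCLM.comp (ContinuousLinearMap.fst ℝ ℝ ℝ)
    + τ • Complex.ofRealCLM.comp (ContinuousLinearMap.snd ℝ ℝ ℝ)

lemma zcoord_apply (τ : ℂ) (y : Plane) : zcoord τ y = y.1 + τ * y.2 := by
  simp [zcoord]

/-- The section `t^k h(z)` of `L_E^k`, where `t = exp (2 i π q z)` is the holomorphic frame of `L_E`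
that is flat and equal to `1` on the line `ℝ μ`. -/
noncomputable def holoSection (τ : ℂ) (k : ℕ) (h : ℂ → ℂ) (y : Plane) : ℂ :=
  Complex.exp (2 * Real.pi * Complex.I * k * (y.2 * zcoord τ y)) * h (zcoord τ y)

lemma contDiff_holoSection (τ : ℂ) (k : ℕ) {h : ℂ → ℂ} (hh : Differentiable ℂ h) :
    ContDiff ℝ ∞ (holoSection τ k h) := by
  have h1 : ContDiff ℝ ∞ (fun y => h (zcoord τ y)) :=
    (hh.contDiff.restrict_scalars ℝ).comp (zcoord τ).contDiff
  have h2 : ContDiff ℝ ∞ (fun y : Plane => (y.2 : ℂ)) :=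
    Complex.ofRealCLM.contDiff.comp contDiff_snd
  unfold holoSection
  exact ((contDiff_const.mul (h2.mul (zcoord τ).contDiff)).cexp).mul h1

lemma dbar_holoSection {j : Plane →ₗ[ℝ] Plane} {τ : ℂ}
    (hτ : ∀ v, zcoord τ (j v) = Complex.I * zcoord τ v) (k : ℕ) {h : ℂ → ℂ}
    (hh : Differentiable ℂ h) (v x : Plane) : dbar j k (holoSection τ k h) v x = 0 := by
  have hZ : HasFDerivAt (fun y => zcoord τ y) (zcoord τ) x := (zcoord τ).hasFDerivAt
  have h2 : HasFDerivAt (fun y : Plane => (y.2 : ℂ))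
      (Complex.ofRealCLM.comp (ContinuousLinearMap.snd ℝ ℝ ℝ)) x :=
    (Complex.ofRealCLM.comp (ContinuousLinearMap.snd ℝ ℝ ℝ)).hasFDerivAt
  have h3 : HasFDerivAt (fun y => h (zcoord τ y)) _ x :=
    ((hh (zcoord τ x)).hasDerivAt.hasFDerivAt.restrictScalars ℝ).comp x hZ
  have h4 := (((h2.mul hZ).const_mul (2 * Real.pi * Complex.I * k)).cexp).mul h3
  have h5 : ∀ w, fderiv ℝ (holoSection τ k h) x w
      = Complex.exp (2 * Real.pi * Complex.I * k * (x.2 * zcoord τ x)) *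
        (deriv h (zcoord τ x) * zcoord τ w + (2 * Real.pi * Complex.I * k) *
          (x.2 * zcoord τ w + zcoord τ x * w.2) * h (zcoord τ x)) := by
    intro w
    have h8 : HasFDerivAt (holoSection τ k h) _ x := h4
    rw [h8.fderiv]
    simp
    ring
  have h6 := hτ v
  rw [dbar, nabla, nabla, h5, h5, h6]
  rw [zcoord_apply, zcoord_apply] at h6
  simp only [omega, holoSection]
  set E := Complex.exp (2 * Real.pi * Complex.I * k * (x.2 * zcoord τ x))
  set H := h (zcoord τ x)
  set D := deriv h (zcoord τ x)
  rw [zcoord_apply, zcoord_apply, div_eq_mul_inv, Complex.inv_I]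
  push_cast
  have hI := Complex.I_sq
  linear_combination (E * D * (v.1 + τ * v.2) +
    4 * Real.pi * k * E * H * x.2 * Complex.I * (v.1 + τ * v.2)) * hI
    + (2 * Real.pi * k * E * H * x.2 * Complex.I ^ 2) * h6

/-! ### Sums of Gaussians -/

lemma summable_exp_neg_mul_sq {a : ℝ} (ha : 0 < a) :
    Summable fun n : ℤ => Real.exp (-a * (n : ℝ) ^ 2) := by
  have h : 0 < (Complex.I * (a / Real.pi : ℝ)).im := by
    simp
    exact div_pos ha Real.pi_pos
  have h1 := (hasSum_jacobiTheta₂_term 0 h).summable.norm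
  refine h1.congr fun n => ?_
  rw [jacobiTheta₂_term, Complex.norm_exp]
  congr 1
  have hpi := Real.pi_ne_zero
  have : (2 * (Real.pi : ℂ) * Complex.I * n * 0 + Real.pi * Complex.I * n ^ 2
      * (Complex.I * (a / Real.pi : ℝ))) = ((-a * (n : ℝ) ^ 2 : ℝ) : ℂ) := by
    have hpi' : (Real.pi : ℂ) ≠ 0 := by exact_mod_cast hpi
    push_cast
    field_simp
    linear_combination (a * (n : ℂ) ^ 2) * Complex.I_sq
  rw [this, Complex.ofReal_re]

/-- Gaussian sums over the integers are bounded uniformly in the centre of the Gaussian. -/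
lemma exists_gaussian_sum_bound {a : ℝ} (ha : 0 < a) : ∃ C : ℝ, 0 < C ∧ ∀ b : ℝ,
    (Summable fun n : ℤ => Real.exp (-a * (n - b) ^ 2)) ∧
      ∑' n : ℤ, Real.exp (-a * (n - b) ^ 2) ≤ C := by
  have hs : Summable fun n : ℤ => Real.exp a * Real.exp (-(a / 2) * (n : ℝ) ^ 2) :=
    (summable_exp_neg_mul_sq (half_pos ha)).mul_left _
  have hle : ∀ (b : ℝ) (n : ℤ), Real.exp (-a * ((n + ⌊b⌋ : ℤ) - b) ^ 2)
      ≤ Real.exp a * Real.exp (-(a / 2) * (n : ℝ) ^ 2) := by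
    intro b n
    rw [← Real.exp_add]
    apply Real.exp_le_exp.2
    have h0 := Int.fract_nonneg b
    have h1 := (Int.fract_lt_one b).le
    have e : (((n + ⌊b⌋ : ℤ) : ℝ) - b) = n - Int.fract b := by
      rw [Int.fract]; push_cast; ring
    rw [e]
    have h2 : (n : ℝ) ^ 2 / 2 - 1 ≤ ((n : ℝ) - Int.fract b) ^ 2 := by
      nlinarith [sq_nonneg ((n : ℝ) - 2 * Int.fract b), mul_nonneg h0 (sub_nonneg.2 h1)]
    nlinarith
  have key : ∀ b : ℝ, Summable fun n : ℤ => Real.exp (-a * ((n + ⌊b⌋ : ℤ) - b) ^ 2) := fun b =>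
    Summable.of_nonneg_of_le (fun _ => (Real.exp_pos _).le) (hle b) hs
  refine ⟨(∑' n : ℤ, Real.exp a * Real.exp (-(a / 2) * (n : ℝ) ^ 2)) + 1, ?_, fun b => ⟨?_, ?_⟩⟩
  · have : 0 ≤ ∑' n : ℤ, Real.exp a * Real.exp (-(a / 2) * (n : ℝ) ^ 2) :=
      tsum_nonneg fun n => (mul_pos (Real.exp_pos a) (Real.exp_pos _)).le
    linarith
  · exact (Equiv.summable_iff (Equiv.addRight ⌊b⌋)).1 (key b)
  · rw [← (Equiv.addRight ⌊b⌋).tsum_eq]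
    have := (key b).tsum_le_tsum (hle b) hs
    simp only [Equiv.coe_addRight]
    linarith

/-! ### Theta series -/

/-- The terms of the theta series. -/
noncomputable def thetaTerm (τ : ℂ) (k : ℕ) (n : ℤ) (y : Plane) : ℂ :=
  Complex.exp (2 * Real.pi * Complex.I * k *
    (τ * ((y.2 + n / (2 * k) : ℝ) : ℂ) ^ 2 + y.1 * (y.2 + n / k)))

/-- The theta series spanned by the frequencies congruent to `l` modulo `2 k`. -/
noncomputable def thetaSeries (τ : ℂ) (k : ℕ) (l : ℤ) (y : Plane) : ℂ :=
  ∑' ν : ℤ, thetaTerm τ k (l + 2 * k * ν) y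

lemma norm_thetaTerm (τ : ℂ) (k : ℕ) (n : ℤ) (y : Plane) :
    ‖thetaTerm τ k n y‖ = Real.exp (-(2 * Real.pi * k * τ.im) * (y.2 + n / (2 * k)) ^ 2) := by
  rw [thetaTerm, Complex.norm_exp]
  congr 1
  have : (2 * Real.pi * Complex.I * k *
    (τ * ((y.2 + n / (2 * k) : ℝ) : ℂ) ^ 2 + y.1 * (y.2 + n / k)) : ℂ)
    = ((2 * Real.pi * k * (y.2 + n / (2 * k)) ^ 2 : ℝ) : ℂ) * (Complex.I * τ)
      + ((2 * Real.pi * k * (y.1 * (y.2 + n / k)) : ℝ) : ℂ) * Complex.I := by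
    push_cast; ring
  rw [this, Complex.add_re, Complex.re_ofReal_mul, Complex.re_ofReal_mul]
  simp
  ring

lemma summable_norm_thetaTerm {τ : ℂ} (hτ : 0 < τ.im) {k : ℕ} (hk : 1 ≤ k) (y : Plane) :
    Summable fun n : ℤ => ‖thetaTerm τ k n y‖ := by
  have hk0 : (0 : ℝ) < k := by exact_mod_cast hk
  have ha : 0 < 2 * Real.pi * k * τ.im / (2 * k) ^ 2 := by have := Real.pi_pos; positivity
  obtain ⟨C, -, hC⟩ := exists_gaussian_sum_bound ha
  refine (hC (-(2 * k * y.2))).1.congr fun n => ?_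
  rw [norm_thetaTerm]
  congr 1
  field_simp
  ring

lemma int_shift_injective {k : ℕ} (hk : 1 ≤ k) (l : ℤ) :
    Function.Injective fun ν : ℤ => l + 2 * k * ν := by
  intro a b h
  have h' : (2 * k : ℤ) * a = 2 * k * b := by simpa using h
  exact mul_left_cancel₀ (by omega) h'

lemma summable_thetaSeries {τ : ℂ} (hτ : 0 < τ.im) {k : ℕ} (hk : 1 ≤ k) (l : ℤ) (y : Plane) :
    Summable fun ν : ℤ => thetaTerm τ k (l + 2 * k * ν) y :=
  ((summable_norm_thetaTerm hτ hk y).comp_injective (int_shift_injective hk l)).of_norm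

lemma thetaSeries_add_period (τ : ℂ) (k : ℕ) (l j : ℤ) :
    thetaSeries τ k (l + 2 * k * j) = thetaSeries τ k l := by
  ext y
  rw [thetaSeries, thetaSeries, ← (Equiv.addRight j).tsum_eq (fun ν => thetaTerm τ k (l + 2 * k * ν) y)]
  refine tsum_congr fun ν => ?_
  rw [Equiv.coe_addRight]
  congr 1
  ring

lemma thetaSeries_zero_eq_holoSection (τ : ℂ) {k : ℕ} (hk : 1 ≤ k) :
    thetaSeries τ k 0 = holoSection τ k fun z => jacobiTheta₂ (2 * k * z) (2 * k * τ) := by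
  have hk0 : (k : ℂ) ≠ 0 := by exact_mod_cast (by omega : k ≠ 0)
  ext y
  rw [thetaSeries, holoSection, jacobiTheta₂, ← tsum_mul_left]
  refine tsum_congr fun ν => ?_
  rw [thetaTerm, jacobiTheta₂_term, ← Complex.exp_add, zcoord_apply]
  congr 1
  push_cast
  field_simp
  ring

lemma jacobiTheta₂_differentiable {τ : ℂ} (hτ : 0 < τ.im) {k : ℕ} (hk : 1 ≤ k) :
    Differentiable ℂ fun z => jacobiTheta₂ (2 * k * z) (2 * k * τ) := by
  have hk0 : (0 : ℝ) < k := by exact_mod_cast hk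
  have h : 0 < (2 * (k : ℂ) * τ).im := by
    have : (2 * (k : ℂ) * τ) = ((2 * k : ℝ) : ℂ) * τ := by push_cast; ring
    rw [this, Complex.im_ofReal_mul]
    positivity
  have h1 : Differentiable ℂ fun z : ℂ => jacobiTheta₂ z (2 * k * τ) := fun z =>
    differentiableAt_jacobiTheta₂_fst z h
  exact h1.comp (differentiable_id.const_mul _)

lemma exp_eq_exp_of_eq_add {a b : ℂ} (n : ℤ) (h : a = b + 2 * Real.pi * Complex.I * n) :
    Complex.exp a = Complex.exp b := by
  rw [Complex.exp_eq_exp_iff_exists_int]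
  exact ⟨n, by rw [h]; ring⟩

lemma isSectionOn_thetaSeries_zero (τ : ℂ) {k : ℕ} (hk : 1 ≤ k) :
    IsSectionOn k Set.univ (thetaSeries τ k 0) := by
  have hk0 : (k : ℂ) ≠ 0 := by exact_mod_cast (by omega : k ≠ 0)
  intro r hr x _
  obtain ⟨m, n, rfl⟩ := mem_lattice_iff.1 hr
  rw [thetaSeries, thetaSeries, ← (Equiv.addRight n).tsum_eq (fun ν => thetaTerm τ k (0 + 2 * k * ν) x),
    ← tsum_mul_left]
  refine tsum_congr fun ν => ?_
  rw [Equiv.coe_addRight, thetaTerm, thetaTerm, multiplier, ← Complex.exp_add]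
  refine exp_eq_exp_of_eq_add (k * (m * n + 2 * m * ν)) ?_
  simp only [omega, Prod.fst_add, Prod.snd_add]
  push_cast
  field_simp
  ring

lemma pullback_mu_thetaSeries_zero (τ : ℂ) {k : ℕ} (hk : 1 ≤ k) :
    pullback k ((1 / (2 * (k : ℝ))) • mu) (thetaSeries τ k 0) = thetaSeries τ k 0 := by
  have hk0 : (k : ℂ) ≠ 0 := by exact_mod_cast (by omega : k ≠ 0)
  ext y
  rw [pullback, thetaSeries, thetaSeries, ← tsum_mul_left]
  refine tsum_congr fun ν => ?_
  rw [thetaTerm, thetaTerm, multiplier, ← Complex.exp_neg, ← Complex.exp_add]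
  refine exp_eq_exp_of_eq_add ν ?_
  simp only [omega, mu, Prod.fst_add, Prod.snd_add, Prod.smul_mk, smul_eq_mul]
  push_cast
  field_simp
  ring

lemma pullback_lam_thetaSeries (τ : ℂ) {k : ℕ} (hk : 1 ≤ k) (l : ℤ) :
    pullback k ((1 / (2 * (k : ℝ))) • lam) (thetaSeries τ k l) = thetaSeries τ k (l + 1) := by
  have hk0 : (k : ℂ) ≠ 0 := by exact_mod_cast (by omega : k ≠ 0)
  ext y
  rw [pullback, thetaSeries, thetaSeries, ← tsum_mul_left]
  refine tsum_congr fun ν => ?_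
  rw [thetaTerm, thetaTerm, multiplier, ← Complex.exp_neg, ← Complex.exp_add]
  congr 1
  simp only [omega, lam, Prod.fst_add, Prod.snd_add, Prod.smul_mk, smul_eq_mul]
  push_cast
  field_simp
  ring

lemma thetaSeries_zero_mem_quantumSpace {j : Plane →ₗ[ℝ] Plane} {τ : ℂ}
    (hj : ∀ v, zcoord τ (j v) = Complex.I * zcoord τ v) (hτ : 0 < τ.im) {k : ℕ} (hk : 1 ≤ k) :
    thetaSeries τ k 0 ∈ quantumSpace j k := by
  refine ⟨?_, isSectionOn_thetaSeries_zero τ hk, ?_⟩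
  · rw [thetaSeries_zero_eq_holoSection τ hk]
    exact contDiff_holoSection τ k (jacobiTheta₂_differentiable hτ hk)
  · rw [thetaSeries_zero_eq_holoSection τ hk]
    exact fun v x => dbar_holoSection hj k (jacobiTheta₂_differentiable hτ hk) v x

/-! ### The norm of the theta series -/

lemma hasSum_intervalIntegral_of_bound {ι : Type*} [Countable ι] {F : ι → ℝ → ℂ} {f : ℝ → ℂ}
    {B : ι → ℝ} (hc : ∀ i, Continuous (F i)) (hB : ∀ i, ∀ t ∈ Set.Icc (0 : ℝ) 1, ‖F i t‖ ≤ B i)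
    (hs : Summable B) (hf : ∀ t ∈ Set.Icc (0 : ℝ) 1, HasSum (fun i => F i t) (f t)) :
    HasSum (fun i => ∫ t in (0 : ℝ)..1, F i t) (∫ t in (0 : ℝ)..1, f t) := by
  have hI : ∀ t, t ∈ Set.uIoc (0 : ℝ) 1 → t ∈ Set.Icc (0 : ℝ) 1 := by
    intro t ht
    rw [Set.uIoc_of_le zero_le_one] at ht
    exact ⟨ht.1.le, ht.2⟩
  refine intervalIntegral.hasSum_integral_of_dominated_convergence (fun i _ => B i)
    (fun i => (hc i).aestronglyMeasurable) (fun i => ?_) ?_ ?_ ?_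
  · exact Filter.Eventually.of_forall fun t ht => hB i t (hI t ht)
  · exact Filter.Eventually.of_forall fun t _ => hs
  · exact intervalIntegrable_const
  · exact Filter.Eventually.of_forall fun t ht => hf t (hI t ht)

lemma integral_exp_int (k : ℕ) (hk : 1 ≤ k) (d : ℤ) :
    ∫ p in (0 : ℝ)..1, Complex.exp (4 * Real.pi * Complex.I * k * d * p) = if d = 0 then 1 else 0 := by
  have hk0 : (k : ℂ) ≠ 0 := by exact_mod_cast (by omega : k ≠ 0)
  have hpi : (Real.pi : ℂ) ≠ 0 := by exact_mod_cast Real.pi_ne_zero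
  split_ifs with h
  · simp [h]
  · have hd : (d : ℂ) ≠ 0 := by exact_mod_cast h
    have hc : (4 * Real.pi * Complex.I * k * d : ℂ) ≠ 0 := by
      simp [hk0, hpi, hd]
    rw [integral_exp_mul_complex hc]
    have : Complex.exp (4 * Real.pi * Complex.I * k * d * (1 : ℝ)) = Complex.exp 0 := by
      refine exp_eq_exp_of_eq_add (2 * k * d) ?_
      push_cast
      ring
    rw [this]
    simp

lemma quantumInner_thetaSeries_zero (kappa : Plane →ₗ[ℝ] ℂ) {τ : ℂ} (hτ : 0 < τ.im) {k : ℕ}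
    (hk : 1 ≤ k) :
    quantumInner kappa (thetaSeries τ k 0) (thetaSeries τ k 0)
      = ((4 * Real.pi * halfFormNormSq kappa * (Real.sqrt (4 * k * τ.im))⁻¹ : ℝ) : ℂ) := by
  have hk0 : (0 : ℝ) < k := by exact_mod_cast hk
  have hk0' : (k : ℂ) ≠ 0 := by exact_mod_cast (by omega : k ≠ 0)
  have hpi := Real.pi_pos
  -- the terms of the double series, in which the variables `p` and `q` separate
  set Bq : ℤ × ℤ → ℝ → ℂ := fun i q =>
    Complex.exp (2 * Real.pi * Complex.I * k * (τ * (q + i.1) ^ 2 - (starRingEnd ℂ) τ * (q + i.2) ^ 2))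
    with hBq
  set Ep : ℤ × ℤ → ℝ → ℂ := fun i p =>
    Complex.exp (4 * Real.pi * Complex.I * k * (i.1 - i.2 : ℤ) * p) with hEp
  set a : ℝ := 2 * Real.pi * k * τ.im with ha
  have ha0 : 0 < a := by positivity
  set M : ℤ → ℝ := fun ν => Real.exp a * Real.exp (-(a / 2) * (ν : ℝ) ^ 2) with hM
  have hMs : Summable M := (summable_exp_neg_mul_sq (half_pos ha0)).mul_left _
  have hM0 : ∀ ν, 0 ≤ M ν := fun ν => (mul_pos (Real.exp_pos _) (Real.exp_pos _)).le
  have hterm : ∀ (ν : ℤ) (y : Plane), y.2 ∈ Set.Icc (0 : ℝ) 1 →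
      ‖thetaTerm τ k (0 + 2 * k * ν) y‖ ≤ M ν := by
    intro ν y hy
    rw [norm_thetaTerm, ← ha]
    simp only [hM]
    rw [← Real.exp_add]
    apply Real.exp_le_exp.2
    have e : y.2 + ((0 + 2 * k * ν : ℤ) : ℝ) / (2 * k) = y.2 + ν := by
      push_cast; field_simp; ring
    rw [e]
    have h2 : (ν : ℝ) ^ 2 / 2 - 1 ≤ (y.2 + ν) ^ 2 := by
      nlinarith [sq_nonneg ((ν : ℝ) + 2 * y.2), mul_nonneg hy.1 (sub_nonneg.2 hy.2), hy.1, hy.2]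
    nlinarith
  have hfac : ∀ (i : ℤ × ℤ) (p q : ℝ), thetaTerm τ k (0 + 2 * k * i.1) (p, q) *
      (starRingEnd ℂ) (thetaTerm τ k (0 + 2 * k * i.2) (p, q)) = Ep i p * Bq i q := by
    intro i p q
    simp only [thetaTerm, hEp, hBq]
    rw [← Complex.exp_conj, ← Complex.exp_add, ← Complex.exp_add]
    congr 1
    simp only [map_mul, map_add, map_pow, Complex.conj_ofReal, Complex.conj_I, map_div₀,
      map_ofNat, map_natCast, map_intCast]
    push_cast
    field_simp
    ring
  have hEn : ∀ i p, ‖Ep i p‖ = 1 := by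
    intro i p
    simp only [hEp]
    rw [show (4 * Real.pi * Complex.I * k * (i.1 - i.2 : ℤ) * p : ℂ)
      = ((4 * Real.pi * k * (i.1 - i.2 : ℤ) * p : ℝ) : ℂ) * Complex.I by push_cast; ring,
      Complex.norm_exp_ofReal_mul_I]
  have hBn : ∀ i, ∀ q ∈ Set.Icc (0 : ℝ) 1, ‖Bq i q‖ ≤ M i.1 * M i.2 := by
    intro i q hq
    rw [← one_mul ‖Bq i q‖, ← hEn i 0, ← norm_mul, ← hfac, norm_mul, RCLike.norm_conj]
    exact mul_le_mul (hterm _ _ hq) (hterm _ _ hq) (norm_nonneg _) (hM0 _)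
  have hMM : Summable fun i : ℤ × ℤ => M i.1 * M i.2 :=
    hMs.mul_of_nonneg hMs (fun ν => hM0 ν) (fun ν => hM0 ν)
  have hBc : ∀ i, Continuous (Bq i) := by intro i; simp only [hBq]; fun_prop
  have hEc : ∀ i, Continuous (Ep i) := by intro i; simp only [hEp]; fun_prop
  have hprod : ∀ p, ∀ q ∈ Set.Icc (0 : ℝ) 1, HasSum (fun i => Ep i p * Bq i q)
      (thetaSeries τ k 0 (p, q) * (starRingEnd ℂ) (thetaSeries τ k 0 (p, q))) := by
    intro p q hq
    have h1 := (summable_thetaSeries hτ hk 0 (p, q)).hasSum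
    have h1c : HasSum (fun ν : ℤ => (starRingEnd ℂ) (thetaTerm τ k (0 + 2 * k * ν) (p, q)))
        ((starRingEnd ℂ) (thetaSeries τ k 0 (p, q))) :=
      h1.map (starRingEnd ℂ) Complex.continuous_conj
    have hn : Summable fun i : ℤ × ℤ => thetaTerm τ k (0 + 2 * k * i.1) (p, q) *
        (starRingEnd ℂ) (thetaTerm τ k (0 + 2 * k * i.2) (p, q)) := by
      refine Summable.of_norm_bounded hMM fun i => ?_
      rw [hfac, norm_mul, hEn, one_mul]
      exact hBn i q hq
    have := h1.mul h1c hn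
    simp only [hfac] at this
    exact this
  have hq : ∀ p, HasSum (fun i => ∫ q in (0 : ℝ)..1, Ep i p * Bq i q)
      (∫ q in (0 : ℝ)..1, thetaSeries τ k 0 (p, q) * (starRingEnd ℂ) (thetaSeries τ k 0 (p, q))) := by
    intro p
    refine hasSum_intervalIntegral_of_bound (fun i => continuous_const.mul (hBc i)) ?_ hMM (hprod p)
    intro i q hq
    rw [norm_mul, hEn, one_mul]
    exact hBn i q hq
  simp only [intervalIntegral.integral_const_mul] at hq
  have hpq : HasSum (fun i => ∫ p in (0 : ℝ)..1, Ep i p * ∫ q in (0 : ℝ)..1, Bq i q)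
      (∫ p in (0 : ℝ)..1, ∫ q in (0 : ℝ)..1,
        thetaSeries τ k 0 (p, q) * (starRingEnd ℂ) (thetaSeries τ k 0 (p, q))) := by
    refine hasSum_intervalIntegral_of_bound (fun i => (hEc i).mul continuous_const) ?_ hMM
      (fun p _ => hq p)
    intro i p _
    rw [norm_mul, hEn, one_mul]
    have := intervalIntegral.norm_integral_le_of_norm_le_const (f := Bq i) (a := 0) (b := 1)
      (C := M i.1 * M i.2) (fun q hq => hBn i q (by
        rw [Set.uIoc_of_le zero_le_one] at hq; exact ⟨hq.1.le, hq.2⟩))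
    simpa using this
  have hint : ∀ i : ℤ × ℤ, (∫ p in (0 : ℝ)..1, Ep i p * ∫ q in (0 : ℝ)..1, Bq i q)
      = if i.1 - i.2 = 0 then ∫ q in (0 : ℝ)..1, Bq i q else 0 := by
    intro i
    rw [intervalIntegral.integral_mul_const]
    simp only [hEp]
    rw [integral_exp_int k hk]
    split_ifs <;> simp
  simp only [hint] at hpq
  have hdiag : HasSum (fun ν : ℤ => ∫ q in (0 : ℝ)..1, Bq (ν, ν) q)
      (∫ p in (0 : ℝ)..1, ∫ q in (0 : ℝ)..1,
        thetaSeries τ k 0 (p, q) * (starRingEnd ℂ) (thetaSeries τ k 0 (p, q))) := by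
    have hinj : Function.Injective fun ν : ℤ => ((ν, ν) : ℤ × ℤ) := fun _ _ h => congrArg Prod.fst h
    have := (hinj.hasSum_iff (f := fun i : ℤ × ℤ =>
      if i.1 - i.2 = 0 then ∫ q in (0 : ℝ)..1, Bq i q else 0) ?_).2 hpq
    · simpa [Function.comp_def] using this
    · rintro ⟨x, y⟩ hxy
      rw [if_neg]
      intro h
      exact hxy ⟨x, by simp only [Prod.mk.injEq, true_and]; omega⟩
  have hBd : ∀ (ν : ℤ) (q : ℝ), Bq (ν, ν) q = ((Real.exp (-(4 * Real.pi * k * τ.im) * (q + ν) ^ 2) : ℝ) : ℂ) := by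
    intro ν q
    simp only [hBq]
    rw [Complex.ofReal_exp]
    congr 1
    have h2 := Complex.sub_conj τ
    push_cast at h2 ⊢
    linear_combination (2 * Real.pi * Complex.I * k * (q + ν) ^ 2) * h2
      + (4 * Real.pi * k * τ.im * (q + ν) ^ 2) * Complex.I_sq
  have hgi : MeasureTheory.Integrable (fun q : ℝ => ((Real.exp (-(4 * Real.pi * k * τ.im) * q ^ 2) : ℝ) : ℂ)) :=
    (integrable_exp_neg_mul_sq (by positivity)).ofReal
  have hg := hgi.hasSum_intervalIntegral_comp_add_int
  simp only [hBd] at hdiag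
  have hval := hdiag.unique hg
  rw [quantumInner]
  simp only [intervalIntegral.integral_const_mul]
  rw [hval, integral_complex_ofReal, integral_gaussian, ← Complex.ofReal_mul]
  congr 2
  rw [← Real.sqrt_inv]
  congr 1
  field_simp

/-! ### The basis of theta functions -/

lemma quantumInner_smul (kappa : Plane →ₗ[ℝ] ℂ) (c : ℂ) (f : Plane → ℂ) :
    quantumInner kappa (c • f) (c • f) = ((‖c‖ ^ 2 : ℝ) : ℂ) * quantumInner kappa f f := by
  rw [quantumInner, quantumInner, ← intervalIntegral.integral_const_mul]
  refine intervalIntegral.integral_congr fun p _ => ?_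
  rw [← intervalIntegral.integral_const_mul]
  refine intervalIntegral.integral_congr fun q _ => ?_
  simp only [Pi.smul_apply, smul_eq_mul, map_mul]
  have := Complex.mul_conj' c
  push_cast
  linear_combination (4 * Real.pi * (halfFormNormSq kappa : ℂ) * f (p, q) *
    (starRingEnd ℂ) (f (p, q))) * this

/-- The pull-back as a linear operator. -/
noncomputable def pullbackLinear (k : ℕ) (x : Plane) : (Plane → ℂ) →ₗ[ℂ] (Plane → ℂ) where
  toFun := pullback k x
  map_add' f h := by ext y; simp [pullback, mul_add]
  map_smul' c f := by ext y; simp [pullback]; ring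

/-- A vector of `H_k` fixed by the pull-back by `μ / 2k` is a multiple of `Ψ_0`. -/
lemma eq_smul_psi_zero {j : Plane →ₗ[ℝ] Plane} {kappa : Plane →ₗ[ℝ] ℂ} {Om : ℂ} {k : ℕ} (hk : 1 ≤ k)
    {Psi : ZMod (2 * k) → Plane → ℂ} (hPsi : IsPsiBasis j kappa Om k Psi) {f : Plane → ℂ}
    (hf : f ∈ quantumSpace j k) (hT : pullback k ((1 / (2 * (k : ℝ))) • mu) f = f) :
    ∃ c : ℂ, f = c • Psi 0 := by
  have : NeZero (2 * k) := ⟨by omega⟩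
  have hk0 : (k : ℂ) ≠ 0 := by exact_mod_cast (by omega : k ≠ 0)
  obtain ⟨c, hc⟩ := (Submodule.mem_span_range_iff_exists_fun ℂ).1 (hPsi.span hf)
  set T := pullbackLinear k ((1 / (2 * (k : ℝ))) • mu) with hTdef
  have hTf : ∀ m : ℕ, (T ^ m) f = f := by
    intro m
    induction m with
    | zero => rfl
    | succ m ih => rw [pow_succ, Module.End.mul_apply, show T f = f from hT, ih]
  have hTl : ∀ (m : ℕ) (l : ZMod (2 * k)),
      (T ^ m) (Psi l) = Complex.exp (Complex.I * Real.pi * (l.val : ℤ) * m / k) • Psi l := by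
    intro m l
    induction m with
    | zero => simp
    | succ m ih =>
      have h1 := hPsi.pullback_mu (l.val : ℤ)
      have e : (((l.val : ℤ) : ZMod (2 * k))) = l := by simp
      rw [e] at h1
      rw [pow_succ', Module.End.mul_apply, ih, map_smul, show T (Psi l) = _ from h1, smul_smul,
        ← Complex.exp_add]
      congr 2
      push_cast
      ring
  -- averaging over the powers of the pull-back kills the other components
  have hsum : (2 * k : ℂ) • f = ∑ m ∈ Finset.range (2 * k), (T ^ m) f := by
    simp only [hTf]
    rw [Finset.sum_const, Finset.card_range, ← Nat.cast_smul_eq_nsmul ℂ]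
    push_cast
    rfl
  have hsum2 : ∑ m ∈ Finset.range (2 * k), (T ^ m) f = (2 * k * c 0 : ℂ) • Psi 0 := by
    rw [← hc]
    simp only [map_sum, map_smul, hTl]
    rw [Finset.sum_comm, Finset.sum_eq_single 0]
    · simp only [ZMod.val_zero, Nat.cast_zero, Int.cast_zero, mul_zero, zero_mul, zero_div,
        Complex.exp_zero, one_smul, Finset.sum_const, Finset.card_range]
      rw [← Nat.cast_smul_eq_nsmul ℂ, smul_smul]
      congr 1
      push_cast
      ring
    · intro l _ hl
      rw [← Finset.smul_sum, ← Finset.sum_smul, sum_exp_eq k hk, if_neg, zero_smul, smul_zero]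
      intro hd
      have h1 := ZMod.val_lt l
      have h2 := Int.eq_zero_of_abs_lt_dvd hd (by rw [abs_lt]; omega)
      exact hl ((ZMod.val_eq_zero l).1 (by omega))
    · simp
  refine ⟨c 0, ?_⟩
  have h2k : (2 * k : ℂ) ≠ 0 := by simp [hk0]
  have := hsum.trans hsum2
  rw [mul_smul (2 * k : ℂ)] at this
  exact smul_right_injective _ h2k this

lemma psi_eq_smul_thetaSeries {j : Plane →ₗ[ℝ] Plane} {kappa : Plane →ₗ[ℝ] ℂ} {Om : ℂ} {k : ℕ}
    (hk : 1 ≤ k) {Psi : ZMod (2 * k) → Plane → ℂ} (hPsi : IsPsiBasis j kappa Om k Psi) {τ a : ℂ}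
    (h0 : Psi 0 = a • thetaSeries τ k 0) (l : ℤ) :
    Psi (l : ZMod (2 * k)) = a • thetaSeries τ k l := by
  have : NeZero (2 * k) := ⟨by omega⟩
  have hnat : ∀ n : ℕ, Psi (n : ZMod (2 * k)) = a • thetaSeries τ k n := by
    intro n
    induction n with
    | zero => simpa using h0
    | succ n ih =>
      have h1 := hPsi.pullback_lam (n : ZMod (2 * k))
      rw [ih, show pullback k ((1 / (2 * (k : ℝ))) • lam) (a • thetaSeries τ k n)
        = a • pullback k ((1 / (2 * (k : ℝ))) • lam) (thetaSeries τ k n) from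
          (pullbackLinear k _).map_smul a _, pullback_lam_thetaSeries τ hk] at h1
      push_cast
      exact h1.symm
  have h2 := hnat (l % (2 * k : ℕ)).toNat
  have hpos : 0 ≤ l % (2 * k : ℕ) := Int.emod_nonneg _ (by omega)
  have e1 : (((l % (2 * k : ℕ)).toNat : ℕ) : ZMod (2 * k)) = (l : ZMod (2 * k)) := by
    rw [← Int.cast_natCast, Int.toNat_of_nonneg hpos, ZMod.intCast_mod]
  have e2 : thetaSeries τ k l = thetaSeries τ k ((l % (2 * k : ℕ)).toNat : ℕ) := by
    rw [Int.toNat_of_nonneg hpos]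
    conv_lhs => rw [← Int.emod_add_mul_ediv l (2 * k : ℕ)]
    push_cast
    rw [thetaSeries_add_period]
  rw [e1] at h2
  rw [h2, e2]

/-! ### The normalization of the basis -/

/-- The modulus `τ` of the complex structure, in the basis `(μ, lam)`. -/
noncomputable def modulus (kappa : Plane →ₗ[ℝ] ℂ) : ℂ := kappa lam / kappa mu

lemma linear_eq_fst_add_snd (kappa : Plane →ₗ[ℝ] ℂ) (v : Plane) :
    kappa v = v.1 * kappa mu + v.2 * kappa lam := by
  have : v = v.1 • mu + v.2 • lam := by ext <;> simp [mu, lam]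
  conv_lhs => rw [this]
  rw [map_add, map_smul, map_smul, Complex.real_smul, Complex.real_smul]

lemma zcoord_modulus {kappa : Plane →ₗ[ℝ] ℂ} (h : kappa mu ≠ 0) (v : Plane) :
    zcoord (modulus kappa) v = kappa v / kappa mu := by
  rw [zcoord_apply, modulus, linear_eq_fst_add_snd kappa v]
  field_simp

lemma IsHalfForm.ne_zero {kappa : Plane →ₗ[ℝ] ℂ} {v : Plane} {Om : ℂ}
    (h : IsHalfForm kappa v Om) : kappa v ≠ 0 := by
  intro h0
  rw [IsHalfForm, h0, mul_zero] at h
  exact zero_ne_one h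

lemma zcoord_modulus_complex {j : Plane →ₗ[ℝ] Plane} {kappa : Plane →ₗ[ℝ] ℂ}
    (hkappa : IsHalfFormLine j kappa) (h : kappa mu ≠ 0) (v : Plane) :
    zcoord (modulus kappa) (j v) = Complex.I * zcoord (modulus kappa) v := by
  rw [zcoord_modulus h, zcoord_modulus h, hkappa.type_one_zero]
  ring

lemma modulus_im_pos {j : Plane →ₗ[ℝ] Plane} (hj : IsCompatible j) {kappa : Plane →ₗ[ℝ] ℂ}
    (hkappa : IsHalfFormLine j kappa) (h : kappa mu ≠ 0) : 0 < (modulus kappa).im := by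
  have h1 := zcoord_modulus_complex hkappa h mu
  rw [zcoord_apply, zcoord_apply] at h1
  have h2 := hj.pos mu (by simp [mu])
  have h3 : 0 < (j mu).2 := by
    simp only [omega, mu] at h2 ⊢
    have := Real.pi_pos
    by_contra! hc
    nlinarith
  have h4 := congrArg Complex.im h1
  simp [mu] at h4
  by_contra! hc
  rw [mul_comm] at h4
  simp only [mu] at h3
  nlinarith

lemma halfFormNormSq_eq {kappa : Plane →ₗ[ℝ] ℂ} (h : kappa mu ≠ 0) :
    halfFormNormSq kappa = Real.sqrt (‖kappa mu‖ ^ 2 * (modulus kappa).im / (2 * Real.pi)) := by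
  rw [halfFormNormSq]
  congr 1
  have h1 : kappa lam = modulus kappa * kappa mu := by rw [modulus]; field_simp
  have h2 : omega mu lam = 4 * Real.pi := by simp [omega, mu, lam]
  have h3 : (Complex.I * (kappa mu * (starRingEnd ℂ) (kappa lam)
      - kappa lam * (starRingEnd ℂ) (kappa mu)))
      = ((2 * ‖kappa mu‖ ^ 2 * (modulus kappa).im : ℝ) : ℂ) := by
    rw [h1, map_mul]
    have h4 := Complex.mul_conj' (kappa mu)
    have h5 := Complex.sub_conj (modulus kappa)
    push_cast at h5 ⊢
    linear_combination (-Complex.I * (kappa mu * (starRingEnd ℂ) (kappa mu))) * h5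
      - 2 * (modulus kappa).im * Complex.I ^ 2 * h4
      - 2 * (‖kappa mu‖ : ℂ) ^ 2 * (modulus kappa).im * Complex.I_sq
  rw [h3, Complex.ofReal_re, h2]
  have := Real.pi_pos
  field_simp
  ring

lemma quantumInner_thetaSeries_zero_sq {j : Plane →ₗ[ℝ] Plane} (hj : IsCompatible j)
    {kappa : Plane →ₗ[ℝ] ℂ} (hkappa : IsHalfFormLine j kappa) (h : kappa mu ≠ 0) {k : ℕ}
    (hk : 1 ≤ k) :
    (4 * Real.pi * halfFormNormSq kappa * (Real.sqrt (4 * k * (modulus kappa).im))⁻¹) ^ 2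
      = 2 * Real.pi * ‖kappa mu‖ ^ 2 / k := by
  have hτ := modulus_im_pos hj hkappa h
  have hk0 : (0 : ℝ) < k := by exact_mod_cast hk
  have hpi := Real.pi_pos
  rw [halfFormNormSq_eq h, mul_pow, mul_pow, inv_pow, Real.sq_sqrt (by positivity),
    Real.sq_sqrt (by positivity)]
  field_simp
  ring

/-- The phase of `1 / θ`, where `θ = 1 + O(e^{-ck})` is the value at the origin of the theta series. -/
lemma norm_phase_sub_one_le (w : ℂ) (hw : w ≠ 0) : ‖(‖w‖ : ℂ) / w - 1‖ ≤ 4 * ‖w - 1‖ := by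
  by_cases h : 1 / 2 ≤ ‖w‖
  · have h0 : 0 < ‖w‖ := by linarith
    have e : (‖w‖ : ℂ) / w - 1 = (((‖w‖ - 1 : ℝ) : ℂ) - (w - 1)) / w := by
      field_simp; push_cast; ring
    rw [e, norm_div, div_le_iff₀ h0]
    have h1 : |‖w‖ - 1| ≤ ‖w - 1‖ := by simpa using abs_norm_sub_norm_le w 1
    have h2 := norm_sub_le (((‖w‖ - 1 : ℝ) : ℂ)) (w - 1)
    rw [Complex.norm_real, Real.norm_eq_abs] at h2
    nlinarith [norm_nonneg (w - 1)]
  · push Not at h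
    have h1 : ‖(‖w‖ : ℂ) / w‖ = 1 := by
      rw [norm_div, Complex.norm_real, norm_norm, div_self (norm_ne_zero_iff.2 hw)]
    have h2 := norm_sub_le ((‖w‖ : ℂ) / w) 1
    have h3 : 1 - ‖w‖ ≤ ‖w - 1‖ := by
      have := norm_sub_norm_le 1 w
      rw [norm_one, norm_sub_rev] at this
      exact this
    rw [h1, norm_one] at h2
    linarith

lemma exists_norm_thetaSeries_zero_sub_one_le {τ : ℂ} (hτ : 0 < τ.im) :
    ∃ C : ℝ, 0 ≤ C ∧ ∀ k : ℕ, 1 ≤ k →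
      ‖thetaSeries τ k 0 0 - 1‖ ≤ C * Real.exp (-(2 * Real.pi * τ.im) * k) := by
  have hpi := Real.pi_pos
  have hlt : Real.exp (-(2 * Real.pi * τ.im)) < 1 := by
    rw [Real.exp_lt_one_iff]; nlinarith [mul_pos hpi hτ]
  refine ⟨2 / (1 - Real.exp (-(2 * Real.pi * τ.im))), div_nonneg zero_le_two (by linarith),
    fun k hk => ?_⟩
  have hk0 : (1 : ℝ) ≤ k := by exact_mod_cast hk
  have him : (2 * (k : ℂ) * τ).im = 2 * k * τ.im := by
    have : (2 * (k : ℂ) * τ) = ((2 * k : ℝ) : ℂ) * τ := by push_cast; ring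
    rw [this, Complex.im_ofReal_mul]
  have h := norm_jacobiTheta_sub_one_le (τ := 2 * k * τ) (by rw [him]; positivity)
  have e : thetaSeries τ k 0 0 = jacobiTheta (2 * k * τ) := by
    rw [thetaSeries_zero_eq_holoSection τ hk, holoSection, jacobiTheta_eq_jacobiTheta₂]
    simp
  rw [e]
  refine h.trans ?_
  rw [him]
  have e2 : -Real.pi * (2 * k * τ.im) = -(2 * Real.pi * τ.im) * k := by ring
  rw [e2]
  have hle : Real.exp (-(2 * Real.pi * τ.im) * k) ≤ Real.exp (-(2 * Real.pi * τ.im)) := by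
    apply Real.exp_le_exp.2
    nlinarith [mul_pos hpi hτ]
  gcongr

/-- The explicit expression of the basis `Ψ_l`, up to a phase that is exponentially close to `1`. -/
lemma exists_psi_eq {j : Plane →ₗ[ℝ] Plane} (hj : IsCompatible j) {kappa : Plane →ₗ[ℝ] ℂ}
    (hkappa : IsHalfFormLine j kappa) {Om : ℂ} (hOm : IsHalfForm kappa mu Om)
    {Psi : (k : ℕ) → ZMod (2 * k) → Plane → ℂ}
    (hPsi : ∀ k, 1 ≤ k → IsPsiBasis j kappa Om k (Psi k)) :
    ∃ (u : ℕ → ℂ) (C δ : ℝ), 0 < δ ∧ (∀ k : ℕ, 1 ≤ k → ‖u k - 1‖ ≤ C * Real.exp (-δ * k)) ∧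
      ∀ k : ℕ, 1 ≤ k → ∀ l : ℤ, Psi k (l : ZMod (2 * k))
        = ((((k : ℝ) / (2 * Real.pi)) ^ (1 / 4 : ℝ) : ℝ) * Om * u k : ℂ)
          • thetaSeries (modulus kappa) k l := by
  have hmu := hOm.ne_zero
  have hτ := modulus_im_pos hj hkappa hmu
  have hpi := Real.pi_pos
  obtain ⟨C, -, hC⟩ := exists_norm_thetaSeries_zero_sub_one_le hτ
  set θ : ℕ → ℂ := fun k => thetaSeries (modulus kappa) k 0 0 with hθ
  have hOm0 : Om ≠ 0 := by
    rintro rfl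
    simp [IsHalfForm] at hOm
  have hOmn : ‖Om‖ ^ 4 * ‖kappa mu‖ ^ 2 = 1 := by
    have := congrArg (fun z => ‖z‖ ^ 2) hOm
    simp only [norm_mul, norm_pow, norm_one, one_pow, mul_pow] at this
    rw [← this]
    ring
  have key : ∀ k : ℕ, 1 ≤ k → θ k ≠ 0 ∧ Psi k 0
      = ((((k : ℝ) / (2 * Real.pi)) ^ (1 / 4 : ℝ) : ℝ) * Om * ((‖θ k‖ : ℂ) / θ k) : ℂ)
          • thetaSeries (modulus kappa) k 0 := by
    intro k hk
    have hk0 : (0 : ℝ) < k := by exact_mod_cast hk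
    obtain ⟨c, hc⟩ := eq_smul_psi_zero hk (hPsi k hk)
      (thetaSeries_zero_mem_quantumSpace (zcoord_modulus_complex hkappa hmu) hτ hk)
      (pullback_mu_thetaSeries_zero _ hk)
    have hn := quantumInner_thetaSeries_zero kappa hτ hk
    have hn2 := quantumInner_thetaSeries_zero_sq hj hkappa hmu hk
    rw [hc, quantumInner_smul, (hPsi k hk).orthonormal, if_pos rfl, mul_one, Complex.ofReal_inj] at hn
    rw [← hn] at hn2
    obtain ⟨r, hr, hr0⟩ := (hPsi k hk).normalization
    have hkp : 0 < 2 * Real.pi * ‖kappa mu‖ ^ 2 / k := by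
      have := norm_pos_iff.2 hmu
      positivity
    have hc0 : c ≠ 0 := by
      rintro rfl
      have : (‖(0 : ℂ)‖ ^ 2) ^ 2 = 0 := by simp
      linarith
    have hθc : θ k = c * (r * Om) := by
      simp only [hθ]; rw [hc, Pi.smul_apply, smul_eq_mul, hr0]
    have hrC : (r : ℂ) ≠ 0 := by exact_mod_cast hr.ne'
    have hθ0 : θ k ≠ 0 := by rw [hθc]; exact mul_ne_zero hc0 (mul_ne_zero hrC hOm0)
    refine ⟨hθ0, ?_⟩
    have hnc : ‖c‖ * (((k : ℝ) / (2 * Real.pi)) ^ (1 / 4 : ℝ) * ‖Om‖) = 1 := by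
      have h4 : (((k : ℝ) / (2 * Real.pi)) ^ (1 / 4 : ℝ)) ^ 4 = k / (2 * Real.pi) := by
        rw [← Real.rpow_natCast, ← Real.rpow_mul (by positivity)]
        norm_num
      have : (‖c‖ * (((k : ℝ) / (2 * Real.pi)) ^ (1 / 4 : ℝ) * ‖Om‖)) ^ 4 = 1 := by
        rw [mul_pow, mul_pow, h4, show ‖c‖ ^ 4 = (‖c‖ ^ 2) ^ 2 by ring, hn2]
        field_simp
        linarith
      exact (pow_eq_one_iff_of_nonneg (by positivity) (by norm_num)).1 this
    have hPsi0 : Psi k 0 = c⁻¹ • thetaSeries (modulus kappa) k 0 := by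
      rw [hc, smul_smul, inv_mul_cancel₀ hc0, one_smul]
    rw [hPsi0]
    congr 1
    rw [hθc, norm_mul, norm_mul, Complex.norm_real, Real.norm_of_nonneg hr.le]
    have hnc' : (‖c‖ : ℂ) * (((((k : ℝ) / (2 * Real.pi)) ^ (1 / 4 : ℝ) : ℝ) : ℂ) * ‖Om‖) = 1 := by
      exact_mod_cast hnc
    push_cast
    field_simp
    linear_combination -hnc'
  refine ⟨fun k => (‖θ k‖ : ℂ) / θ k, 4 * C, 2 * Real.pi * (modulus kappa).im, by positivity,
    fun k hk => ?_, fun k hk l => psi_eq_smul_thetaSeries hk (hPsi k hk) (key k hk).2 l⟩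
  have h1 := norm_phase_sub_one_le (θ k) (key k hk).1
  have h2 := hC k hk
  simp only [hθ] at h1 ⊢
  linarith

/-! ### The state as a Gaussian sum -/

lemma hasSum_int_of_residues {E : Type*} [AddCommMonoid E] [TopologicalSpace E] [ContinuousAdd E]
    {f : ℤ → E} {m : ℕ} (hm : 1 ≤ m) {s : ℕ → E}
    (h : ∀ r < m, HasSum (fun ν : ℤ => f (r + m * ν)) (s r)) :
    HasSum f (∑ r ∈ Finset.range m, s r) := by
  have h1 : ∀ r ∈ Finset.range m,
      HasSum (fun n : ℤ => if n % (m : ℤ) = r then f n else 0) (s r) := by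
    intro r hr
    rw [Finset.mem_range] at hr
    have hinj : Function.Injective fun ν : ℤ => (r : ℤ) + m * ν := by
      intro a b hab
      have : (m : ℤ) * a = m * b := by simpa using hab
      exact mul_left_cancel₀ (by omega) this
    rw [← hinj.hasSum_iff]
    · have e : (fun n : ℤ => if n % (m : ℤ) = r then f n else 0) ∘ (fun ν : ℤ => (r : ℤ) + m * ν)
          = fun ν : ℤ => f (r + m * ν) := by
        ext ν
        have : ((r : ℤ) + m * ν) % (m : ℤ) = r := by
          rw [Int.add_mul_emod_self_left]
          exact Int.emod_eq_of_lt (by omega) (by omega)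
        simp [this]
      rw [e]
      exact h r hr
    · intro x hx
      rw [if_neg]
      intro hxr
      exact hx ⟨x / m, by simp only; rw [← hxr]; exact Int.emod_add_mul_ediv x m⟩
  have h2 := hasSum_sum h1
  convert h2 using 2 with n
  have hlt := Int.emod_lt_of_pos n (by omega : (0 : ℤ) < m)
  have hge := Int.emod_nonneg n (by omega : (m : ℤ) ≠ 0)
  rw [Finset.sum_eq_single (n % (m : ℤ)).toNat]
  · rw [if_pos (Int.toNat_of_nonneg hge).symm]
  · intro b _ hb
    rw [if_neg]
    intro hnb
    exact hb (by omega)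
  · intro hn
    rw [Finset.mem_range] at hn
    omega

/-- Sums of wide Gaussians over the integers, uniformly in the centre. -/
lemma exists_wide_gaussian_sum_bound {a : ℝ} (ha : 0 < a) : ∃ C : ℝ, 0 < C ∧
    ∀ (k : ℕ) (b : ℝ), 1 ≤ k → (Summable fun n : ℤ => Real.exp (-(a / k) * (n - b) ^ 2)) ∧
      ∑' n : ℤ, Real.exp (-(a / k) * (n - b) ^ 2) ≤ C * k := by
  obtain ⟨C, hC0, hC⟩ := exists_gaussian_sum_bound ha
  refine ⟨C, hC0, fun k b hk => ?_⟩
  have hk1 : (1 : ℝ) ≤ k := by exact_mod_cast hk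
  have hk0 : (0 : ℝ) < k := by linarith
  have hle : ∀ (r : ℕ) (ν : ℤ), Real.exp (-(a / k) * ((r + k * ν : ℤ) - b) ^ 2)
      ≤ Real.exp (-a * (ν - (b - r) / k) ^ 2) := by
    intro r ν
    apply Real.exp_le_exp.2
    have e : ((r + k * ν : ℤ) : ℝ) - b = k * (ν - (b - r) / k) := by
      push_cast; field_simp; ring
    rw [e, mul_pow]
    have : -(a / k) * (k ^ 2 * (ν - (b - r) / k : ℝ) ^ 2) = -a * (k * (ν - (b - r) / k : ℝ) ^ 2) := by
      field_simp
    rw [this]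
    have h2 := sq_nonneg ((ν : ℝ) - (b - r) / k)
    nlinarith [mul_le_mul_of_nonneg_right hk1 h2]
  have hsum : ∀ r : ℕ, Summable fun ν : ℤ => Real.exp (-(a / k) * ((r + k * ν : ℤ) - b) ^ 2) :=
    fun r => Summable.of_nonneg_of_le (fun _ => (Real.exp_pos _).le) (hle r) (hC _).1
  have h := hasSum_int_of_residues (f := fun n : ℤ => Real.exp (-(a / k) * (n - b) ^ 2)) hk
    (fun r _ => (hsum r).hasSum)
  refine ⟨h.summable, ?_⟩
  rw [h.tsum_eq]
  calc ∑ r ∈ Finset.range k, ∑' ν : ℤ, Real.exp (-(a / k) * ((r + k * ν : ℤ) - b) ^ 2)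
      ≤ ∑ r ∈ Finset.range k, C := by
        refine Finset.sum_le_sum fun r _ => ?_
        exact ((hsum r).tsum_le_tsum (hle r) (hC _).1).trans (hC _).2
    _ = C * k := by simp [mul_comm]

/-- The Verlinde numbers, extended to a `2 k`-periodic odd function of the colour. -/
noncomputable def coeffZ (g k : ℕ) (n : ℤ) : ℝ := ((k : ℝ) / 2) ^ (g - 1) * sineSum (2 * g - 1) k n

lemma one_div_le_abs_sin {k : ℕ} (hk : 1 ≤ k) (n : ℤ) :
    Real.sin (Real.pi * n / k) = 0 ∨ 1 / (k : ℝ) ≤ |Real.sin (Real.pi * n / k)| := by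
  have hk0 : (0 : ℝ) < k := by exact_mod_cast hk
  have hpi := Real.pi_pos
  have hlt := Int.emod_lt_of_pos n (by omega : (0 : ℤ) < k)
  have hge := Int.emod_nonneg n (by omega : (k : ℤ) ≠ 0)
  obtain ⟨r, hr⟩ := Int.eq_ofNat_of_zero_le hge
  have hn : (n : ℝ) = r + k * (n / (k : ℤ) : ℤ) := by
    have := Int.emod_add_mul_ediv n k
    rw [hr] at this
    exact_mod_cast this.symm
  have e : Real.pi * n / k = Real.pi * r / k + (n / (k : ℤ) : ℤ) * Real.pi := by
    rw [hn]; field_simp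
  rw [e, Real.sin_add_int_mul_pi]
  have habs : |(-1 : ℝ) ^ (n / (k : ℤ)) * Real.sin (Real.pi * r / k)| = |Real.sin (Real.pi * r / k)| := by
    rw [abs_mul, abs_zpow, abs_neg, abs_one, one_zpow, one_mul]
  rw [habs]
  rcases Nat.eq_zero_or_pos r with rfl | hr0
  · left; simp
  right
  have hrk : r < k := by omega
  have hs := sin_pos_of_color hr0 hrk
  rw [abs_of_pos hs]
  have hgen : ∀ r : ℕ, 1 ≤ r → 2 * r ≤ k → 1 / (k : ℝ) ≤ Real.sin (Real.pi * r / k) := by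
    intro r hr1 hr2
    have hr1' : (1 : ℝ) ≤ r := by exact_mod_cast hr1
    have hr2' : 2 * (r : ℝ) ≤ k := by exact_mod_cast hr2
    have := Real.mul_le_sin (x := Real.pi * r / k) (by positivity) (by
      rw [div_le_div_iff₀ hk0 two_pos]; nlinarith)
    refine le_trans ?_ this
    rw [div_le_iff₀ hk0]
    have : 2 / Real.pi * (Real.pi * r / k) * k = 2 * r := by field_simp
    rw [this]
    linarith
  by_cases h2 : 2 * r ≤ k
  · exact hgen r hr0 h2
  · have h3 := hgen (k - r) (by omega) (by omega)
    rw [Nat.cast_sub hrk.le] at h3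
    have e2 : Real.pi * (k - r : ℝ) / k = Real.pi - Real.pi * r / k := by field_simp
    rwa [e2, Real.sin_pi_sub] at h3

lemma abs_inv_sin_pow_le {k : ℕ} (hk : 1 ≤ k) (s : ℕ) (n : ℤ) :
    |(Real.sin (Real.pi * n / k) ^ s)⁻¹| ≤ (k : ℝ) ^ s := by
  have hk0 : (0 : ℝ) < k := by exact_mod_cast hk
  rw [abs_inv, abs_pow, ← inv_pow]
  rcases one_div_le_abs_sin hk n with h | h
  · rw [h, abs_zero, inv_zero]
    exact pow_le_pow_left₀ le_rfl hk0.le s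
  · refine pow_le_pow_left₀ (by positivity) ?_ s
    rw [inv_le_comm₀ (lt_of_lt_of_le (by positivity) h) hk0]
    simpa using h

lemma abs_coeffZ_le {g : ℕ} (hg : 1 ≤ g) {k : ℕ} (hk : 1 ≤ k) (n : ℤ) :
    |coeffZ g k n| ≤ (k : ℝ) ^ (3 * g) := by
  have hk1 : (1 : ℝ) ≤ k := by exact_mod_cast hk
  have h1 : |sineSum (2 * g - 1) k n| ≤ k * (k : ℝ) ^ (2 * g - 1) := by
    rw [sineSum]
    refine (Finset.abs_sum_le_sum_abs _ _).trans ?_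
    calc _ ≤ ∑ m ∈ Finset.range k, (k : ℝ) ^ (2 * g - 1) := by
          refine Finset.sum_le_sum fun m _ => ?_
          rw [abs_mul]
          have h2 := abs_inv_sin_pow_le hk (2 * g - 1) m
          rw [Int.cast_natCast] at h2
          calc _ ≤ 1 * (k : ℝ) ^ (2 * g - 1) :=
                mul_le_mul (Real.abs_sin_le_one _) h2 (abs_nonneg _) zero_le_one
            _ = _ := one_mul _
      _ = _ := by simp
  rw [coeffZ, abs_mul, abs_of_nonneg (by positivity)]
  calc ((k : ℝ) / 2) ^ (g - 1) * |sineSum (2 * g - 1) k n|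
      ≤ (k : ℝ) ^ (g - 1) * (k * (k : ℝ) ^ (2 * g - 1)) := by
        refine mul_le_mul (pow_le_pow_left₀ (by positivity) (by linarith) _) h1 (abs_nonneg _)
          (by positivity)
    _ = (k : ℝ) ^ ((g - 1) + (1 + (2 * g - 1))) := by rw [pow_add, pow_add, pow_one]
    _ ≤ (k : ℝ) ^ (3 * g) := by
        exact pow_le_pow_right₀ hk1 (by omega)

lemma coeffZ_add_period (g k : ℕ) (n j : ℤ) : coeffZ g k (n + 2 * k * j) = coeffZ g k n := by
  rw [coeffZ, coeffZ, sineSum_add_period]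

lemma sum_range_two_mul_eq {E : Type*} [AddCommMonoid E] {k : ℕ} (hk : 1 ≤ k) (F : ℕ → E) :
    ∑ r ∈ Finset.range (2 * k), F r = F 0 + F k + ∑ r ∈ Finset.Ico 1 k, (F r + F (2 * k - r)) := by
  rw [Finset.range_eq_Ico, ← Finset.sum_Ico_consecutive F (Nat.zero_le k) (by omega),
    Finset.sum_eq_sum_Ico_succ_bot hk, Finset.sum_eq_sum_Ico_succ_bot (by omega : k < 2 * k),
    Finset.sum_add_distrib]
  have : ∑ r ∈ Finset.Ico 1 k, F (2 * k - r) = ∑ r ∈ Finset.Ico (k + 1) (2 * k), F r := by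
    refine Finset.sum_nbij' (fun r => 2 * k - r) (fun r => 2 * k - r) ?_ ?_ ?_ ?_ ?_ <;>
      intro r hr <;> simp only [Finset.mem_Ico] at hr ⊢ <;> omega
  rw [this]
  simp only [zero_add]
  abel

lemma hasSum_coeffZ {τ : ℂ} (hτ : 0 < τ.im) (g : ℕ) {k : ℕ} (hk : 1 ≤ k) (y : Plane) :
    HasSum (fun n : ℤ => (coeffZ g k n : ℂ) * thetaTerm τ k n y)
      (∑ l ∈ Finset.Ico 1 k, (coeffZ g k l : ℂ) * (thetaSeries τ k l y - thetaSeries τ k (-l) y)) := by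
  have h := hasSum_int_of_residues (f := fun n : ℤ => (coeffZ g k n : ℂ) * thetaTerm τ k n y)
    (m := 2 * k) (by omega) (s := fun r => (coeffZ g k r : ℂ) * thetaSeries τ k r y) (by
      intro r _
      have := ((summable_thetaSeries hτ hk r y).hasSum).mul_left (coeffZ g k r : ℂ)
      have e : (fun ν : ℤ => (coeffZ g k (r + (2 * k : ℕ) * ν) : ℂ) *
          thetaTerm τ k (r + (2 * k : ℕ) * ν) y)
          = fun ν : ℤ => (coeffZ g k r : ℂ) * thetaTerm τ k (r + 2 * k * ν) y := by
        ext ν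
        push_cast
        rw [coeffZ_add_period]
      rw [e]
      exact this)
  rw [sum_range_two_mul_eq hk] at h
  have h0 : coeffZ g k (0 : ℕ) = 0 := by
    have := sineSum_neg (2 * g - 1) k 0
    rw [neg_zero] at this
    rw [coeffZ, Nat.cast_zero, show sineSum (2 * g - 1) k 0 = 0 by linarith, mul_zero]
  have hkk : coeffZ g k (k : ℕ) = 0 := by
    have := sineSum_period_sub (2 * g - 1) k k
    rw [show (2 * (k : ℤ) - k) = k by ring] at this
    rw [coeffZ, show sineSum (2 * g - 1) k k = 0 by linarith, mul_zero]
  rw [h0, hkk] at h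
  simp only [Complex.ofReal_zero, zero_mul, zero_add] at h
  convert h using 1
  refine Finset.sum_congr rfl fun l hl => ?_
  rw [Finset.mem_Ico] at hl
  have e1 : ((2 * k - l : ℕ) : ℤ) = 2 * k - l := by
    rw [Nat.cast_sub (by omega)]; push_cast; rfl
  have e2 : coeffZ g k (2 * k - l) = - coeffZ g k l := by
    rw [coeffZ, coeffZ, sineSum_period_sub]; ring
  have e3 : thetaSeries τ k (2 * k - l) = thetaSeries τ k (-l) := by
    rw [← thetaSeries_add_period τ k (-l) 1]; congr 1; ring
  rw [e1, e2, e3]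
  push_cast
  ring

/-- The Gaussian sum to which the state `Z_k` is proportional. -/
noncomputable def gaussZ (g : ℕ) (τ : ℂ) (k : ℕ) (y : Plane) : ℂ :=
  ∑' n : ℤ, (coeffZ g k n : ℂ) * thetaTerm τ k n y

lemma exists_stateZ_eq {g : ℕ} (hg : 1 ≤ g) (G : PantsDecomposition g) {j : Plane →ₗ[ℝ] Plane}
    (hj : IsCompatible j) {kappa : Plane →ₗ[ℝ] ℂ} (hkappa : IsHalfFormLine j kappa) {Om : ℂ}
    (hOm : IsHalfForm kappa mu Om) {Psi : (k : ℕ) → ZMod (2 * k) → Plane → ℂ}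
    (hPsi : ∀ k, 1 ≤ k → IsPsiBasis j kappa Om k (Psi k)) :
    ∃ (u : ℕ → ℂ) (C δ : ℝ), 0 < δ ∧ (∀ k : ℕ, 1 ≤ k → ‖u k - 1‖ ≤ C * Real.exp (-δ * k)) ∧
      ∀ k : ℕ, 1 ≤ k → ∀ y, stateZ G Psi k y
        = ((((k : ℝ) / (2 * Real.pi)) ^ (1 / 4 : ℝ) : ℝ) * Om * u k : ℂ)
          * (((Real.sqrt 2 : ℝ) : ℂ)⁻¹ * gaussZ g (modulus kappa) k y) := by
  obtain ⟨u, C, δ, hδ, hu, hP⟩ := exists_psi_eq hj hkappa hOm hPsi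
  refine ⟨u, C, δ, hδ, hu, fun k hk y => ?_⟩
  have hτ := modulus_im_pos hj hkappa hOm.ne_zero
  rw [gaussZ, (hasSum_coeffZ hτ g hk y).tsum_eq, stateZ, Finset.sum_apply, Finset.mul_sum,
    Finset.mul_sum]
  refine Finset.sum_congr rfl fun l hl => ?_
  rw [Finset.mem_Ico] at hl
  have h1 := hP k hk l
  have h2 := hP k hk (-l)
  push_cast at h1 h2
  have h3 : ((verlindeNumber G k l : ℕ) : ℂ) = (coeffZ g k l : ℂ) := by
    rw [coeffZ, ← verlindeNumber_eq_sineSum hg G hl.2, Complex.ofReal_natCast]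
  rw [h1, h2, h3]
  simp only [Pi.smul_apply, Pi.sub_apply, smul_eq_mul]
  ring

lemma exists_norm_gaussZ_le {g : ℕ} (hg : 1 ≤ g) {τ : ℂ} (hτ : 0 < τ.im) : ∃ C : ℝ, 0 < C ∧
    ∀ k : ℕ, 1 ≤ k → ∀ y, ‖gaussZ g τ k y‖ ≤ C * (k : ℝ) ^ (3 * g + 1) := by
  have hpi := Real.pi_pos
  obtain ⟨C, hC0, hC⟩ := exists_wide_gaussian_sum_bound (a := Real.pi * τ.im / 2) (by positivity)
  refine ⟨C, hC0, fun k hk y => ?_⟩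
  have hk0 : (0 : ℝ) < k := by exact_mod_cast hk
  obtain ⟨hs, hle⟩ := hC k (-(2 * k * y.2)) hk
  have hb : ∀ n : ℤ, ‖(coeffZ g k n : ℂ) * thetaTerm τ k n y‖
      ≤ (k : ℝ) ^ (3 * g) * Real.exp (-(Real.pi * τ.im / 2 / k) * (n - -(2 * k * y.2)) ^ 2) := by
    intro n
    rw [norm_mul, Complex.norm_real, Real.norm_eq_abs, norm_thetaTerm]
    have e : -(2 * Real.pi * k * τ.im) * (y.2 + n / (2 * k)) ^ 2
        = -(Real.pi * τ.im / 2 / k) * (n - -(2 * k * y.2)) ^ 2 := by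
      field_simp; ring
    rw [e]
    exact mul_le_mul_of_nonneg_right (abs_coeffZ_le hg hk n) (Real.exp_pos _).le
  refine (tsum_of_norm_bounded (hs.mul_left _).hasSum hb).trans ?_
  rw [tsum_mul_left, pow_succ]
  calc _ ≤ (k : ℝ) ^ (3 * g) * (C * k) := by gcongr
    _ = _ := by ring

lemma quantumNorm_le {kappa : Plane →ₗ[ℝ] ℂ} {f : Plane → ℂ} {B : ℝ} (hB0 : 0 ≤ B)
    (hB : ∀ y, ‖f y‖ ≤ B) :
    quantumNorm kappa f ≤ Real.sqrt (4 * Real.pi * halfFormNormSq kappa) * B := by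
  have hh : 0 ≤ 4 * Real.pi * halfFormNormSq kappa :=
    mul_nonneg (by have := Real.pi_pos; positivity) (Real.sqrt_nonneg _)
  have h1 : ‖quantumInner kappa f f‖ ≤ 4 * Real.pi * halfFormNormSq kappa * B ^ 2 := by
    have h2 : ∀ p q : ℝ, ‖((4 * Real.pi * halfFormNormSq kappa : ℝ) : ℂ) *
        (f (p, q) * (starRingEnd ℂ) (f (p, q)))‖ ≤ 4 * Real.pi * halfFormNormSq kappa * B ^ 2 := by
      intro p q
      rw [norm_mul, norm_mul, RCLike.norm_conj, Complex.norm_real, Real.norm_of_nonneg hh, ← sq]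
      exact mul_le_mul_of_nonneg_left (pow_le_pow_left₀ (norm_nonneg _) (hB _) 2) hh
    have h3 : ∀ p : ℝ, ‖∫ q in (0 : ℝ)..1, ((4 * Real.pi * halfFormNormSq kappa : ℝ) : ℂ) *
        (f (p, q) * (starRingEnd ℂ) (f (p, q)))‖ ≤ 4 * Real.pi * halfFormNormSq kappa * B ^ 2 := by
      intro p
      simpa using intervalIntegral.norm_integral_le_of_norm_le_const (a := 0) (b := 1)
        (fun q _ => h2 p q)
    rw [quantumInner]
    simpa using intervalIntegral.norm_integral_le_of_norm_le_const (a := 0) (b := 1)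
      (fun p _ => h3 p)
  rw [quantumNorm]
  calc Real.sqrt (quantumInner kappa f f).re
      ≤ Real.sqrt (4 * Real.pi * halfFormNormSq kappa * B ^ 2) :=
        Real.sqrt_le_sqrt ((Complex.re_le_norm _).trans h1)
    _ = _ := by rw [Real.sqrt_mul hh, Real.sqrt_sq hB0]

lemma zero_mem_quantumSpace (j : Plane →ₗ[ℝ] Plane) (k : ℕ) : (0 : Plane → ℂ) ∈ quantumSpace j k := by
  refine ⟨contDiff_const, fun r _ x _ => by simp, fun v x => ?_⟩
  simp [dbar, nabla]

lemma add_mem_quantumSpace {j : Plane →ₗ[ℝ] Plane} {k : ℕ} {f h : Plane → ℂ}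
    (hf : f ∈ quantumSpace j k) (hh : h ∈ quantumSpace j k) : f + h ∈ quantumSpace j k := by
  refine ⟨hf.1.add hh.1, fun r hr x hx => ?_, fun v x => ?_⟩
  · rw [Pi.add_apply, Pi.add_apply, hf.2.1 r hr x hx, hh.2.1 r hr x hx, mul_add]
  · have h1 := hf.2.2 v x
    have h2 := hh.2.2 v x
    have d1 : DifferentiableAt ℝ f x := (hf.1.differentiable (by simp)).differentiableAt
    have d2 : DifferentiableAt ℝ h x := (hh.1.differentiable (by simp)).differentiableAt
    simp only [dbar, nabla] at h1 h2 ⊢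
    rw [fderiv_add d1 d2]
    simp only [add_apply, Pi.add_apply]
    linear_combination h1 + h2

lemma smul_mem_quantumSpace {j : Plane →ₗ[ℝ] Plane} {k : ℕ} {f : Plane → ℂ} (c : ℂ)
    (hf : f ∈ quantumSpace j k) : c • f ∈ quantumSpace j k := by
  refine ⟨contDiff_const.smul hf.1, fun r hr x hx => ?_, fun v x => ?_⟩
  · rw [Pi.smul_apply, Pi.smul_apply, hf.2.1 r hr x hx, smul_eq_mul, smul_eq_mul]
    ring
  · have h1 := hf.2.2 v x
    have d1 : DifferentiableAt ℝ f x := (hf.1.differentiable (by simp)).differentiableAt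
    simp only [dbar, nabla] at h1 ⊢
    rw [fderiv_const_smul d1]
    simp only [smul_apply, Pi.smul_apply, smul_eq_mul]
    linear_combination c * h1

lemma stateZ_mem_quantumSpace {g : ℕ} (G : PantsDecomposition g) {j : Plane →ₗ[ℝ] Plane}
    {kappa : Plane →ₗ[ℝ] ℂ} {Om : ℂ} {Psi : (k : ℕ) → ZMod (2 * k) → Plane → ℂ} {k : ℕ}
    (hPsi : IsPsiBasis j kappa Om k (Psi k)) : stateZ G Psi k ∈ quantumSpace j k := by
  rw [stateZ]
  refine Finset.sum_induction _ (· ∈ quantumSpace j k) (fun _ _ => add_mem_quantumSpace)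
    (zero_mem_quantumSpace j k) fun l _ => ?_
  rw [sub_eq_add_neg, ← neg_one_smul ℂ]
  exact smul_mem_quantumSpace _ (smul_mem_quantumSpace _ (add_mem_quantumSpace (hPsi.mem _)
    (smul_mem_quantumSpace _ (hPsi.mem _))))

/-! ### Local expansions of holomorphic functions -/

lemma exists_exp_neg_le {δ : ℝ} (hδ : 0 < δ) (L : ℕ) : ∃ C : ℝ, 0 < C ∧ ∀ k : ℕ, 1 ≤ k →
    Real.exp (-δ * k) ≤ C * ((k : ℝ) ^ L)⁻¹ := by
  refine ⟨L.factorial / δ ^ L, by positivity, fun k hk => ?_⟩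
  have hk0 : (0 : ℝ) < k := by exact_mod_cast hk
  have h := Real.pow_div_factorial_le_exp (δ * k) (by positivity) L
  have hf : (0 : ℝ) < L.factorial := by positivity
  rw [neg_mul, Real.exp_neg, inv_le_iff_one_le_mul₀ (Real.exp_pos _)]
  calc (1 : ℝ) = L.factorial / δ ^ L * ((k : ℝ) ^ L)⁻¹ * ((δ * k) ^ L / L.factorial) := by
        rw [mul_pow]; field_simp
    _ ≤ _ := by gcongr

lemma exists_pow_mul_exp_neg_le {a : ℝ} (ha : 0 < a) (L : ℕ) : ∃ C : ℝ, 0 < C ∧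
    ∀ (k : ℕ) (u : ℝ), 1 ≤ k → u ^ (2 * L) * Real.exp (-(a * k) * u ^ 2) ≤ C * ((k : ℝ) ^ L)⁻¹ := by
  refine ⟨L.factorial / a ^ L, by positivity, fun k u hk => ?_⟩
  have hk0 : (0 : ℝ) < k := by exact_mod_cast hk
  have h := Real.pow_div_factorial_le_exp (a * k * u ^ 2) (by positivity) L
  have hf : (0 : ℝ) < L.factorial := by positivity
  have e : u ^ (2 * L) = L.factorial / a ^ L * ((k : ℝ) ^ L)⁻¹ * ((a * k * u ^ 2) ^ L / L.factorial) := by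
    rw [mul_pow, mul_pow, ← pow_mul]; field_simp
  rw [e, mul_assoc]
  refine mul_le_of_le_one_right (by positivity) ?_
  rw [neg_mul, Real.exp_neg, mul_inv_le_iff₀ (Real.exp_pos _), one_mul]
  exact h

/-- Taylor's formula for a holomorphic function, uniform in the centre. -/
lemma exists_taylor_bound {b : ℂ → ℂ} {x₀ : ℂ} {R : ℝ} (hR : 0 < R)
    (hb : DifferentiableOn ℂ b (Metric.ball x₀ R)) (L : ℕ) : ∃ C : ℝ, 0 < C ∧
      ∀ w₀ ∈ Metric.ball x₀ (R / 16),
        (∀ n < L, ‖iteratedDeriv n b w₀ / n.factorial‖ ≤ C) ∧ ∀ w ∈ Metric.ball x₀ (R / 16),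
          ‖b w - ∑ n ∈ Finset.range L, iteratedDeriv n b w₀ / n.factorial * (w - w₀) ^ n‖
            ≤ C * ‖w - w₀‖ ^ L := by
  have hcb : Metric.closedBall x₀ (R / 2) ⊆ Metric.ball x₀ R :=
    Metric.closedBall_subset_ball (by linarith)
  obtain ⟨M, hM⟩ := (isCompact_closedBall x₀ (R / 2)).exists_bound_of_continuousOn
    (hb.continuousOn.mono hcb)
  set M' := max M 1 with hM'
  have hM'0 : 0 < M' := lt_of_lt_of_le one_pos (le_max_right _ _)
  set q : ℝ := (R / 4)⁻¹ with hq
  have hq0 : 0 < q := by positivity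
  have hco : ∀ w₀ ∈ Metric.ball x₀ (R / 16), ∀ n : ℕ,
      ‖iteratedDeriv n b w₀ / n.factorial‖ ≤ M' * q ^ n := by
    intro w₀ hw₀ n
    rw [Metric.mem_ball, dist_eq_norm] at hw₀
    have hsub : Metric.closedBall w₀ (R / 4) ⊆ Metric.closedBall x₀ (R / 2) := by
      refine Metric.closedBall_subset_closedBall' ?_
      rw [dist_eq_norm]; linarith
    have h := Complex.norm_iteratedDeriv_le_of_forall_mem_sphere_norm_le (f := b) (c := w₀)
      (R := R / 4) (C := M') n (by positivity)
      ((hb.mono (hsub.trans hcb)).diffContOnCl_ball (by rfl))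
      (fun z hz => (hM z (hsub (Metric.sphere_subset_closedBall hz))).trans (le_max_left _ _))
    rw [norm_div, Complex.norm_natCast, div_le_iff₀ (by positivity)]
    refine h.trans (le_of_eq ?_)
    rw [hq, inv_pow]
    field_simp
  refine ⟨M' * ∑ n ∈ Finset.range (L + 1), q ^ n + 2 * M' * q ^ L, by positivity, fun w₀ hw₀ => ⟨fun n hn => ?_,
    fun w hw => ?_⟩⟩
  · refine (hco w₀ hw₀ n).trans ?_
    have := Finset.single_le_sum (f := fun n => q ^ n) (fun i _ => by positivity)
      (Finset.mem_range.2 (by omega : n < L + 1))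
    have h2 : 0 ≤ 2 * M' * q ^ L := by positivity
    have h3 := mul_le_mul_of_nonneg_left this hM'0.le
    linarith
  · have hd : ‖w - w₀‖ < R / 8 := by
      rw [Metric.mem_ball, dist_eq_norm] at hw₀ hw
      calc ‖w - w₀‖ = ‖(w - x₀) - (w₀ - x₀)‖ := by congr 1; ring
        _ ≤ ‖w - x₀‖ + ‖w₀ - x₀‖ := norm_sub_le _ _
        _ < R / 8 := by linarith
    have hball : Metric.ball w₀ (R / 4) ⊆ Metric.ball x₀ R := by
      refine Metric.ball_subset_ball' ?_
      rw [Metric.mem_ball] at hw₀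
      linarith
    have hs := Complex.hasSum_taylorSeries_on_ball (hb.mono hball) (z := w)
      (by rw [Metric.mem_ball, dist_eq_norm]; linarith)
    have hs2 := (hasSum_nat_add_iff' L).2 hs
    have e : ∀ n : ℕ, ((n.factorial : ℂ))⁻¹ • (w - w₀) ^ n • iteratedDeriv n b w₀
        = iteratedDeriv n b w₀ / n.factorial * (w - w₀) ^ n := by
      intro n; simp only [smul_eq_mul]; ring
    simp only [e] at hs2
    set t : ℝ := q * ‖w - w₀‖ with ht
    have ht0 : 0 ≤ t := by positivity
    have ht1 : t ≤ 1 / 2 := by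
      rw [ht, hq, inv_mul_le_iff₀ (by positivity)]
      linarith
    have hgeo : HasSum (fun n : ℕ => M' * t ^ L * t ^ n) (M' * t ^ L * (1 - t)⁻¹) :=
      (hasSum_geometric_of_lt_one ht0 (by linarith)).mul_left _
    have hle : ∀ n : ℕ, ‖iteratedDeriv (n + L) b w₀ / (n + L).factorial * (w - w₀) ^ (n + L)‖
        ≤ M' * t ^ L * t ^ n := by
      intro n
      rw [norm_mul, norm_pow]
      calc _ ≤ M' * q ^ (n + L) * ‖w - w₀‖ ^ (n + L) :=
            mul_le_mul_of_nonneg_right (hco w₀ hw₀ _) (by positivity)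
        _ = _ := by rw [ht, mul_pow, mul_pow, pow_add, pow_add]; ring
    have := tsum_of_norm_bounded hgeo hle
    rw [hs2.tsum_eq] at this
    refine this.trans ?_
    have h2 : (1 - t)⁻¹ ≤ 2 := by
      rw [inv_le_comm₀ (by linarith) two_pos]; linarith
    calc M' * t ^ L * (1 - t)⁻¹ ≤ M' * t ^ L * 2 := by gcongr
      _ = (2 * M' * q ^ L) * ‖w - w₀‖ ^ L := by rw [ht, mul_pow]; ring
      _ ≤ _ := by
        refine mul_le_mul_of_nonneg_right ?_ (by positivity)
        have : 0 ≤ M' * ∑ n ∈ Finset.range (L + 1), q ^ n := by positivity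
        linarith

/-- Expansion of a holomorphic function in characters `exp (2 i π m (x - P))`. Up to order `L` at
`P`, such an expansion carries the same information as a Taylor expansion, but Gaussian sums of
characters can be computed exactly. -/
lemma exists_character_expansion {b : ℂ → ℂ} {x₀ : ℝ} {r : ℝ} (hr : 0 < r)
    (hb : DifferentiableOn ℂ b (Metric.ball (x₀ : ℂ) r)) : ∃ ρ : ℝ, 0 < ρ ∧ ∀ L : ℕ,
      ∃ (C : ℝ) (γ : ℝ → ℕ → ℂ), 0 < C ∧ ∀ P : ℝ, |P - x₀| < ρ →
        (∀ i < L, ‖γ P i‖ ≤ C) ∧ ∀ x : ℂ, ‖x - x₀‖ < ρ →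
          ‖b x - ∑ i ∈ Finset.range L, γ P i * Complex.exp (2 * Real.pi * Complex.I * i * (x - P))‖
            ≤ C * ‖x - P‖ ^ L := by
  have hpi := Real.pi_pos
  have hpi4 := Real.pi_le_four
  have hpic : (Real.pi : ℂ) ≠ 0 := by exact_mod_cast hpi.ne'
  have h2pi : (2 * Real.pi * Complex.I : ℂ) ≠ 0 := by simp [hpic]
  have hn2pi : ‖(2 * Real.pi * Complex.I : ℂ)‖ = 2 * Real.pi := by
    rw [norm_mul, norm_mul, Complex.norm_I, Complex.norm_real, Real.norm_of_nonneg hpi.le]; simp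
  -- in the variable `v = exp (2 i π (x - x₀))`, characters become powers
  set lg : ℂ → ℂ := fun v => x₀ + Complex.log v / (2 * Real.pi * Complex.I) with hlg
  have hlgd : ∀ v ∈ Complex.slitPlane, DifferentiableAt ℂ lg v := fun v hv =>
    ((differentiableAt_id.clog hv).div_const _).const_add _
  have h1s : (1 : ℂ) ∈ Complex.slitPlane := by simp
  have hev : ∀ᶠ v in nhds (1 : ℂ), v ∈ Complex.slitPlane ∧ lg v ∈ Metric.ball (x₀ : ℂ) r := by
    refine Filter.Eventually.and (Complex.isOpen_slitPlane.eventually_mem h1s) ?_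
    refine (hlgd 1 h1s).continuousAt.eventually (Metric.isOpen_ball.mem_nhds ?_)
    simp [hlg, hr]
  obtain ⟨R, hR, hRb⟩ := Metric.eventually_nhds_iff_ball.1 hev
  set β : ℂ → ℂ := fun v => b (lg v) with hβ
  have hβd : DifferentiableOn ℂ β (Metric.ball 1 R) := by
    intro v hv
    obtain ⟨h1, h2⟩ := hRb v hv
    exact ((hb.differentiableAt (Metric.isOpen_ball.mem_nhds h2)).comp v (hlgd v h1)).differentiableWithinAt
  set ex : ℂ → ℂ := fun x => Complex.exp (2 * Real.pi * Complex.I * (x - x₀)) with hex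
  have hexc : Continuous ex := by simp only [hex]; fun_prop
  have hev2 : ∀ᶠ x in nhds (x₀ : ℂ), ex x ∈ Metric.ball (1 : ℂ) (R / 16) := by
    refine hexc.continuousAt.eventually (Metric.isOpen_ball.mem_nhds ?_)
    simp [hex]; linarith
  obtain ⟨ρ', hρ', hρb⟩ := Metric.eventually_nhds_iff_ball.1 hev2
  have hβex : ∀ x : ℂ, ‖x - x₀‖ < 1 / 16 → β (ex x) = b x := by
    intro x hx
    have hre : |(x - x₀).re| < 1 / 16 := (Complex.abs_re_le_norm _).trans_lt hx
    rw [abs_lt] at hre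
    have him : (2 * Real.pi * Complex.I * (x - x₀)).im = 2 * Real.pi * (x - x₀).re := by
      rw [show (2 * Real.pi * Complex.I * (x - x₀) : ℂ)
        = ((2 * Real.pi : ℝ) : ℂ) * (Complex.I * (x - x₀)) by push_cast; ring,
        Complex.im_ofReal_mul]
      simp
    simp only [hβ, hlg, hex]
    rw [Complex.log_exp (by rw [him]; nlinarith) (by rw [him]; nlinarith), mul_div_cancel_left₀ _ h2pi]
    congr 1
    ring
  refine ⟨min ρ' (1 / 16), by positivity, fun L => ?_⟩
  obtain ⟨C₀, hC₀, hT⟩ := exists_taylor_bound hR hβd L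
  set t : ℝ → ℕ → ℂ := fun P n =>
    iteratedDeriv n β (ex P) / n.factorial * (ex P) ^ n with ht
  set pc : ℕ → ℕ → ℂ := fun n i => (((Polynomial.X - Polynomial.C 1) ^ n : Polynomial ℂ)).coeff i with hpc
  set D : ℝ := ∑ n ∈ Finset.range L, ∑ i ∈ Finset.range L, ‖pc n i‖ with hD
  have hD0 : 0 ≤ D := by positivity
  refine ⟨C₀ * D + C₀ * (4 * Real.pi) ^ L, fun P i => ∑ n ∈ Finset.range L, t P n * pc n i,
    by positivity, fun P hP => ?_⟩
  have hexP : ‖ex P‖ = 1 := by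
    simp only [hex]
    rw [show (2 * Real.pi * Complex.I * (P - x₀) : ℂ) = ((2 * Real.pi * (P - x₀) : ℝ) : ℂ) * Complex.I by
      push_cast; ring, Complex.norm_exp_ofReal_mul_I]
  have hPn : ‖(P : ℂ) - x₀‖ < min ρ' (1 / 16) := by
    rw [← Complex.ofReal_sub, Complex.norm_real, Real.norm_eq_abs]; exact hP
  have hexPb : ex P ∈ Metric.ball (1 : ℂ) (R / 16) := by
    refine hρb P ?_
    rw [Metric.mem_ball, dist_eq_norm]
    exact hPn.trans_le (min_le_left _ _)
  obtain ⟨hT1, hT2⟩ := hT (ex P) hexPb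
  have htn : ∀ n < L, ‖t P n‖ ≤ C₀ := by
    intro n hn
    simp only [ht]
    rw [norm_mul, norm_pow, hexP, one_pow, mul_one]
    exact hT1 n hn
  refine ⟨fun i hi => ?_, fun x hx => ?_⟩
  · calc ‖∑ n ∈ Finset.range L, t P n * pc n i‖ ≤ ∑ n ∈ Finset.range L, C₀ * ‖pc n i‖ := by
          refine norm_sum_le_of_le _ fun n hn => ?_
          rw [norm_mul]
          exact mul_le_mul_of_nonneg_right (htn n (Finset.mem_range.1 hn)) (norm_nonneg _)
      _ = C₀ * ∑ n ∈ Finset.range L, ‖pc n i‖ := by rw [Finset.mul_sum]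
      _ ≤ C₀ * D := by
          refine mul_le_mul_of_nonneg_left (Finset.sum_le_sum fun n _ => ?_) hC₀.le
          exact Finset.single_le_sum (f := fun i => ‖pc n i‖) (fun _ _ => norm_nonneg _)
            (Finset.mem_range.2 hi)
      _ ≤ _ := le_add_of_nonneg_right (by positivity)
  · have hxb : ex x ∈ Metric.ball (1 : ℂ) (R / 16) := by
      refine hρb x ?_
      rw [Metric.mem_ball, dist_eq_norm]
      exact hx.trans_le (min_le_left _ _)
    set u : ℂ := Complex.exp (2 * Real.pi * Complex.I * (x - P)) with hu
    have hexu : ex x = ex P * u := by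
      simp only [hex, hu]
      rw [← Complex.exp_add]
      congr 1
      ring
    have hsum : ∑ i ∈ Finset.range L, (∑ n ∈ Finset.range L, t P n * pc n i) *
        Complex.exp (2 * Real.pi * Complex.I * i * (x - P))
        = ∑ n ∈ Finset.range L, iteratedDeriv n β (ex P) / n.factorial * (ex x - ex P) ^ n := by
      have hui : ∀ i : ℕ, Complex.exp (2 * Real.pi * Complex.I * i * (x - P)) = u ^ i := by
        intro i
        rw [hu, ← Complex.exp_nat_mul]
        congr 1
        ring
      simp only [hui, Finset.sum_mul]
      rw [Finset.sum_comm]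
      refine Finset.sum_congr rfl fun n hn => ?_
      rw [Finset.mem_range] at hn
      have hev := Polynomial.eval_eq_sum_range' (p := ((Polynomial.X - Polynomial.C 1) ^ n : Polynomial ℂ))
        (n := L) (by rw [Polynomial.natDegree_pow, Polynomial.natDegree_X_sub_C]; omega) u
      simp only [Polynomial.eval_pow, Polynomial.eval_sub, Polynomial.eval_X, Polynomial.eval_C] at hev
      rw [hexu, show ex P * u - ex P = ex P * (u - 1) by ring, mul_pow, hev, Finset.mul_sum,
        Finset.mul_sum]
      refine Finset.sum_congr rfl fun i _ => ?_
      simp only [ht, hpc]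
      ring
    rw [hsum, ← hβex x (hx.trans_le (min_le_right _ _))]
    refine (hT2 (ex x) hxb).trans ?_
    have hxP : ‖x - P‖ ≤ 1 / 8 := by
      calc ‖x - P‖ = ‖(x - x₀) - (P - x₀)‖ := by congr 1; ring
        _ ≤ ‖x - x₀‖ + ‖(P : ℂ) - x₀‖ := norm_sub_le _ _
        _ ≤ 1 / 16 + 1 / 16 := add_le_add (hx.le.trans (min_le_right _ _)) (hPn.le.trans (min_le_right _ _))
        _ = 1 / 8 := by norm_num
    have hnu : ‖ex x - ex P‖ ≤ 4 * Real.pi * ‖x - P‖ := by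
      rw [hexu, show ex P * u - ex P = ex P * (u - 1) by ring, norm_mul, hexP, one_mul]
      have hn : ‖2 * Real.pi * Complex.I * (x - P)‖ = 2 * Real.pi * ‖x - P‖ := by
        rw [norm_mul, hn2pi]
      have := Complex.norm_exp_sub_one_le (x := 2 * Real.pi * Complex.I * (x - P))
        (by rw [hn]; nlinarith [norm_nonneg (x - P)])
      rw [hn] at this
      linarith
    calc C₀ * ‖ex x - ex P‖ ^ L ≤ C₀ * (4 * Real.pi * ‖x - P‖) ^ L := by gcongr
      _ = C₀ * (4 * Real.pi) ^ L * ‖x - P‖ ^ L := by rw [mul_pow]; ring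
      _ ≤ _ := by
        refine mul_le_mul_of_nonneg_right ?_ (by positivity)
        have : 0 ≤ C₀ * D := by positivity
        linarith

/-! ### Gaussian sums and Poisson summation -/

/-- The terms of a Gaussian sum, with centre `P`, frequency `Q` and quadratic coefficient `c`. -/
noncomputable def gaussTerm (c : ℂ) (k : ℕ) (P Q : ℝ) (N : ℤ) : ℂ :=
  Complex.exp (2 * Real.pi * Complex.I * N * Q - k * c * (P - N / (2 * k)) ^ 2)

/-- A Gaussian sum with coefficients `a`. -/
noncomputable def gaussSum (a : ℕ → ℤ → ℂ) (c : ℂ) (k : ℕ) (P Q : ℝ) : ℂ :=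
  ∑' N : ℤ, a k N * gaussTerm c k P Q N

/-- The total mass of the Gaussian. -/
noncomputable def gaussMass (c : ℂ) : ℂ := ∫ s : ℝ, Complex.exp (-c * s ^ 2)

lemma gaussMass_eq {c : ℂ} (hc : 0 < c.re) : gaussMass c = (Real.pi / c) ^ (1 / 2 : ℂ) :=
  integral_gaussian_complex hc

lemma gaussMass_sq {c : ℂ} (hc : 0 < c.re) : gaussMass c ^ 2 = Real.pi / c := by
  rw [gaussMass_eq hc, ← Complex.cpow_nat_mul]
  norm_num

lemma ne_zero_of_re_pos {c : ℂ} (hc : 0 < c.re) : c ≠ 0 := by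
  rintro rfl
  simp at hc

lemma gaussMass_ne_zero {c : ℂ} (hc : 0 < c.re) : gaussMass c ≠ 0 := by
  intro h
  have := gaussMass_sq hc
  rw [h] at this
  have hpi : (Real.pi : ℂ) ≠ 0 := by exact_mod_cast Real.pi_ne_zero
  exact div_ne_zero hpi (ne_zero_of_re_pos hc) (by rw [← this]; simp)

lemma inv_re_pos {c : ℂ} (hc : 0 < c.re) : 0 < (1 / c).re := by
  rw [one_div, Complex.inv_re]
  exact div_pos hc (Complex.normSq_pos.2 (ne_zero_of_re_pos hc))

lemma norm_gaussTerm (c : ℂ) {k : ℕ} (P Q : ℝ) (N : ℤ) :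
    ‖gaussTerm c k P Q N‖ = Real.exp (-(c.re * k) * (N / (2 * k) - P) ^ 2) := by
  rw [gaussTerm, Complex.norm_exp]
  congr 1
  rw [show (2 * Real.pi * Complex.I * N * Q - k * c * (P - N / (2 * k)) ^ 2 : ℂ)
    = ((2 * Real.pi * N * Q : ℝ) : ℂ) * Complex.I
      - (((k * (P - N / (2 * k)) ^ 2 : ℝ)) : ℂ) * c by push_cast; ring, Complex.sub_re,
    Complex.re_ofReal_mul, Complex.re_ofReal_mul, Complex.I_re]
  ring

lemma exists_sum_exp_le {a : ℝ} (ha : 0 < a) : ∃ C : ℝ, 0 < C ∧ ∀ (k : ℕ) (P : ℝ), 1 ≤ k →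
    (Summable fun N : ℤ => Real.exp (-(a * k) * (N / (2 * k) - P) ^ 2)) ∧
      ∑' N : ℤ, Real.exp (-(a * k) * (N / (2 * k) - P) ^ 2) ≤ C * k := by
  obtain ⟨C, hC0, hC⟩ := exists_wide_gaussian_sum_bound (a := a / 4) (by positivity)
  refine ⟨C, hC0, fun k P hk => ?_⟩
  have hk0 : (0 : ℝ) < k := by exact_mod_cast hk
  have e : ∀ N : ℤ, -(a * k) * ((N : ℝ) / (2 * k) - P) ^ 2 = -(a / 4 / k) * (N - 2 * k * P) ^ 2 := by
    intro N; field_simp; ring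
  simp only [e]
  exact hC k (2 * k * P) hk

lemma summable_gaussTerm {c : ℂ} (hc : 0 < c.re) {k : ℕ} (hk : 1 ≤ k) (P Q : ℝ) :
    Summable fun N : ℤ => gaussTerm c k P Q N := by
  obtain ⟨C, -, hC⟩ := exists_sum_exp_le hc
  refine Summable.of_norm ((hC k P hk).1.congr fun N => ?_)
  rw [norm_gaussTerm]

lemma summable_mul_gaussTerm {c : ℂ} (hc : 0 < c.re) {k : ℕ} (hk : 1 ≤ k) (P Q : ℝ) {f : ℤ → ℂ}
    {B : ℝ} (hf : ∀ N, ‖f N‖ ≤ B) : Summable fun N : ℤ => f N * gaussTerm c k P Q N := by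
  obtain ⟨C, -, hC⟩ := exists_sum_exp_le hc
  refine Summable.of_norm_bounded ((hC k P hk).1.mul_left B) fun N => ?_
  rw [norm_mul, norm_gaussTerm]
  exact mul_le_mul_of_nonneg_right (hf N) (Real.exp_pos _).le

lemma gaussSum_sub_int (a : ℕ → ℤ → ℂ) (c : ℂ) (k : ℕ) (P Q : ℝ) (m : ℤ) :
    gaussSum a c k P (Q - m) = gaussSum a c k P Q := by
  refine tsum_congr fun N => ?_
  congr 1
  refine exp_eq_exp_of_eq_add (-(N * m)) ?_
  push_cast
  ring

/-- The terms of the dual Gaussian sum. -/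
noncomputable def dualTerm (c : ℂ) (k : ℕ) (P Q : ℝ) (n : ℤ) : ℂ :=
  Complex.exp (-(4 * Real.pi ^ 2 * k * (n - Q) ^ 2) / c - 4 * Real.pi * Complex.I * k * (n - Q) * P)

lemma norm_dualTerm (c : ℂ) (k : ℕ) (P Q : ℝ) (n : ℤ) :
    ‖dualTerm c k P Q n‖ = Real.exp (-(4 * Real.pi ^ 2 * (1 / c).re * k) * (n - Q) ^ 2) := by
  rw [dualTerm, Complex.norm_exp]
  congr 1
  rw [show (-(4 * Real.pi ^ 2 * k * (n - Q) ^ 2) / c - 4 * Real.pi * Complex.I * k * (n - Q) * P : ℂ)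
    = ((-(4 * Real.pi ^ 2 * k * (n - Q) ^ 2) : ℝ) : ℂ) * (1 / c)
      - ((4 * Real.pi * k * (n - Q) * P : ℝ) : ℂ) * Complex.I by push_cast; ring, Complex.sub_re,
    Complex.re_ofReal_mul, Complex.re_ofReal_mul, Complex.I_re]
  ring

/-- Poisson summation for Gaussian sums with constant coefficients. -/
lemma tsum_gaussTerm {c : ℂ} (hc : 0 < c.re) {k : ℕ} (hk : 1 ≤ k) (P Q : ℝ) :
    ∑' N : ℤ, gaussTerm c k P Q N = 2 * (Real.sqrt k : ℝ) * gaussMass c * ∑' n : ℤ, dualTerm c k P Q n := by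
  have hk0 : (0 : ℝ) < k := by exact_mod_cast hk
  have hk0' : (k : ℂ) ≠ 0 := by exact_mod_cast hk0.ne'
  have hpi := Real.pi_pos
  have hpic : (Real.pi : ℂ) ≠ 0 := by exact_mod_cast hpi.ne'
  have hc0 := ne_zero_of_re_pos hc
  set a : ℂ := ((1 / (4 * k) : ℝ) : ℂ) * (c / Real.pi) with ha
  have hcre : 0 < (c / Real.pi).re := by
    rw [Complex.div_ofReal_re]; positivity
  have hare : 0 < a.re := by
    rw [ha, Complex.re_ofReal_mul]; positivity
  set b : ℂ := Complex.I * Q + c * P / (2 * Real.pi) with hb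
  have h := Complex.tsum_exp_neg_quadratic hare b
  have hterm : ∀ N : ℤ, gaussTerm c k P Q N = Complex.exp (-(k * c * P ^ 2)) *
      Complex.exp (-Real.pi * a * N ^ 2 + 2 * Real.pi * b * N) := by
    intro N
    rw [gaussTerm, ← Complex.exp_add]
    congr 1
    rw [ha, hb]
    push_cast
    field_simp
    ring
  have hdual : ∀ n : ℤ, dualTerm c k P Q n = Complex.exp (-(k * c * P ^ 2)) *
      Complex.exp (-Real.pi / a * (n + Complex.I * b) ^ 2) := by
    intro n
    rw [dualTerm, ← Complex.exp_add]
    congr 1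
    rw [ha, hb]
    push_cast
    field_simp
    ring_nf
    simp only [Complex.I_sq, Complex.I_pow_three, Complex.I_pow_four]
    ring
  have hroot : 1 / a ^ (1 / 2 : ℂ) = 2 * (Real.sqrt k : ℝ) * gaussMass c := by
    have h1 : a ^ (1 / 2 : ℂ) = (((1 / (4 * k) : ℝ) : ℂ)) ^ (1 / 2 : ℂ) * (c / Real.pi) ^ (1 / 2 : ℂ) := by
      have hr : (0 : ℝ) < 1 / (4 * k) := by positivity
      have hx : (c / Real.pi : ℂ) ≠ 0 := div_ne_zero hc0 hpic
      have hr' : ((1 / (4 * k) : ℝ) : ℂ) ≠ 0 := by exact_mod_cast hr.ne'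
      rw [ha, Complex.cpow_def_of_ne_zero (mul_ne_zero hr' hx), Complex.cpow_def_of_ne_zero hr',
        Complex.cpow_def_of_ne_zero hx, Complex.log_ofReal_mul hr hx, ← Complex.exp_add,
        Complex.ofReal_log hr.le, add_mul]
    have h2 : (((1 / (4 * k) : ℝ) : ℂ)) ^ (1 / 2 : ℂ) = ((1 / (2 * Real.sqrt k) : ℝ) : ℂ) := by
      have e : (1 / (4 * k) : ℝ) = (1 / (2 * Real.sqrt k)) ^ 2 := by
        rw [div_pow, mul_pow, Real.sq_sqrt hk0.le]; norm_num
      rw [show (1 / 2 : ℂ) = ((1 / 2 : ℝ) : ℂ) by push_cast; rfl, ← Complex.ofReal_cpow (by positivity),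
        ← Real.sqrt_eq_rpow, e, Real.sqrt_sq (by positivity)]
    have h3 : gaussMass c = ((c / Real.pi) ^ (1 / 2 : ℂ))⁻¹ := by
      rw [gaussMass_eq hc, ← Complex.inv_cpow, inv_div]
      intro harg
      have := (Complex.arg_eq_pi_iff.1 harg).1
      linarith
    rw [h1, h2, h3]
    push_cast
    have hs : ((Real.sqrt k : ℝ) : ℂ) ≠ 0 := by
      exact_mod_cast (Real.sqrt_pos.2 hk0).ne'
    field_simp
  simp only [hterm, hdual]
  rw [tsum_mul_left, tsum_mul_left, h, hroot]
  ring

/-! ### Gaussian sums with locally holomorphic coefficients -/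

/-- The coefficients `a k N` grow at most polynomially in `k`, and near `x₀` they are the values at
the points `N / 2k` of a holomorphic function `b`, defined on the disc of radius `r`. -/
structure IsSampled (a : ℕ → ℤ → ℂ) (b : ℂ → ℂ) (x₀ r : ℝ) (M : ℕ) : Prop where
  radius_pos : 0 < r
  differentiableOn : DifferentiableOn ℂ b (Metric.ball (x₀ : ℂ) r)
  bound : ∃ C : ℝ, 0 < C ∧ ∀ k : ℕ, 1 ≤ k → ∀ N : ℤ, ‖a k N‖ ≤ C * (k : ℝ) ^ M
  eq : ∀ k : ℕ, 1 ≤ k → ∀ N : ℤ, |(N : ℝ) / (2 * k) - x₀| < r → a k N = b (N / (2 * k))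

lemma gaussTerm_add_frequency (c : ℂ) {k : ℕ} (hk : 1 ≤ k) (P Q : ℝ) (i : ℕ) (N : ℤ) :
    Complex.exp (-(2 * Real.pi * Complex.I * i * P)) * gaussTerm c k P (Q + i / (2 * k)) N
      = Complex.exp (2 * Real.pi * Complex.I * i * ((N : ℂ) / (2 * k) - P)) * gaussTerm c k P Q N := by
  have hk0 : (k : ℂ) ≠ 0 := by exact_mod_cast (by omega : k ≠ 0)
  rw [gaussTerm, gaussTerm, ← Complex.exp_add, ← Complex.exp_add]
  congr 1
  push_cast
  field_simp
  ring

lemma norm_exp_two_pi_mul (i : ℕ) (x : ℝ) :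
    ‖Complex.exp (2 * Real.pi * Complex.I * i * x)‖ = 1 := by
  rw [show (2 * Real.pi * Complex.I * i * x : ℂ) = ((2 * Real.pi * i * x : ℝ) : ℂ) * Complex.I by
    push_cast; ring, Complex.norm_exp_ofReal_mul_I]

lemma norm_sqrt_natCast_le {k : ℕ} (hk : 1 ≤ k) : ‖((Real.sqrt k : ℝ) : ℂ)‖ ≤ k := by
  have hk1 : (1 : ℝ) ≤ k := by exact_mod_cast hk
  rw [Complex.norm_real, Real.norm_of_nonneg (Real.sqrt_nonneg _)]
  exact Real.sqrt_le_iff.2 ⟨by linarith, by nlinarith⟩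

/-- The coefficients of a Gaussian sum may be replaced by their expansion in characters at the
centre: this reduces the sum, up to a small error, to finitely many translated theta series. -/
lemma IsSampled.exists_approx {a : ℕ → ℤ → ℂ} {b : ℂ → ℂ} {x₀ r : ℝ} {M : ℕ}
    (h : IsSampled a b x₀ r M) {c : ℂ} (hc : 0 < c.re) : ∃ ρ : ℝ, 0 < ρ ∧ ρ ≤ r ∧ ∀ L : ℕ,
      ∃ (n : ℕ) (C : ℝ) (γ : ℝ → ℕ → ℂ), L ≤ n ∧ 0 < C ∧ ∀ P : ℝ, |P - x₀| < ρ →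
        (∀ i < 2 * n, ‖γ P i‖ ≤ C) ∧
        (∀ x : ℂ, ‖x - x₀‖ < ρ → ‖b x - ∑ i ∈ Finset.range (2 * n),
          γ P i * Complex.exp (2 * Real.pi * Complex.I * i * (x - P))‖ ≤ C * ‖x - P‖ ^ (2 * n)) ∧
        ∀ k : ℕ, 1 ≤ k → ∀ Q : ℝ, ‖gaussSum a c k P Q - ∑ i ∈ Finset.range (2 * n),
          γ P i * (Complex.exp (-(2 * Real.pi * Complex.I * i * P)) *
            ∑' N : ℤ, gaussTerm c k P (Q + i / (2 * k)) N)‖ ≤ C * ((k : ℝ) ^ L)⁻¹ := by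
  obtain ⟨ρ', hρ', hexp⟩ := exists_character_expansion h.radius_pos h.differentiableOn
  obtain ⟨Ca, hCa, hba⟩ := h.bound
  have hr := h.radius_pos
  set ρ₀ := min ρ' r with hρ₀
  have hρ₀0 : 0 < ρ₀ := lt_min hρ' hr
  refine ⟨ρ₀ / 2, by positivity, by linarith [min_le_right ρ' r], fun L => ?_⟩
  set n := M + 1 + L with hn
  obtain ⟨C₁, γ, hC₁, hγ⟩ := hexp (2 * n)
  obtain ⟨C₃, hC₃, h3⟩ := exists_pow_mul_exp_neg_le (a := c.re / 2) (by positivity) n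
  obtain ⟨C₄, hC₄, h4⟩ := exists_sum_exp_le (a := c.re / 2) (by positivity)
  set C₂ : ℝ := C₁ + (Ca + 2 * n * C₁) / (ρ₀ / 2) ^ (2 * n) with hC₂
  have hC₂0 : 0 < C₂ := by positivity
  refine ⟨n, C₁ + C₂ * C₃ * C₄, γ, by omega, by positivity, fun P hP => ?_⟩
  have hP' : |P - x₀| < ρ' := by linarith [min_le_left ρ' r]
  obtain ⟨hγ1, hγ2⟩ := hγ P hP'
  refine ⟨fun i hi => (hγ1 i hi).trans (le_add_of_nonneg_right (by positivity)), fun x hx => ?_,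
    fun k hk Q => ?_⟩
  · refine (hγ2 x (by linarith [min_le_left ρ' r])).trans ?_
    exact mul_le_mul_of_nonneg_right (le_add_of_nonneg_right (by positivity)) (by positivity)
  have hk0 : (0 : ℝ) < k := by exact_mod_cast hk
  have hk1 : (1 : ℝ) ≤ k := by exact_mod_cast hk
  have hkM : (1 : ℝ) ≤ (k : ℝ) ^ M := one_le_pow₀ hk1
  set S : ℤ → ℂ := fun N => ∑ i ∈ Finset.range (2 * n),
    γ P i * Complex.exp (2 * Real.pi * Complex.I * i * ((N : ℂ) / (2 * k) - P)) with hS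
  have hSn : ∀ N, ‖S N‖ ≤ 2 * n * C₁ := by
    intro N
    calc ‖S N‖ ≤ ∑ i ∈ Finset.range (2 * n), C₁ := by
          refine norm_sum_le_of_le _ fun i hi => ?_
          have := norm_exp_two_pi_mul i ((N : ℝ) / (2 * k) - P)
          push_cast at this
          rw [norm_mul, this, mul_one]
          exact hγ1 i (Finset.mem_range.1 hi)
      _ = 2 * n * C₁ := by simp
  have hsumS : ∑ i ∈ Finset.range (2 * n), γ P i *
      (Complex.exp (-(2 * Real.pi * Complex.I * i * P)) *
        ∑' N : ℤ, gaussTerm c k P (Q + i / (2 * k)) N) = ∑' N : ℤ, S N * gaussTerm c k P Q N := by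
    simp only [← tsum_mul_left, gaussTerm_add_frequency c hk, hS, Finset.sum_mul]
    rw [Summable.tsum_finsetSum]
    · exact Finset.sum_congr rfl fun i _ => tsum_congr fun N => by ring
    · intro i _
      refine summable_mul_gaussTerm hc hk P Q (B := ‖γ P i‖) fun N => ?_
      have := norm_exp_two_pi_mul i ((N : ℝ) / (2 * k) - P)
      push_cast at this
      rw [norm_mul, this, mul_one]
  have hdiff : ∀ N : ℤ, ‖a k N - S N‖ ≤ C₂ * (k : ℝ) ^ M * ((N : ℝ) / (2 * k) - P) ^ (2 * n) := by
    intro N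
    set x : ℝ := (N : ℝ) / (2 * k) with hx
    have hxc : ((N : ℂ) / (2 * k)) = (x : ℂ) := by rw [hx]; push_cast; rfl
    have hev : 0 ≤ (x - P) ^ (2 * n) := (even_two_mul n).pow_nonneg _
    have habs : |x - P| ^ (2 * n) = (x - P) ^ (2 * n) := (even_two_mul n).pow_abs _
    by_cases hxx : |x - x₀| < ρ₀
    · have hnx : ‖(x : ℂ) - x₀‖ = |x - x₀| := by
        rw [← Complex.ofReal_sub, Complex.norm_real, Real.norm_eq_abs]
      have hnP : ‖(x : ℂ) - P‖ = |x - P| := by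
        rw [← Complex.ofReal_sub, Complex.norm_real, Real.norm_eq_abs]
      have := hγ2 x (by rw [hnx]; exact hxx.trans_le (min_le_left _ _))
      rw [hnP, habs] at this
      rw [h.eq k hk N (hxx.trans_le (min_le_right _ _)), hxc]
      simp only [hS, hxc]
      refine this.trans (mul_le_mul_of_nonneg_right ?_ hev)
      calc C₁ ≤ C₂ * 1 := by rw [mul_one]; exact le_add_of_nonneg_right (by positivity)
        _ ≤ C₂ * (k : ℝ) ^ M := by gcongr
    · have hfar : ρ₀ / 2 ≤ |x - P| := by
        have := abs_sub_abs_le_abs_sub (x - x₀) (P - x₀)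
        rw [show x - x₀ - (P - x₀) = x - P by ring] at this
        linarith
      have h1 : (ρ₀ / 2) ^ (2 * n) ≤ (x - P) ^ (2 * n) := by
        rw [← habs]; gcongr
      calc ‖a k N - S N‖ ≤ ‖a k N‖ + ‖S N‖ := norm_sub_le _ _
        _ ≤ Ca * (k : ℝ) ^ M + 2 * n * C₁ * (k : ℝ) ^ M := by
          refine add_le_add (hba k hk N) ((hSn N).trans ?_)
          exact le_mul_of_one_le_right (by positivity) hkM
        _ = (Ca + 2 * n * C₁) / (ρ₀ / 2) ^ (2 * n) * (k : ℝ) ^ M * (ρ₀ / 2) ^ (2 * n) := by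
          field_simp
        _ ≤ C₂ * (k : ℝ) ^ M * (x - P) ^ (2 * n) := by
          gcongr
          rw [hC₂]; linarith
  have hterm : ∀ N : ℤ, ‖(a k N - S N) * gaussTerm c k P Q N‖
      ≤ C₂ * (k : ℝ) ^ M * (C₃ * ((k : ℝ) ^ n)⁻¹) *
        Real.exp (-(c.re / 2 * k) * ((N : ℝ) / (2 * k) - P) ^ 2) := by
    intro N
    set u : ℝ := (N : ℝ) / (2 * k) - P with hu
    rw [norm_mul, norm_gaussTerm]
    have e : Real.exp (-(c.re * k) * u ^ 2)
        = Real.exp (-(c.re / 2 * k) * u ^ 2) * Real.exp (-(c.re / 2 * k) * u ^ 2) := by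
      rw [← Real.exp_add]; congr 1; ring
    rw [e, ← mul_assoc]
    refine mul_le_mul_of_nonneg_right ?_ (Real.exp_pos _).le
    calc _ ≤ C₂ * (k : ℝ) ^ M * u ^ (2 * n) * Real.exp (-(c.re / 2 * k) * u ^ 2) :=
          mul_le_mul_of_nonneg_right (hdiff N) (Real.exp_pos _).le
      _ = C₂ * (k : ℝ) ^ M * (u ^ (2 * n) * Real.exp (-(c.re / 2 * k) * u ^ 2)) := by ring
      _ ≤ _ := mul_le_mul_of_nonneg_left (h3 k u hk) (by positivity)
  obtain ⟨h4s, h4b⟩ := h4 k P hk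
  have hsa : Summable fun N : ℤ => a k N * gaussTerm c k P Q N :=
    summable_mul_gaussTerm hc hk P Q (hba k hk)
  have hsS : Summable fun N : ℤ => S N * gaussTerm c k P Q N :=
    summable_mul_gaussTerm hc hk P Q hSn
  rw [hsumS, gaussSum, ← hsa.tsum_sub hsS]
  simp only [← sub_mul]
  refine (tsum_of_norm_bounded (h4s.mul_left _).hasSum hterm).trans ?_
  rw [tsum_mul_left]
  calc _ ≤ C₂ * (k : ℝ) ^ M * (C₃ * ((k : ℝ) ^ n)⁻¹) * (C₄ * k) := by gcongr
    _ = C₂ * C₃ * C₄ * ((k : ℝ) ^ L)⁻¹ := by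
      rw [hn, pow_add, pow_add]; field_simp
    _ ≤ _ := mul_le_mul_of_nonneg_right (le_add_of_nonneg_left hC₁.le) (by positivity)

/-- The terms of a dual Gaussian sum whose index is at distance at least `d` from the frequency
contribute a small amount. -/
lemma exists_dualTerm_tail_le {c : ℂ} (hc : 0 < c.re) {d : ℝ} (hd : 0 < d) (i : ℕ) (L : ℕ) :
    ∃ C : ℝ, 0 < C ∧ ∀ k : ℕ, 1 ≤ k → ∀ (P Q : ℝ) (s : Set ℤ), (∀ n ∈ s, d ≤ |n - Q|) →
      ‖∑' n : ℤ, s.indicator (dualTerm c k P (Q + i / (2 * k))) n‖ ≤ C * ((k : ℝ) ^ L)⁻¹ := by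
  have hκ := inv_re_pos hc
  set κ := (1 / c).re with hκdef
  have hpi := Real.pi_pos
  obtain ⟨C₁, hC₁, h1⟩ := exists_gaussian_sum_bound (a := Real.pi ^ 2 * κ) (by positivity)
  obtain ⟨C₂, hC₂, h2⟩ := exists_exp_neg_le (δ := Real.pi ^ 2 * κ * d ^ 2) (by positivity) L
  refine ⟨Real.exp (Real.pi ^ 2 * κ * i ^ 2) * C₂ * C₁, by positivity, fun k hk P Q s hs => ?_⟩
  have hk0 : (0 : ℝ) < k := by exact_mod_cast hk
  have hk1 : (1 : ℝ) ≤ k := by exact_mod_cast hk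
  have hterm : ∀ n : ℤ, ‖s.indicator (dualTerm c k P (Q + i / (2 * k))) n‖
      ≤ Real.exp (Real.pi ^ 2 * κ * i ^ 2) * (C₂ * ((k : ℝ) ^ L)⁻¹) *
        Real.exp (-(Real.pi ^ 2 * κ) * (n - Q) ^ 2) := by
    intro n
    by_cases hn : n ∈ s
    · rw [Set.indicator_of_mem hn, norm_dualTerm]
      refine le_trans ?_ (mul_le_mul_of_nonneg_right (mul_le_mul_of_nonneg_left (h2 k hk)
        (Real.exp_pos _).le) (Real.exp_pos _).le)
      rw [← Real.exp_add, ← Real.exp_add]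
      refine Real.exp_le_exp.2 ?_
      have hdn : d ^ 2 ≤ ((n : ℝ) - Q) ^ 2 := by
        rw [← sq_abs ((n : ℝ) - Q)]; gcongr; exact hs n hn
      set A : ℝ := (n : ℝ) - Q with hA
      -- `(A - t)² ≥ A² / 2 - t²`, with `k t² ≤ i² / 4`
      have h3 : 2 * (k * A ^ 2) - (i : ℝ) ^ 2 ≤ 4 * (k * (n - (Q + i / (2 * k))) ^ 2) := by
        have e : (n : ℝ) - (Q + i / (2 * k)) = A - i / (2 * k) := by rw [hA]; ring
        have e2 : (k : ℝ) * (i / (2 * k)) ^ 2 ≤ (i : ℝ) ^ 2 / 4 := by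
          rw [div_pow, mul_pow, ← mul_div_assoc, div_le_div_iff₀ (by positivity) (by norm_num)]
          nlinarith [sq_nonneg (i : ℝ), mul_nonneg (sq_nonneg (i : ℝ)) (by linarith : (0 : ℝ) ≤ k - 1)]
        rw [e]
        have : A ^ 2 / 2 - ((i : ℝ) / (2 * k)) ^ 2 ≤ (A - i / (2 * k)) ^ 2 := by
          nlinarith [sq_nonneg (A - 2 * (i / (2 * k)))]
        nlinarith [mul_le_mul_of_nonneg_left this hk0.le]
      have h4 : k * d ^ 2 + A ^ 2 ≤ 2 * (k * A ^ 2) := by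
        nlinarith [mul_le_mul_of_nonneg_left hdn hk0.le, mul_nonneg (sub_nonneg.2 hk1) (sq_nonneg A)]
      have h5 : 0 < Real.pi ^ 2 * κ := by positivity
      nlinarith [mul_le_mul_of_nonneg_left h3 h5.le, mul_le_mul_of_nonneg_left h4 h5.le]
    · rw [Set.indicator_of_notMem hn, norm_zero]
      positivity
  obtain ⟨hsm, hb⟩ := h1 Q
  refine (tsum_of_norm_bounded (hsm.mul_left _).hasSum hterm).trans ?_
  rw [tsum_mul_left]
  calc _ ≤ Real.exp (Real.pi ^ 2 * κ * i ^ 2) * (C₂ * ((k : ℝ) ^ L)⁻¹) * C₁ := by gcongr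
    _ = _ := by ring

/-- Away from integral frequencies, Gaussian sums are negligible. -/
lemma IsSampled.exists_gaussSum_le {a : ℕ → ℤ → ℂ} {b : ℂ → ℂ} {x₀ r : ℝ} {M : ℕ}
    (h : IsSampled a b x₀ r M) {c : ℂ} (hc : 0 < c.re) : ∃ ρ : ℝ, 0 < ρ ∧
      ∀ d : ℝ, 0 < d → ∀ L : ℕ, ∃ C : ℝ, 0 < C ∧ ∀ k : ℕ, 1 ≤ k → ∀ P Q : ℝ, |P - x₀| < ρ →
        (∀ n : ℤ, d ≤ |n - Q|) → ‖gaussSum a c k P Q‖ ≤ C * ((k : ℝ) ^ L)⁻¹ := by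
  obtain ⟨ρ, hρ, -, happ⟩ := h.exists_approx hc
  refine ⟨ρ, hρ, fun d hd L => ?_⟩
  obtain ⟨n, C, γ, -, hC, hγ⟩ := happ L
  choose D hD htail using fun i : ℕ => exists_dualTerm_tail_le hc hd i (L + 1)
  set G := ‖gaussMass c‖ with hG
  refine ⟨C + ∑ i ∈ Finset.range (2 * n), C * (2 * G * D i), by
    have : ∀ i, 0 < D i := hD
    have : 0 ≤ ∑ i ∈ Finset.range (2 * n), C * (2 * G * D i) :=
      Finset.sum_nonneg fun i _ => by have := hD i; positivity
    linarith, fun k hk P Q hP hQ => ?_⟩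
  have hk0 : (0 : ℝ) < k := by exact_mod_cast hk
  obtain ⟨h1, -, h2⟩ := hγ P hP
  set S := ∑ i ∈ Finset.range (2 * n), γ P i * (Complex.exp (-(2 * Real.pi * Complex.I * i * P)) *
            ∑' N : ℤ, gaussTerm c k P (Q + i / (2 * k)) N) with hS
  have hSle : ‖S‖ ≤ ∑ i ∈ Finset.range (2 * n), C * (2 * G * D i) * ((k : ℝ) ^ L)⁻¹ := by
    refine norm_sum_le_of_le _ fun i hi => ?_
    have hn1 : ‖Complex.exp (-(2 * Real.pi * Complex.I * i * P))‖ = 1 := by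
      have := norm_exp_two_pi_mul i (-P)
      rw [← this]; congr 2; push_cast; ring
    have ht := htail i k hk P Q Set.univ (fun n _ => hQ n)
    rw [Set.indicator_univ] at ht
    have hsq := norm_sqrt_natCast_le hk
    rw [norm_mul, norm_mul, hn1, one_mul, tsum_gaussTerm hc hk, norm_mul, norm_mul, norm_mul,
      Complex.norm_ofNat]
    calc _ ≤ C * (2 * k * G * (D i * ((k : ℝ) ^ (L + 1))⁻¹)) := by
          gcongr
          exact h1 i (Finset.mem_range.1 hi)
      _ = _ := by rw [pow_succ]; field_simp
  calc ‖gaussSum a c k P Q‖ = ‖(gaussSum a c k P Q - S) + S‖ := by congr 1; ring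
    _ ≤ C * ((k : ℝ) ^ L)⁻¹ + ∑ i ∈ Finset.range (2 * n), C * (2 * G * D i) * ((k : ℝ) ^ L)⁻¹ :=
      (norm_add_le _ _).trans (add_le_add (h2 k hk Q) hSle)
    _ = _ := by rw [← Finset.sum_mul]; ring

/-! ### Local Gaussian integrals -/

/-- The average of a function `b`, holomorphic near `z`, against a normalized Gaussian of width
`k ^ (-1/2)` along the real direction, cut off at distance `ε`. These functions of `z` are the symbols
of the Lagrangian states. -/
noncomputable def localAverage (b : ℂ → ℂ) (c : ℂ) (ε : ℝ) (k : ℕ) (z : ℂ) : ℂ :=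
  (Real.sqrt k : ℝ) / gaussMass c * ∫ s in (-ε)..ε, b (z + s) * Complex.exp (-(k * c) * s ^ 2)

lemma norm_exp_gaussian (c : ℂ) (k : ℕ) (s : ℝ) :
    ‖Complex.exp (-(k * c) * (s : ℂ) ^ 2)‖ = Real.exp (-(c.re * k) * s ^ 2) := by
  rw [Complex.norm_exp]
  congr 1
  rw [show (-(k * c) * (s : ℂ) ^ 2) = ((-(k * s ^ 2) : ℝ) : ℂ) * c by push_cast; ring,
    Complex.re_ofReal_mul]
  ring

lemma integrable_pow_mul_gaussian {c : ℂ} (hc : 0 < c.re) (n : ℕ) :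
    MeasureTheory.Integrable fun s : ℝ => (s : ℂ) ^ n * Complex.exp (-c * (s : ℂ) ^ 2) := by
  have h := integrable_rpow_mul_exp_neg_mul_sq hc (s := n) (by linarith [n.cast_nonneg (α := ℝ)])
  simp only [Real.rpow_natCast] at h
  refine h.mono (by fun_prop) (Filter.Eventually.of_forall fun s => le_of_eq ?_)
  have := norm_exp_gaussian c 1 s
  simp only [Nat.cast_one, one_mul, mul_one] at this
  rw [norm_mul, this, norm_pow, Complex.norm_real, norm_mul, norm_pow,
    Real.norm_of_nonneg (Real.exp_pos _).le]

/-- A function bounded by a power of `A + |s|` has a small integral against a narrow Gaussian. -/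
lemma exists_gaussian_integral_le {c : ℂ} (hc : 0 < c.re) (n : ℕ) : ∃ C : ℝ, 0 < C ∧
    ∀ (k : ℕ) (K A : ℝ) (h : ℝ → ℂ), 1 ≤ k → 0 ≤ K → 0 ≤ A →
      (∀ s, ‖h s‖ ≤ K * (A + |s|) ^ (2 * n)) →
        ‖∫ s : ℝ, h s * Complex.exp (-(k * c) * s ^ 2)‖ ≤ C * K * (A ^ (2 * n) + ((k : ℝ) ^ n)⁻¹) := by
  obtain ⟨C, hC, hb⟩ := exists_pow_mul_exp_neg_le (a := c.re / 2) (by positivity) n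
  have hint := integrable_exp_neg_mul_sq (b := c.re / 2) (by positivity)
  set J := ∫ s : ℝ, Real.exp (-(c.re / 2) * s ^ 2) with hJ
  have hJ0 : 0 ≤ J := MeasureTheory.integral_nonneg fun s => (Real.exp_pos _).le
  refine ⟨2 ^ (2 * n) * (1 + C) * (J + 1), by positivity, fun k K A h hk hK hA hle => ?_⟩
  have hk0 : (0 : ℝ) < k := by exact_mod_cast hk
  have hk1 : (1 : ℝ) ≤ k := by exact_mod_cast hk
  have hpt : ∀ s : ℝ, ‖h s * Complex.exp (-(k * c) * (s : ℂ) ^ 2)‖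
      ≤ 2 ^ (2 * n) * K * (A ^ (2 * n) + C * ((k : ℝ) ^ n)⁻¹) * Real.exp (-(c.re / 2) * s ^ 2) := by
    intro s
    have e : Real.exp (-(c.re * k) * s ^ 2)
        = Real.exp (-(c.re / 2 * k) * s ^ 2) * Real.exp (-(c.re / 2 * k) * s ^ 2) := by
      rw [← Real.exp_add]; congr 1; ring
    have h1 : Real.exp (-(c.re / 2 * k) * s ^ 2) ≤ 1 :=
      Real.exp_le_one_iff.2 (by nlinarith [mul_nonneg (mul_pos hc hk0).le (sq_nonneg s)])
    have h2 : Real.exp (-(c.re / 2 * k) * s ^ 2) ≤ Real.exp (-(c.re / 2) * s ^ 2) := by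
      refine Real.exp_le_exp.2 ?_
      have : c.re * s ^ 2 * 1 ≤ c.re * s ^ 2 * k := by gcongr
      linarith
    have h3 : (A + |s|) ^ (2 * n) ≤ 2 ^ (2 * n) * (A ^ (2 * n) + s ^ (2 * n)) := by
      refine (add_pow_le hA (abs_nonneg s) _).trans ?_
      rw [(even_two_mul n).pow_abs]
      have : 0 ≤ s ^ (2 * n) := (even_two_mul n).pow_nonneg _
      gcongr
      · norm_num
      · omega
    have hs0 : 0 ≤ s ^ (2 * n) := (even_two_mul n).pow_nonneg _
    rw [norm_mul, norm_exp_gaussian, e, ← mul_assoc]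
    refine mul_le_mul ?_ h2 (Real.exp_pos _).le (by positivity)
    calc _ ≤ K * (2 ^ (2 * n) * (A ^ (2 * n) + s ^ (2 * n))) * Real.exp (-(c.re / 2 * k) * s ^ 2) := by
          refine mul_le_mul_of_nonneg_right ((hle s).trans ?_) (Real.exp_pos _).le
          gcongr
      _ = 2 ^ (2 * n) * K * (A ^ (2 * n) * Real.exp (-(c.re / 2 * k) * s ^ 2)
            + s ^ (2 * n) * Real.exp (-(c.re / 2 * k) * s ^ 2)) := by ring
      _ ≤ 2 ^ (2 * n) * K * (A ^ (2 * n) * 1 + C * ((k : ℝ) ^ n)⁻¹) := by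
          refine mul_le_mul_of_nonneg_left (add_le_add ?_ (hb k s hk)) (by positivity)
          exact mul_le_mul_of_nonneg_left h1 (by positivity)
      _ = _ := by ring
  refine (MeasureTheory.norm_integral_le_of_norm_le (hint.const_mul _)
    (Filter.Eventually.of_forall hpt)).trans ?_
  rw [MeasureTheory.integral_const_mul]
  have hkn : 0 < ((k : ℝ) ^ n)⁻¹ := by positivity
  have hAn : 0 ≤ A ^ (2 * n) := by positivity
  calc _ ≤ 2 ^ (2 * n) * K * ((1 + C) * (A ^ (2 * n) + ((k : ℝ) ^ n)⁻¹)) * (J + 1) := by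
        gcongr
        · nlinarith [mul_nonneg hC.le hAn]
        · linarith
    _ = _ := by ring

/-- A local average may be computed by replacing the function `b` by an entire approximation. -/
lemma exists_localAverage_sub_le {b : ℂ → ℂ} {x₀ ε : ℝ} (hε : 0 < ε)
    (hb : ContinuousOn b (Metric.ball (x₀ : ℂ) (2 * ε))) {c : ℂ} (hc : 0 < c.re) (n : ℕ) :
    ∃ C : ℝ, 0 < C ∧ ∀ (k : ℕ) (K A : ℝ) (T : ℝ → ℂ) (z : ℂ), 1 ≤ k → 0 ≤ K → 0 ≤ A →
      z ∈ Metric.ball (x₀ : ℂ) ε →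
      MeasureTheory.Integrable (fun s : ℝ => T s * Complex.exp (-(k * c) * (s : ℂ) ^ 2)) →
      (∀ s, |s| ≤ ε → ‖T s - b (z + s)‖ ≤ K * (A + |s|) ^ (2 * n)) →
      (∀ s, ε ≤ |s| → ‖T s‖ ≤ K * (A + |s|) ^ (2 * n)) →
        ‖(Real.sqrt k : ℝ) / gaussMass c * (∫ s : ℝ, T s * Complex.exp (-(k * c) * (s : ℂ) ^ 2))
          - localAverage b c ε k z‖ ≤ C * K * k * (A ^ (2 * n) + ((k : ℝ) ^ n)⁻¹) := by
  obtain ⟨C, hC, hle⟩ := exists_gaussian_integral_le hc n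
  refine ⟨(‖gaussMass c‖⁻¹ + 1) * C, by positivity, fun k K A T z hk hK hA hz hT h1 h2 => ?_⟩
  rw [Metric.mem_ball, dist_eq_norm] at hz
  have hcont : ContinuousOn (fun s : ℝ => b (z + s) * Complex.exp (-(k * c) * (s : ℂ) ^ 2))
      (Set.Icc (-ε) ε) := by
    refine ContinuousOn.mul (hb.comp (by fun_prop) fun s hs => ?_) (by fun_prop)
    have hs' : |s| ≤ ε := abs_le.2 hs
    rw [Metric.mem_ball, dist_eq_norm]
    calc ‖z + s - x₀‖ = ‖(z - x₀) + s‖ := by congr 1; ring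
      _ ≤ ‖z - x₀‖ + ‖(s : ℂ)‖ := norm_add_le _ _
      _ < 2 * ε := by rw [Complex.norm_real, Real.norm_eq_abs]; linarith
  have hint : MeasureTheory.IntegrableOn
      (fun s : ℝ => b (z + s) * Complex.exp (-(k * c) * (s : ℂ) ^ 2)) (Set.Ioc (-ε) ε) :=
    hcont.integrableOn_Icc.mono_set Set.Ioc_subset_Icc_self
  set h : ℝ → ℂ := fun s => T s - (Set.Ioc (-ε) ε).indicator (fun s : ℝ => b (z + s)) s with hh
  have hdiff : (∫ s : ℝ, T s * Complex.exp (-(k * c) * (s : ℂ) ^ 2))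
      - ∫ s in (-ε)..ε, b (z + s) * Complex.exp (-(k * c) * (s : ℂ) ^ 2)
      = ∫ s : ℝ, h s * Complex.exp (-(k * c) * (s : ℂ) ^ 2) := by
    rw [intervalIntegral.integral_of_le (by linarith), ← MeasureTheory.integral_indicator measurableSet_Ioc,
      ← MeasureTheory.integral_sub hT (hint.integrable_indicator measurableSet_Ioc)]
    refine MeasureTheory.integral_congr_ae (Filter.Eventually.of_forall fun s => ?_)
    by_cases hs : s ∈ Set.Ioc (-ε) ε
    · simp only [hh, Set.indicator_of_mem hs]; ring
    · simp only [hh, Set.indicator_of_notMem hs]; ring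
  have hhle : ∀ s, ‖h s‖ ≤ K * (A + |s|) ^ (2 * n) := by
    intro s
    by_cases hs : s ∈ Set.Ioc (-ε) ε
    · simp only [hh, Set.indicator_of_mem hs]
      exact h1 s (abs_le.2 ⟨hs.1.le, hs.2⟩)
    · simp only [hh, Set.indicator_of_notMem hs, sub_zero]
      refine h2 s ?_
      by_contra hlt
      rw [not_le, abs_lt] at hlt
      exact hs ⟨hlt.1, hlt.2.le⟩
  rw [localAverage, ← mul_sub, hdiff, norm_mul, norm_div]
  calc _ ≤ k / ‖gaussMass c‖ * (C * K * (A ^ (2 * n) + ((k : ℝ) ^ n)⁻¹)) := by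
        gcongr
        · exact norm_sqrt_natCast_le hk
        · exact hle k K A h hk hK hA hhle
    _ = ‖gaussMass c‖⁻¹ * (C * K * k * (A ^ (2 * n) + ((k : ℝ) ^ n)⁻¹)) := by ring
    _ ≤ (‖gaussMass c‖⁻¹ + 1) * (C * K * k * (A ^ (2 * n) + ((k : ℝ) ^ n)⁻¹)) := by
        gcongr; linarith
    _ = _ := by ring

lemma integral_pow_mul_gaussian_scale (c : ℂ) {k : ℕ} (hk : 1 ≤ k) (n : ℕ) :
    ∫ s : ℝ, (s : ℂ) ^ n * Complex.exp (-(k * c) * (s : ℂ) ^ 2)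
      = ((Real.sqrt k : ℝ) : ℂ)⁻¹ ^ (n + 1) * ∫ s : ℝ, (s : ℂ) ^ n * Complex.exp (-c * (s : ℂ) ^ 2) := by
  have hk0 : (0 : ℝ) < k := by exact_mod_cast hk
  have hs := Real.sqrt_pos.2 hk0
  have hs' : ((Real.sqrt k : ℝ) : ℂ) ≠ 0 := by exact_mod_cast hs.ne'
  have h := MeasureTheory.Measure.integral_comp_mul_left
    (fun s : ℝ => (s : ℂ) ^ n * Complex.exp (-c * (s : ℂ) ^ 2)) (Real.sqrt k)
  rw [abs_of_pos (inv_pos.2 hs)] at h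
  have hsq : ((Real.sqrt k : ℝ) : ℂ) ^ 2 = k := by
    rw [← Complex.ofReal_pow, Real.sq_sqrt hk0.le]; simp
  have e : ∀ s : ℝ, (s : ℂ) ^ n * Complex.exp (-(k * c) * (s : ℂ) ^ 2) = ((Real.sqrt k : ℝ) : ℂ)⁻¹ ^ n *
      (((Real.sqrt k * s : ℝ) : ℂ) ^ n * Complex.exp (-c * ((Real.sqrt k * s : ℝ) : ℂ) ^ 2)) := by
    intro s
    rw [Complex.ofReal_mul, mul_pow, mul_pow, hsq]
    rw [inv_pow, ← mul_assoc, ← mul_assoc, inv_mul_cancel₀ (pow_ne_zero _ hs'), one_mul]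
    congr 2
    ring
  simp only [e]
  rw [MeasureTheory.integral_const_mul, h, pow_succ, Complex.real_smul, Complex.ofReal_inv]
  ring

lemma natCast_mul_re_pos {c : ℂ} (hc : 0 < c.re) {k : ℕ} (hk : 1 ≤ k) : 0 < ((k : ℂ) * c).re := by
  have hk0 : (0 : ℝ) < k := by exact_mod_cast hk
  rw [← Complex.ofReal_natCast, Complex.re_ofReal_mul]
  positivity

/-- The average of a character. -/
lemma integral_character_mul_gaussian {c : ℂ} (hc : 0 < c.re) {k : ℕ} (hk : 1 ≤ k) (i : ℕ) (w : ℂ) :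
    MeasureTheory.Integrable (fun s : ℝ => Complex.exp (2 * Real.pi * Complex.I * i * (w + s)) *
      Complex.exp (-(k * c) * (s : ℂ) ^ 2)) ∧
    (Real.sqrt k : ℝ) / gaussMass c * ∫ s : ℝ, Complex.exp (2 * Real.pi * Complex.I * i * (w + s)) *
      Complex.exp (-(k * c) * (s : ℂ) ^ 2)
      = Complex.exp (2 * Real.pi * Complex.I * i * w - Real.pi ^ 2 * i ^ 2 / (k * c)) := by
  have hk0 : (0 : ℝ) < k := by exact_mod_cast hk
  have hkc := natCast_mul_re_pos hc hk
  have hkc0 := ne_zero_of_re_pos hkc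
  have e : ∀ s : ℝ, Complex.exp (2 * Real.pi * Complex.I * i * (w + s)) *
      Complex.exp (-(k * c) * (s : ℂ) ^ 2) = Complex.exp (-(k * c) * (s : ℂ) ^ 2
        + 2 * Real.pi * Complex.I * i * s + 2 * Real.pi * Complex.I * i * w) := by
    intro s
    rw [← Complex.exp_add]
    congr 1
    ring
  simp only [e]
  refine ⟨integrable_cexp_quadratic hkc _ _, ?_⟩
  have h1 := integral_cexp_quadratic (b := -(k * c)) (by rw [Complex.neg_re]; linarith)
    (2 * Real.pi * Complex.I * i) (2 * Real.pi * Complex.I * i * w)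
  have h2 := integral_pow_mul_gaussian_scale c hk 0
  simp only [pow_zero, one_mul, zero_add, pow_one] at h2
  rw [integral_gaussian_complex hkc] at h2
  have hs : ((Real.sqrt k : ℝ) : ℂ) ≠ 0 := by exact_mod_cast (Real.sqrt_pos.2 hk0).ne'
  rw [h1, neg_neg, h2, ← gaussMass, ← mul_assoc]
  have : ((Real.sqrt k : ℝ) : ℂ) / gaussMass c * (((Real.sqrt k : ℝ) : ℂ)⁻¹ * gaussMass c) = 1 := by
    have := gaussMass_ne_zero hc
    field_simp
  rw [this, one_mul]
  congr 1
  rw [mul_pow, mul_pow, mul_pow, Complex.I_sq]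
  field_simp
  ring

/-! ### The leading part of a Gaussian sum -/

/-- The size of the leading part of a Gaussian sum, relative to its symbol. -/
noncomputable def leadingExp (c : ℂ) (k : ℕ) (P Q : ℝ) : ℂ :=
  Complex.exp (4 * Real.pi * Complex.I * k * Q * P - 4 * Real.pi ^ 2 * k * Q ^ 2 / c)

lemma norm_leadingExp (c : ℂ) (k : ℕ) (P Q : ℝ) :
    ‖leadingExp c k P Q‖ = Real.exp (-(4 * Real.pi ^ 2 * (1 / c).re * k) * Q ^ 2) := by
  rw [leadingExp, Complex.norm_exp]
  congr 1
  rw [show (4 * Real.pi * Complex.I * k * Q * P - 4 * Real.pi ^ 2 * k * Q ^ 2 / c : ℂ)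
    = ((4 * Real.pi * k * Q * P : ℝ) : ℂ) * Complex.I
      - ((4 * Real.pi ^ 2 * k * Q ^ 2 : ℝ) : ℂ) * (1 / c) by push_cast; ring, Complex.sub_re,
    Complex.re_ofReal_mul, Complex.re_ofReal_mul, Complex.I_re]
  ring

/-- The contribution of the zero mode of the dual series is a Gaussian average of the character. -/
lemma dualTerm_zero_eq {c : ℂ} (hc : 0 < c.re) {k : ℕ} (hk : 1 ≤ k) (P Q : ℝ) (i : ℕ) :
    Complex.exp (-(2 * Real.pi * Complex.I * i * P)) * dualTerm c k P (Q + i / (2 * k)) 0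
      = leadingExp c k P Q * ((Real.sqrt k : ℝ) / gaussMass c * ∫ s : ℝ,
        Complex.exp (2 * Real.pi * Complex.I * i * (2 * Real.pi * Complex.I * Q / c + s)) *
          Complex.exp (-(k * c) * (s : ℂ) ^ 2)) := by
  have hk0 : (k : ℂ) ≠ 0 := by exact_mod_cast (by omega : k ≠ 0)
  have hc0 := ne_zero_of_re_pos hc
  rw [(integral_character_mul_gaussian hc hk i _).2, dualTerm, leadingExp, ← Complex.exp_add,
    ← Complex.exp_add]
  congr 1
  push_cast
  field_simp
  ring_nf
  simp only [Complex.I_sq]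
  ring

/-- Near an integral frequency, a Gaussian sum is the product of an exponential factor with a local
average of the function that its coefficients sample. -/
lemma IsSampled.exists_gaussSum_sub_le {a : ℕ → ℤ → ℂ} {b : ℂ → ℂ} {x₀ r : ℝ} {M : ℕ}
    (h : IsSampled a b x₀ r M) {c : ℂ} (hc : 0 < c.re) : ∃ ε ρ : ℝ, 0 < ε ∧ 32 * ε ≤ r ∧ 0 < ρ ∧
      (∀ P Q : ℝ, |P - x₀| < ρ → |Q| < ρ →
        (P : ℂ) + 2 * Real.pi * Complex.I * Q / c ∈ Metric.ball (x₀ : ℂ) ε) ∧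
      ∀ L : ℕ, ∃ C : ℝ, 0 < C ∧ ∀ k : ℕ, 1 ≤ k → ∀ P Q : ℝ, |P - x₀| < ρ → |Q| < ρ →
        ‖gaussSum a c k P Q - 2 * (Real.sqrt k : ℝ) * gaussMass c * leadingExp c k P Q *
          localAverage b c ε k (P + 2 * Real.pi * Complex.I * Q / c)‖ ≤ C * ((k : ℝ) ^ L)⁻¹ := by
  obtain ⟨ρ₀, hρ₀, hρr, happ⟩ := h.exists_approx hc
  have hpi := Real.pi_pos
  have hcn : 0 < ‖c‖ := norm_pos_iff.2 (ne_zero_of_re_pos hc)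
  have hκ := inv_re_pos hc
  set ε := ρ₀ / 32 with hε
  have hε0 : 0 < ε := by positivity
  set B : ℝ := 2 * Real.pi / ‖c‖ with hB
  have hB0 : 0 < B := by positivity
  have hnQ : ∀ Q : ℝ, ‖(2 * Real.pi * Complex.I * Q / c : ℂ)‖ = B * |Q| := by
    intro Q
    rw [norm_div, norm_mul, norm_mul, norm_mul, Complex.norm_I, Complex.norm_real, Complex.norm_real,
      Real.norm_of_nonneg hpi.le, Complex.norm_ofNat, Real.norm_eq_abs, hB]
    ring
  set ρ : ℝ := min (1 / 2) (ε / (1 + B)) with hρ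
  have hρ0 : 0 < ρ := by positivity
  have hρ1 : ρ ≤ ε / (1 + B) := min_le_right _ _
  have hρε : ρ * (1 + B) ≤ ε := by rwa [le_div_iff₀ (by positivity)] at hρ1
  have hPx : ∀ P : ℝ, ‖(P : ℂ) - x₀‖ = |P - x₀| := fun P => by
    rw [← Complex.ofReal_sub, Complex.norm_real, Real.norm_eq_abs]
  have hball : ∀ P Q : ℝ, |P - x₀| < ρ → |Q| < ρ →
      (P : ℂ) + 2 * Real.pi * Complex.I * Q / c ∈ Metric.ball (x₀ : ℂ) ε := by
    intro P Q hP hQ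
    rw [Metric.mem_ball, dist_eq_norm]
    calc ‖(P : ℂ) + 2 * Real.pi * Complex.I * Q / c - x₀‖
        = ‖((P : ℂ) - x₀) + 2 * Real.pi * Complex.I * Q / c‖ := by congr 1; ring
      _ ≤ |P - x₀| + B * |Q| := (norm_add_le _ _).trans_eq (by rw [hPx, hnQ])
      _ < ρ + B * ρ := by gcongr
      _ ≤ ε := by linarith
  refine ⟨ε, ρ, hε0, by linarith, hρ0, hball, fun L => ?_⟩
  obtain ⟨n, C, γ, hn, hC, hγ⟩ := happ (L + 2)
  choose D hD htail using fun i : ℕ => exists_dualTerm_tail_le hc (d := 1 / 2) (by norm_num) i (L + 1)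
  have hbc : ContinuousOn b (Metric.ball (x₀ : ℂ) (2 * ε)) :=
    h.differentiableOn.continuousOn.mono (Metric.ball_subset_ball (by linarith))
  obtain ⟨C₁, hC₁, hloc⟩ := exists_localAverage_sub_le hε0 hbc hc n
  obtain ⟨C₂, hC₂, h2⟩ := exists_pow_mul_exp_neg_le (a := 4 * Real.pi ^ 2 * (1 / c).re)
    (by positivity) n
  set G := ‖gaussMass c‖ with hG
  set K₁ : ℝ := Real.exp (2 * Real.pi * (2 * n) * ε) with hK₁
  set K : ℝ := C + 2 * n * (C * K₁) / ε ^ (2 * n) with hK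
  have hK0 : 0 < K := by positivity
  have hDs : 0 ≤ ∑ i ∈ Finset.range (2 * n), C * (2 * G * D i) :=
    Finset.sum_nonneg fun i _ => by have := hD i; positivity
  refine ⟨C + ∑ i ∈ Finset.range (2 * n), C * (2 * G * D i) + 2 * G * C₁ * K * (B ^ (2 * n) * C₂ + 1),
    by positivity, fun k hk P Q hP hQ => ?_⟩
  have hk0 : (0 : ℝ) < k := by exact_mod_cast hk
  have hk1 : (1 : ℝ) ≤ k := by exact_mod_cast hk
  have hρ₀ρ : ρ < ρ₀ := by
    have : ρ * 1 ≤ ρ * (1 + B) := by gcongr; linarith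
    linarith
  obtain ⟨hγ1, hγ2, hγ3⟩ := hγ P (hP.trans hρ₀ρ)
  set w : ℂ := 2 * Real.pi * Complex.I * Q / c with hw
  set z : ℂ := P + w with hz
  have hzb := hball P Q hP hQ
  set T : ℝ → ℂ := fun s => ∑ i ∈ Finset.range (2 * n),
    γ P i * Complex.exp (2 * Real.pi * Complex.I * i * (w + s)) with hT
  have hsq := norm_sqrt_natCast_le hk
  -- splitting of each translated theta series into its zero mode and the other modes
  have hsplit : ∀ i : ℕ, ∑' N : ℤ, gaussTerm c k P (Q + i / (2 * k)) N = 2 * (Real.sqrt k : ℝ) *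
      gaussMass c * (dualTerm c k P (Q + i / (2 * k)) 0 + ∑' m : ℤ,
        ({0}ᶜ : Set ℤ).indicator (dualTerm c k P (Q + i / (2 * k))) m) := by
    intro i
    have hsum : Summable (dualTerm c k P (Q + i / (2 * k))) := by
      obtain ⟨C', -, h'⟩ := exists_gaussian_sum_bound
        (a := 4 * Real.pi ^ 2 * (1 / c).re * k) (by positivity)
      refine Summable.of_norm ((h' (Q + i / (2 * k))).1.congr fun m => ?_)
      rw [norm_dualTerm]
    rw [tsum_gaussTerm hc hk, hsum.tsum_eq_add_tsum_ite 0]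
    congr 3
    ext m
    by_cases hm : m = 0 <;> simp [hm]
  have hTint : ∀ i ∈ Finset.range (2 * n), MeasureTheory.Integrable (fun s : ℝ =>
      γ P i * Complex.exp (2 * Real.pi * Complex.I * i * (w + s)) *
        Complex.exp (-(k * c) * (s : ℂ) ^ 2)) := by
    intro i _
    simp only [mul_assoc (γ P i)]
    exact (integral_character_mul_gaussian hc hk i w).1.const_mul _
  have hmain : ∑ i ∈ Finset.range (2 * n), γ P i * (Complex.exp (-(2 * Real.pi * Complex.I * i * P)) *
      ∑' N : ℤ, gaussTerm c k P (Q + i / (2 * k)) N)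
      = 2 * (Real.sqrt k : ℝ) * gaussMass c * leadingExp c k P Q *
          ((Real.sqrt k : ℝ) / gaussMass c * ∫ s : ℝ, T s * Complex.exp (-(k * c) * (s : ℂ) ^ 2))
        + ∑ i ∈ Finset.range (2 * n), γ P i * (Complex.exp (-(2 * Real.pi * Complex.I * i * P)) *
          (2 * (Real.sqrt k : ℝ) * gaussMass c * ∑' m : ℤ,
            ({0}ᶜ : Set ℤ).indicator (dualTerm c k P (Q + i / (2 * k))) m)) := by
    simp only [hT, Finset.sum_mul]
    rw [MeasureTheory.integral_finsetSum _ hTint, Finset.mul_sum, Finset.mul_sum,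
      ← Finset.sum_add_distrib]
    refine Finset.sum_congr rfl fun i _ => ?_
    simp only [mul_assoc (γ P i)]
    rw [MeasureTheory.integral_const_mul, hsplit i]
    linear_combination (2 * (Real.sqrt k : ℝ) * gaussMass c * γ P i) * dualTerm_zero_eq hc hk P Q i
  have hrest : ‖∑ i ∈ Finset.range (2 * n), γ P i *
      (Complex.exp (-(2 * Real.pi * Complex.I * i * P)) * (2 * (Real.sqrt k : ℝ) * gaussMass c *
        ∑' m : ℤ, ({0}ᶜ : Set ℤ).indicator (dualTerm c k P (Q + i / (2 * k))) m))‖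
      ≤ (∑ i ∈ Finset.range (2 * n), C * (2 * G * D i)) * ((k : ℝ) ^ L)⁻¹ := by
    rw [Finset.sum_mul]
    refine norm_sum_le_of_le _ fun i hi => ?_
    have hn1 : ‖Complex.exp (-(2 * Real.pi * Complex.I * i * P))‖ = 1 := by
      have := norm_exp_two_pi_mul i (-P)
      rw [← this]; congr 2; push_cast; ring
    have ht := htail i k hk P Q ({0}ᶜ) (fun m hm => by
      have hm1 : (1 : ℝ) ≤ |(m : ℝ)| := by exact_mod_cast Int.one_le_abs hm
      have h3 := abs_sub_abs_le_abs_sub (m : ℝ) Q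
      have h4 : ρ ≤ 1 / 2 := min_le_left _ _
      linarith)
    rw [norm_mul, norm_mul, hn1, one_mul, norm_mul, norm_mul, norm_mul, Complex.norm_ofNat]
    calc _ ≤ C * (2 * k * G * (D i * ((k : ℝ) ^ (L + 1))⁻¹)) := by
          gcongr
          exact hγ1 i (Finset.mem_range.1 hi)
      _ = _ := by rw [pow_succ]; field_simp
  have hTi : MeasureTheory.Integrable fun s : ℝ => T s * Complex.exp (-(k * c) * (s : ℂ) ^ 2) := by
    simp only [hT, Finset.sum_mul]
    exact MeasureTheory.integrable_finsetSum _ hTint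
  have hwn : ‖w‖ < ε := by
    rw [hw, hnQ]
    calc B * |Q| ≤ B * ρ := by gcongr
      _ < ε := by linarith
  have hlocal := hloc k K (B * |Q|) T z hk hK0.le (by positivity) hzb hTi (fun s hs => by
      have hx : ‖z + s - x₀‖ < ρ₀ := by
        rw [Metric.mem_ball, dist_eq_norm] at hzb
        calc ‖z + s - x₀‖ = ‖(z - x₀) + s‖ := by congr 1; ring
          _ ≤ ‖z - x₀‖ + |s| := (norm_add_le _ _).trans_eq (by rw [Complex.norm_real, Real.norm_eq_abs])
          _ < ρ₀ := by linarith
      have h3 := hγ2 (z + s) hx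
      have h4 : z + s - P = w + s := by rw [hz]; ring
      rw [h4] at h3
      rw [norm_sub_rev]
      refine h3.trans ?_
      have h5 : ‖w + s‖ ≤ B * |Q| + |s| :=
        (norm_add_le _ _).trans_eq (by rw [hw, hnQ, Complex.norm_real, Real.norm_eq_abs])
      have h6 : C ≤ K := le_add_of_nonneg_right (by positivity)
      gcongr) (fun s hs => by
      calc ‖T s‖ ≤ ∑ i ∈ Finset.range (2 * n), C * K₁ := by
            refine norm_sum_le_of_le _ fun i hi => ?_
            rw [Finset.mem_range] at hi
            rw [norm_mul]
            refine mul_le_mul (hγ1 i hi) ?_ (norm_nonneg _) hC.le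
            rw [Complex.norm_exp]
            refine Real.exp_le_exp.2 ?_
            rw [show (2 * Real.pi * Complex.I * i * (w + s) : ℂ)
              = ((2 * Real.pi * i : ℝ) : ℂ) * (Complex.I * (w + s)) by push_cast; ring,
              Complex.re_ofReal_mul, Complex.I_mul_re, Complex.add_im, Complex.ofReal_im, add_zero]
            have h7 : -w.im ≤ ε := (neg_le_abs _).trans ((Complex.abs_im_le_norm _).trans hwn.le)
            have h8 : (i : ℝ) ≤ 2 * n := by exact_mod_cast hi.le
            calc 2 * Real.pi * i * -w.im ≤ 2 * Real.pi * i * ε := by gcongr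
              _ ≤ _ := by gcongr
        _ = 2 * n * (C * K₁) / ε ^ (2 * n) * ε ^ (2 * n) := by
            rw [Finset.sum_const, Finset.card_range, nsmul_eq_mul]; push_cast; field_simp
        _ ≤ K * (B * |Q| + |s|) ^ (2 * n) := by
            gcongr
            · exact le_add_of_nonneg_left hC.le
            · have : 0 ≤ B * |Q| := by positivity
              linarith)
  have hE1 : ‖leadingExp c k P Q‖ ≤ 1 := by
    rw [norm_leadingExp, Real.exp_le_one_iff]
    have : 0 ≤ 4 * Real.pi ^ 2 * (1 / c).re * k * Q ^ 2 := by positivity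
    linarith
  have hE2 : ‖leadingExp c k P Q‖ * (B * |Q|) ^ (2 * n) ≤ B ^ (2 * n) * C₂ * ((k : ℝ) ^ n)⁻¹ := by
    rw [norm_leadingExp, mul_pow, (even_two_mul n).pow_abs]
    have := mul_le_mul_of_nonneg_left (h2 k Q hk) (by positivity : 0 ≤ B ^ (2 * n))
    linarith
  have hkn : ((k : ℝ) ^ n)⁻¹ ≤ ((k : ℝ) ^ (L + 2))⁻¹ := by
    gcongr
  have happrox := hγ3 k hk Q
  rw [hmain] at happrox
  set I₁ := (Real.sqrt k : ℝ) / gaussMass c * ∫ s : ℝ, T s * Complex.exp (-(k * c) * (s : ℂ) ^ 2) with hI₁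
  set R := ∑ i ∈ Finset.range (2 * n), γ P i *
      (Complex.exp (-(2 * Real.pi * Complex.I * i * P)) * (2 * (Real.sqrt k : ℝ) * gaussMass c *
        ∑' m : ℤ, ({0}ᶜ : Set ℤ).indicator (dualTerm c k P (Q + i / (2 * k))) m)) with hR
  set E := leadingExp c k P Q with hE
  have hfin : ‖2 * (Real.sqrt k : ℝ) * gaussMass c * E * (I₁ - localAverage b c ε k z)‖
      ≤ 2 * G * C₁ * K * (B ^ (2 * n) * C₂ + 1) * ((k : ℝ) ^ L)⁻¹ := by
    rw [norm_mul, norm_mul, norm_mul, norm_mul, Complex.norm_ofNat]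
    calc _ ≤ 2 * k * G * ‖E‖ * (C₁ * K * k * ((B * |Q|) ^ (2 * n) + ((k : ℝ) ^ n)⁻¹)) := by
          gcongr
      _ = 2 * k * G * (C₁ * K * k) * (‖E‖ * (B * |Q|) ^ (2 * n) + ‖E‖ * ((k : ℝ) ^ n)⁻¹) := by ring
      _ ≤ 2 * k * G * (C₁ * K * k) * (B ^ (2 * n) * C₂ * ((k : ℝ) ^ n)⁻¹ + 1 * ((k : ℝ) ^ n)⁻¹) := by
          gcongr
      _ = 2 * k * G * (C₁ * K * k) * (B ^ (2 * n) * C₂ + 1) * ((k : ℝ) ^ n)⁻¹ := by ring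
      _ ≤ 2 * k * G * (C₁ * K * k) * (B ^ (2 * n) * C₂ + 1) * ((k : ℝ) ^ (L + 2))⁻¹ := by gcongr
      _ = _ := by rw [pow_add]; field_simp
  have hkL : ((k : ℝ) ^ (L + 2))⁻¹ ≤ ((k : ℝ) ^ L)⁻¹ := by
    gcongr
    omega
  calc ‖gaussSum a c k P Q - 2 * (Real.sqrt k : ℝ) * gaussMass c * E * localAverage b c ε k z‖
      = ‖(gaussSum a c k P Q - (2 * (Real.sqrt k : ℝ) * gaussMass c * E * I₁ + R)) + R
          + 2 * (Real.sqrt k : ℝ) * gaussMass c * E * (I₁ - localAverage b c ε k z)‖ := by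
        congr 1; ring
    _ ≤ C * ((k : ℝ) ^ (L + 2))⁻¹ + (∑ i ∈ Finset.range (2 * n), C * (2 * G * D i)) * ((k : ℝ) ^ L)⁻¹
          + 2 * G * C₁ * K * (B ^ (2 * n) * C₂ + 1) * ((k : ℝ) ^ L)⁻¹ :=
        (norm_add_le _ _).trans (add_le_add ((norm_add_le _ _).trans (add_le_add happrox hrest)) hfin)
    _ ≤ C * ((k : ℝ) ^ L)⁻¹ + (∑ i ∈ Finset.range (2 * n), C * (2 * G * D i)) * ((k : ℝ) ^ L)⁻¹
          + 2 * G * C₁ * K * (B ^ (2 * n) * C₂ + 1) * ((k : ℝ) ^ L)⁻¹ := by gcongr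
    _ = _ := by ring

/-! ### Asymptotic expansions of holomorphic functions -/

/-- The holomorphic functions `f k` on `B` have the asymptotic expansion `∑ k ^ (-l) F l`, uniformly
on `B`, with holomorphic coefficients. -/
structure HolExp (B : Set ℂ) (f F : ℕ → ℂ → ℂ) : Prop where
  differentiableOn : ∀ k, 1 ≤ k → DifferentiableOn ℂ (f k) B
  differentiableOn_coeff : ∀ l, DifferentiableOn ℂ (F l) B
  bound : ∀ L : ℕ, ∃ C : ℝ, 0 < C ∧ ∀ k : ℕ, 1 ≤ k → ∀ z ∈ B,
    ‖f k z - ∑ l ∈ Finset.range L, ((k : ℂ) ^ l)⁻¹ * F l z‖ ≤ C * ((k : ℝ) ^ L)⁻¹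

lemma HolExp.const_mul {B : Set ℂ} {f F : ℕ → ℂ → ℂ} (h : HolExp B f F) (a : ℂ) :
    HolExp B (fun k z => a * f k z) (fun l z => a * F l z) := by
  refine ⟨fun k hk => (h.differentiableOn k hk).const_mul a,
    fun l => (h.differentiableOn_coeff l).const_mul a, fun L => ?_⟩
  obtain ⟨C, hC, hb⟩ := h.bound L
  refine ⟨(‖a‖ + 1) * C, by positivity, fun k hk z hz => ?_⟩
  have e : a * f k z - ∑ l ∈ Finset.range L, ((k : ℂ) ^ l)⁻¹ * (a * F l z)
      = a * (f k z - ∑ l ∈ Finset.range L, ((k : ℂ) ^ l)⁻¹ * F l z) := by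
    rw [mul_sub, Finset.mul_sum]
    congr 1
    exact Finset.sum_congr rfl fun l _ => by ring
  rw [e, norm_mul, mul_assoc]
  have := hb k hk z hz
  gcongr
  linarith

lemma HolExp.sum {ι : Type*} (s : Finset ι) {B : Set ℂ} {f F : ι → ℕ → ℂ → ℂ}
    (h : ∀ i ∈ s, HolExp B (f i) (F i)) :
    HolExp B (fun k z => ∑ i ∈ s, f i k z) (fun l z => ∑ i ∈ s, F i l z) := by
  refine ⟨fun k hk => DifferentiableOn.fun_sum fun i hi => (h i hi).differentiableOn k hk,
    fun l => DifferentiableOn.fun_sum fun i hi => (h i hi).differentiableOn_coeff l, fun L => ?_⟩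
  choose! C hC hb using fun i (hi : i ∈ s) => (h i hi).bound L
  have h0 : 0 ≤ ∑ i ∈ s, C i := Finset.sum_nonneg fun i hi => (hC i hi).le
  refine ⟨1 + ∑ i ∈ s, C i, by linarith, fun k hk z hz => ?_⟩
  have e : ∑ i ∈ s, f i k z - ∑ l ∈ Finset.range L, ((k : ℂ) ^ l)⁻¹ * ∑ i ∈ s, F i l z
      = ∑ i ∈ s, (f i k z - ∑ l ∈ Finset.range L, ((k : ℂ) ^ l)⁻¹ * F i l z) := by
    rw [Finset.sum_sub_distrib, Finset.sum_comm]
    simp only [Finset.mul_sum]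
  rw [e]
  refine (norm_sum_le_of_le _ fun i hi => hb i hi k hk z hz).trans ?_
  rw [← Finset.sum_mul]
  gcongr
  linarith

/-- The coefficients of an expansion multiplied by `k⁻¹`. -/
def shiftCoeff (F : ℕ → ℂ → ℂ) : ℕ → ℂ → ℂ
  | 0 => fun _ => 0
  | l + 1 => F l

lemma HolExp.inv_mul {B : Set ℂ} {f F : ℕ → ℂ → ℂ} (h : HolExp B f F) :
    HolExp B (fun k z => (k : ℂ)⁻¹ * f k z) (shiftCoeff F) := by
  refine ⟨fun k hk => (h.differentiableOn k hk).const_mul _, fun l => ?_, fun L => ?_⟩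
  · cases l with
    | zero => exact differentiableOn_const 0
    | succ l => exact h.differentiableOn_coeff l
  · have e : ∀ (k : ℕ) (L : ℕ) (z : ℂ), (k : ℂ)⁻¹ * f k z
        - ∑ l ∈ Finset.range (L + 1), ((k : ℂ) ^ l)⁻¹ * shiftCoeff F l z
        = (k : ℂ)⁻¹ * (f k z - ∑ l ∈ Finset.range L, ((k : ℂ) ^ l)⁻¹ * F l z) := by
      intro k L z
      rw [Finset.sum_range_succ', mul_sub, Finset.mul_sum]
      simp only [shiftCoeff, mul_zero, add_zero]
      congr 1
      refine Finset.sum_congr rfl fun l _ => ?_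
      rw [pow_succ, mul_inv]
      ring
    cases L with
    | zero =>
      obtain ⟨C, hC, hb⟩ := h.bound 0
      refine ⟨C, hC, fun k hk z hz => ?_⟩
      have hk1 : (1 : ℝ) ≤ k := by exact_mod_cast hk
      have := hb k hk z hz
      simp only [Finset.range_zero, Finset.sum_empty, sub_zero, pow_zero, inv_one, mul_one] at this ⊢
      rw [norm_mul, norm_inv, Complex.norm_natCast]
      exact (mul_le_of_le_one_left (norm_nonneg _) (inv_le_one_of_one_le₀ hk1)).trans this
    | succ L =>
      obtain ⟨C, hC, hb⟩ := h.bound L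
      refine ⟨C, hC, fun k hk z hz => ?_⟩
      rw [e, norm_mul, norm_inv, Complex.norm_natCast, pow_succ, mul_inv]
      calc _ ≤ (k : ℝ)⁻¹ * (C * ((k : ℝ) ^ L)⁻¹) := by
            gcongr
            exact hb k hk z hz
        _ = _ := by ring

lemma HolExp.exists_inv_pow_mul {B : Set ℂ} {f F : ℕ → ℂ → ℂ} (h : HolExp B f F) (n : ℕ) :
    ∃ F' : ℕ → ℂ → ℂ, HolExp B (fun k z => ((k : ℂ) ^ n)⁻¹ * f k z) F' ∧
      ∀ z, F' 0 z = if n = 0 then F 0 z else 0 := by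
  induction n with
  | zero => exact ⟨F, by simpa using h, by simp⟩
  | succ n ih =>
    obtain ⟨F', hF', -⟩ := ih
    refine ⟨shiftCoeff F', ?_, by simp [shiftCoeff]⟩
    have e : (fun (k : ℕ) (z : ℂ) => (k : ℂ)⁻¹ * (((k : ℂ) ^ n)⁻¹ * f k z))
        = fun (k : ℕ) (z : ℂ) => ((k : ℂ) ^ (n + 1))⁻¹ * f k z := by
      ext k z
      rw [pow_succ, mul_inv]
      ring
    exact e ▸ hF'.inv_mul

/-- Cauchy's estimates, for the real derivatives of the composition of a holomorphic function with an
affine map. -/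
lemma exists_norm_iteratedFDeriv_comp_le {B : Set ℂ} (hB : IsOpen B) (ℓ : Plane →L[ℝ] ℂ) (w : ℂ)
    (m : ℕ) {K : Set Plane} (hK : IsCompact K) (hKB : ∀ y ∈ K, ℓ y + w ∈ B) : ∃ C : ℝ, 0 < C ∧
      ∀ (h : ℂ → ℂ) (ε : ℝ), DifferentiableOn ℂ h B → (∀ z ∈ B, ‖h z‖ ≤ ε) → ∀ y ∈ K,
        ‖iteratedFDeriv ℝ m (fun y => h (ℓ y + w)) y‖ ≤ C * ε := by
  set B' : Set ℂ := (fun u => u + w) ⁻¹' B with hB'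
  have hB'o : IsOpen B' := hB.preimage (by fun_prop)
  obtain ⟨δ, hδ, hδB⟩ := (hK.image ℓ.continuous).exists_cthickening_subset_open hB'o
    (by rintro _ ⟨y, hy, rfl⟩; exact hKB y hy)
  refine ⟨(‖ℓ‖ + 1) ^ m * (m.factorial / δ ^ m), by positivity, fun h ε hh hle y hy => ?_⟩
  set g : ℂ → ℂ := fun u => h (u + w) with hg
  have hgd : DifferentiableOn ℂ g B' := hh.comp (by fun_prop) fun u hu => hu
  have hyB : ℓ y ∈ B' := hKB y hy
  have hε : 0 ≤ ε := (norm_nonneg _).trans (hle _ hyB)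
  have hball : Metric.closedBall (ℓ y) δ ⊆ B' :=
    (Metric.closedBall_subset_cthickening (Set.mem_image_of_mem _ hy) δ).trans hδB
  have hcont : ContDiffOn ℝ m g B' := (hgd.contDiffOn (n := m) hB'o).restrict_scalars ℝ
  have hVo : IsOpen (ℓ ⁻¹' B') := hB'o.preimage ℓ.continuous
  have h1 : iteratedFDeriv ℝ m (g ∘ ℓ) y
      = (iteratedFDeriv ℝ m g (ℓ y)).compContinuousLinearMap fun _ => ℓ := by
    rw [← iteratedFDerivWithin_of_isOpen m hVo (show y ∈ ℓ ⁻¹' B' from hyB),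
      ← iteratedFDerivWithin_of_isOpen m hB'o hyB]
    exact ℓ.iteratedFDerivWithin_comp_right hcont hB'o.uniqueDiffOn hVo.uniqueDiffOn hyB le_rfl
  have h2 : ‖iteratedFDeriv ℝ m g (ℓ y)‖ = ‖iteratedDeriv m g (ℓ y)‖ := by
    have hc : ContDiffAt ℂ m g (ℓ y) := (hgd.contDiffOn hB'o).contDiffAt (hB'o.mem_nhds hyB)
    rw [← hc.restrictScalars_iteratedFDeriv (𝕜 := ℝ), ← norm_iteratedFDeriv_eq_norm_iteratedDeriv]
    exact ContinuousMultilinearMap.norm_restrictScalars _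
  have h3 : ‖iteratedDeriv m g (ℓ y)‖ ≤ m.factorial * ε / δ ^ m :=
    Complex.norm_iteratedDeriv_le_of_forall_mem_sphere_norm_le m hδ
      ((hgd.mono hball).diffContOnCl_ball (by rfl))
      (fun z hz => hle _ (hball (Metric.sphere_subset_closedBall hz)))
  calc ‖iteratedFDeriv ℝ m (g ∘ ℓ) y‖ ≤ ‖iteratedFDeriv ℝ m g (ℓ y)‖ * ∏ _i : Fin m, ‖ℓ‖ := by
        rw [h1]
        exact ContinuousMultilinearMap.norm_compContinuousLinearMap_le _ _
    _ = ‖ℓ‖ ^ m * ‖iteratedDeriv m g (ℓ y)‖ := by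
        rw [h2, Finset.prod_const, Finset.card_univ, Fintype.card_fin, mul_comm]
    _ ≤ (‖ℓ‖ + 1) ^ m * (m.factorial * ε / δ ^ m) := by
        gcongr
        linarith
    _ = _ := by ring

lemma HolExp.hasSmoothExpansion {B : Set ℂ} (hB : IsOpen B) {f F : ℕ → ℂ → ℂ} (h : HolExp B f F)
    (ℓ : Plane →L[ℝ] ℂ) (w : ℂ) {V : Set Plane} (hV : ∀ y ∈ V, ℓ y + w ∈ B) :
    HasSmoothExpansion V (fun k y => f k (ℓ y + w)) (fun l y => F l (ℓ y + w)) := by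
  have hsm : ∀ g : ℂ → ℂ, DifferentiableOn ℂ g B → ContDiffOn ℝ ∞ (fun y => g (ℓ y + w)) V :=
    fun g hg => ((hg.contDiffOn hB).restrict_scalars ℝ).comp (by fun_prop) hV
  refine ⟨fun k hk => hsm _ (h.differentiableOn k hk), fun l => hsm _ (h.differentiableOn_coeff l),
    fun L m K hK hKV => ?_⟩
  obtain ⟨C, hC, hle⟩ := exists_norm_iteratedFDeriv_comp_le hB ℓ w m hK fun y hy => hV y (hKV hy)
  obtain ⟨C', -, hb⟩ := h.bound L
  refine ⟨C * C', fun k hk y hy => ?_⟩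
  have := hle (fun z => f k z - ∑ l ∈ Finset.range L, ((k : ℂ) ^ l)⁻¹ * F l z) _
    ((h.differentiableOn k hk).sub (DifferentiableOn.fun_sum fun l _ =>
      (h.differentiableOn_coeff l).const_mul _)) (hb k hk) y hy
  rwa [← mul_assoc] at this

/-! ### The expansion of local averages -/

/-- The moments of the normalized Gaussian. -/
noncomputable def gaussMoment (c : ℂ) (n : ℕ) : ℂ :=
  (gaussMass c)⁻¹ * ∫ s : ℝ, (s : ℂ) ^ n * Complex.exp (-c * (s : ℂ) ^ 2)

lemma gaussMoment_zero {c : ℂ} (hc : 0 < c.re) : gaussMoment c 0 = 1 := by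
  simp only [gaussMoment, pow_zero, one_mul]
  exact inv_mul_cancel₀ (gaussMass_ne_zero hc)

lemma gaussMoment_odd (c : ℂ) {n : ℕ} (hn : Odd n) : gaussMoment c n = 0 := by
  have h := MeasureTheory.integral_neg_eq_self
    (fun s : ℝ => (s : ℂ) ^ n * Complex.exp (-c * (s : ℂ) ^ 2)) MeasureTheory.volume
  simp only [Complex.ofReal_neg, hn.neg_pow, neg_sq, neg_mul (_ ^ n : ℂ)] at h
  rw [MeasureTheory.integral_neg] at h
  have h0 : ∫ s : ℝ, (s : ℂ) ^ n * Complex.exp (-c * (s : ℂ) ^ 2) = 0 := by linear_combination -h / 2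
  rw [gaussMoment, h0, mul_zero]

lemma integral_polynomial_mul_gaussian {c : ℂ} (hc : 0 < c.re) {k : ℕ} (hk : 1 ≤ k) (β : ℕ → ℂ)
    (L : ℕ) : MeasureTheory.Integrable (fun s : ℝ => (∑ n ∈ Finset.range (2 * L), β n * (s : ℂ) ^ n) *
        Complex.exp (-(k * c) * (s : ℂ) ^ 2)) ∧
    (Real.sqrt k : ℝ) / gaussMass c * (∫ s : ℝ, (∑ n ∈ Finset.range (2 * L), β n * (s : ℂ) ^ n) *
        Complex.exp (-(k * c) * (s : ℂ) ^ 2))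
      = ∑ l ∈ Finset.range L, ((k : ℂ) ^ l)⁻¹ * (β (2 * l) * gaussMoment c (2 * l)) := by
  have hk0 : (0 : ℝ) < k := by exact_mod_cast hk
  have hs : ((Real.sqrt k : ℝ) : ℂ) ≠ 0 := by exact_mod_cast (Real.sqrt_pos.2 hk0).ne'
  have hsq : ((Real.sqrt k : ℝ) : ℂ) ^ 2 = k := by
    rw [← Complex.ofReal_pow, Real.sq_sqrt hk0.le]; simp
  have hi : ∀ n ∈ Finset.range (2 * L), MeasureTheory.Integrable fun s : ℝ =>
      β n * (s : ℂ) ^ n * Complex.exp (-(k * c) * (s : ℂ) ^ 2) := by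
    intro n _
    simp only [mul_assoc (β n)]
    exact (integrable_pow_mul_gaussian (natCast_mul_re_pos hc hk) n).const_mul _
  simp only [Finset.sum_mul]
  refine ⟨MeasureTheory.integrable_finsetSum _ hi, ?_⟩
  rw [MeasureTheory.integral_finsetSum _ hi, Finset.mul_sum]
  have hn : ∀ n : ℕ, (Real.sqrt k : ℝ) / gaussMass c *
      (∫ s : ℝ, β n * (s : ℂ) ^ n * Complex.exp (-(k * c) * (s : ℂ) ^ 2))
      = ((Real.sqrt k : ℝ) : ℂ)⁻¹ ^ n * (β n * gaussMoment c n) := by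
    intro n
    simp only [mul_assoc (β n)]
    rw [MeasureTheory.integral_const_mul, integral_pow_mul_gaussian_scale c hk, gaussMoment, pow_succ]
    field_simp
  simp only [hn]
  clear hi
  induction L with
  | zero => simp
  | succ L ih =>
    rw [show 2 * (L + 1) = 2 * L + 1 + 1 by ring, Finset.sum_range_succ, Finset.sum_range_succ, ih,
      Finset.sum_range_succ, gaussMoment_odd c (odd_two_mul_add_one L), pow_mul, inv_pow, hsq, inv_pow]
    ring

lemma differentiableOn_localAverage {b : ℂ → ℂ} {x₀ ε r : ℝ} (hε : 0 < ε) (hr : 32 * ε ≤ r)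
    (hb : DifferentiableOn ℂ b (Metric.ball (x₀ : ℂ) r)) {c : ℂ} (hc : 0 < c.re) (k : ℕ) :
    DifferentiableOn ℂ (localAverage b c ε k) (Metric.ball (x₀ : ℂ) ε) := by
  have hmem : ∀ z ∈ Metric.ball (x₀ : ℂ) ε, ∀ s : ℝ, s ∈ Set.uIcc (-ε) ε →
      z + s ∈ Metric.closedBall (x₀ : ℂ) (2 * ε) := by
    intro z hz s hs
    rw [Set.uIcc_of_le (by linarith)] at hs
    have hs' : |s| ≤ ε := abs_le.2 hs
    rw [Metric.mem_ball, dist_eq_norm] at hz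
    rw [Metric.mem_closedBall, dist_eq_norm]
    calc ‖z + s - x₀‖ = ‖(z - x₀) + s‖ := by congr 1; ring
      _ ≤ ‖z - x₀‖ + ‖(s : ℂ)‖ := norm_add_le _ _
      _ ≤ 2 * ε := by rw [Complex.norm_real, Real.norm_eq_abs]; linarith
  have hcb : Metric.closedBall (x₀ : ℂ) (2 * ε) ⊆ Metric.ball (x₀ : ℂ) r :=
    Metric.closedBall_subset_ball (by linarith)
  have hdc : ContinuousOn (deriv b) (Metric.ball (x₀ : ℂ) r) :=
    (hb.deriv Metric.isOpen_ball).continuousOn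
  obtain ⟨D, hD⟩ := (isCompact_closedBall (x₀ : ℂ) (2 * ε)).exists_bound_of_continuousOn
    (hdc.mono hcb)
  have hcomp : ∀ g : ℂ → ℂ, ContinuousOn g (Metric.ball (x₀ : ℂ) r) → ∀ z ∈ Metric.ball (x₀ : ℂ) ε,
      ContinuousOn (fun s : ℝ => g (z + s) * Complex.exp (-(k * c) * (s : ℂ) ^ 2))
        (Set.uIcc (-ε) ε) := fun g hg z hz =>
    ContinuousOn.mul (hg.comp (by fun_prop) fun s hs => hcb (hmem z hz s hs)) (by fun_prop)
  have hmeas : ∀ g : ℂ → ℂ, ContinuousOn g (Metric.ball (x₀ : ℂ) r) → ∀ z ∈ Metric.ball (x₀ : ℂ) ε,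
      MeasureTheory.AEStronglyMeasurable
        (fun s : ℝ => g (z + s) * Complex.exp (-(k * c) * (s : ℂ) ^ 2))
        (MeasureTheory.volume.restrict (Set.uIoc (-ε) ε)) := fun g hg z hz =>
    ((hcomp g hg z hz).mono Set.uIoc_subset_uIcc).aestronglyMeasurable measurableSet_uIoc
  intro z hz
  refine DifferentiableAt.differentiableWithinAt (DifferentiableAt.const_mul ?_ _)
  have hn : Metric.ball (x₀ : ℂ) ε ∈ nhds z := Metric.isOpen_ball.mem_nhds hz
  refine (intervalIntegral.hasDerivAt_integral_of_dominated_loc_of_deriv_le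
    (F := fun z (s : ℝ) => b (z + s) * Complex.exp (-(k * c) * (s : ℂ) ^ 2))
    (F' := fun z (s : ℝ) => deriv b (z + s) * Complex.exp (-(k * c) * (s : ℂ) ^ 2))
    (bound := fun _ => D) hn
    (Filter.eventually_of_mem hn fun z hz => hmeas b hb.continuousOn z hz)
    (hcomp b hb.continuousOn z hz).intervalIntegrable (hmeas _ hdc z hz)
    (Filter.Eventually.of_forall fun s hs z hz => ?_) intervalIntegrable_const
    (Filter.Eventually.of_forall fun s hs z hz => ?_)).2.differentiableAt
  · have h1 := hD _ (hmem z hz s (Set.uIoc_subset_uIcc hs))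
    have h2 : Real.exp (-(c.re * k) * s ^ 2) ≤ 1 := by
      rw [Real.exp_le_one_iff]
      have : 0 ≤ c.re * k * s ^ 2 := by positivity
      linarith
    rw [norm_mul, norm_exp_gaussian]
    exact (mul_le_of_le_one_right (norm_nonneg _) h2).trans h1
  · have h1 := hcb (hmem z hz s (Set.uIoc_subset_uIcc hs))
    have h2 := (hb.differentiableAt (Metric.isOpen_ball.mem_nhds h1)).hasDerivAt
    exact (h2.comp_add_const z (s : ℂ)).mul_const _

/-- The Laplace method: the coefficients of the expansion of the local averages come from the Taylor
expansion of `b`, the first one being `b` itself. -/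
lemma exists_holExp_localAverage {b : ℂ → ℂ} {x₀ ε r : ℝ} (hε : 0 < ε) (hr : 32 * ε ≤ r)
    (hb : DifferentiableOn ℂ b (Metric.ball (x₀ : ℂ) r)) {c : ℂ} (hc : 0 < c.re) :
    ∃ F : ℕ → ℂ → ℂ, HolExp (Metric.ball (x₀ : ℂ) ε) (localAverage b c ε) F ∧ F 0 = b := by
  have hbε : DifferentiableOn ℂ b (Metric.ball (x₀ : ℂ) ε) :=
    hb.mono (Metric.ball_subset_ball (by linarith))
  refine ⟨fun l z => iteratedDeriv (2 * l) b z / (2 * l).factorial * gaussMoment c (2 * l),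
    ⟨fun k _ => differentiableOn_localAverage hε hr hb hc k, fun l => ?_, fun L => ?_⟩, ?_⟩
  · refine DifferentiableOn.mul_const (DifferentiableOn.div_const ?_ _) _
    rw [iteratedDeriv_eq_iterate]
    generalize 2 * l = n
    induction n with
    | zero => exact hbε
    | succ n ih => rw [Function.iterate_succ_apply']; exact ih.deriv Metric.isOpen_ball
  · obtain ⟨C, hC, hT⟩ := exists_taylor_bound (by linarith) hb (2 * (L + 1))
    obtain ⟨C₁, hC₁, hloc⟩ := exists_localAverage_sub_le hε
      (hb.continuousOn.mono (Metric.ball_subset_ball (by linarith : 2 * ε ≤ r))) hc (L + 1)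
    set K : ℝ := C + 2 * (L + 1) * C * ((1 + ε) ^ (2 * (L + 1)) / ε ^ (2 * (L + 1))) with hK
    have hK0 : 0 < K := by positivity
    refine ⟨C₁ * K + C * ‖gaussMoment c (2 * L)‖, by positivity, fun k hk z hz => ?_⟩
    have hk0 : (0 : ℝ) < k := by exact_mod_cast hk
    have hz' : z ∈ Metric.ball (x₀ : ℂ) (r / 16) := Metric.ball_subset_ball (by linarith) hz
    obtain ⟨hT1, hT2⟩ := hT z hz'
    obtain ⟨hi, he⟩ := integral_polynomial_mul_gaussian hc hk
      (fun n => iteratedDeriv n b z / n.factorial) (L + 1)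
    have h := hloc k K 0 (fun s : ℝ => ∑ n ∈ Finset.range (2 * (L + 1)),
      iteratedDeriv n b z / n.factorial * (s : ℂ) ^ n) z hk hK0.le le_rfl hz hi (fun s hs => by
        have h1 := hT2 (z + s) (by
          rw [Metric.mem_ball, dist_eq_norm] at hz ⊢
          calc ‖z + s - x₀‖ = ‖(z - x₀) + s‖ := by congr 1; ring
            _ ≤ ‖z - x₀‖ + ‖(s : ℂ)‖ := norm_add_le _ _
            _ < r / 16 := by rw [Complex.norm_real, Real.norm_eq_abs]; linarith)
        rw [add_sub_cancel_left, Complex.norm_real, Real.norm_eq_abs] at h1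
        rw [norm_sub_rev, zero_add]
        refine h1.trans ?_
        have : C ≤ K := le_add_of_nonneg_right (by positivity)
        gcongr) (fun s hs => by
        have hpow : ∀ n < 2 * (L + 1), |s| ^ n ≤ (1 + ε) ^ (2 * (L + 1)) / ε ^ (2 * (L + 1)) *
            |s| ^ (2 * (L + 1)) := by
          intro n hn
          have ht : 1 ≤ |s| / ε := by rwa [one_le_div hε]
          calc |s| ^ n = ε ^ n * (|s| / ε) ^ n := by rw [← mul_pow, mul_div_cancel₀ _ hε.ne']
            _ ≤ (1 + ε) ^ n * (|s| / ε) ^ n := by gcongr; linarith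
            _ ≤ (1 + ε) ^ (2 * (L + 1)) * (|s| / ε) ^ (2 * (L + 1)) := by
              gcongr
              linarith
            _ = _ := by rw [div_pow]; ring
        rw [zero_add]
        calc _ ≤ ∑ n ∈ Finset.range (2 * (L + 1)), C * ((1 + ε) ^ (2 * (L + 1)) / ε ^ (2 * (L + 1)) *
              |s| ^ (2 * (L + 1))) := by
              refine norm_sum_le_of_le _ fun n hn => ?_
              rw [Finset.mem_range] at hn
              rw [norm_mul, norm_pow, Complex.norm_real, Real.norm_eq_abs]
              exact mul_le_mul (hT1 n hn) (hpow n hn) (by positivity) hC.le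
          _ = 2 * (L + 1) * C * ((1 + ε) ^ (2 * (L + 1)) / ε ^ (2 * (L + 1))) *
              |s| ^ (2 * (L + 1)) := by
              rw [Finset.sum_const, Finset.card_range, nsmul_eq_mul]; push_cast; ring
          _ ≤ _ := by
              refine mul_le_mul_of_nonneg_right ?_ (by positivity)
              rw [hK]; linarith)
    rw [he, zero_pow (by omega), zero_add, Finset.sum_range_succ, norm_sub_rev] at h
    set S := ∑ l ∈ Finset.range L, ((k : ℂ) ^ l)⁻¹ *
      (iteratedDeriv (2 * l) b z / (2 * l).factorial * gaussMoment c (2 * l)) with hS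
    set t := iteratedDeriv (2 * L) b z / (2 * L).factorial * gaussMoment c (2 * L) with ht
    have htn : ‖t‖ ≤ C * ‖gaussMoment c (2 * L)‖ := by
      rw [ht, norm_mul]
      exact mul_le_mul_of_nonneg_right (hT1 _ (by omega)) (norm_nonneg _)
    calc ‖localAverage b c ε k z - S‖
        = ‖(localAverage b c ε k z - (S + ((k : ℂ) ^ L)⁻¹ * t)) + ((k : ℂ) ^ L)⁻¹ * t‖ := by
          congr 1; ring
      _ ≤ C₁ * K * k * ((k : ℝ) ^ (L + 1))⁻¹ + ((k : ℝ) ^ L)⁻¹ * (C * ‖gaussMoment c (2 * L)‖) := by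
          refine (norm_add_le _ _).trans (add_le_add h ?_)
          rw [norm_mul, norm_inv, norm_pow, Complex.norm_natCast]
          gcongr
      _ = _ := by rw [pow_succ]; field_simp
  · ext z
    simp [gaussMoment_zero hc]

/-! ### Negligible families -/

lemma IsNegligibleOn.mono {S S' : Set Plane} {r : ℕ → Plane → ℂ} (h : IsNegligibleOn S r)
    (hS : S' ⊆ S) : IsNegligibleOn S' r := fun N => by
  obtain ⟨C, hC⟩ := h N
  exact ⟨C, fun k hk y hy => hC k hk y (hS hy)⟩

lemma IsNegligibleOn.congr {S : Set Plane} {r r' : ℕ → Plane → ℂ} (h : IsNegligibleOn S r)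
    (he : ∀ k, 1 ≤ k → ∀ y ∈ S, r' k y = r k y) : IsNegligibleOn S r' := fun N => by
  obtain ⟨C, hC⟩ := h N
  exact ⟨C, fun k hk y hy => (congrArg norm (he k hk y hy)).trans_le (hC k hk y hy)⟩

lemma isNegligibleOn_zero (S : Set Plane) : IsNegligibleOn S (fun _ _ => 0) :=
  fun _ => ⟨0, fun _ _ _ _ => by simp⟩

lemma IsNegligibleOn.add {S : Set Plane} {r r' : ℕ → Plane → ℂ} (h : IsNegligibleOn S r)
    (h' : IsNegligibleOn S r') : IsNegligibleOn S (fun k y => r k y + r' k y) := fun N => by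
  obtain ⟨C, hC⟩ := h N
  obtain ⟨C', hC'⟩ := h' N
  refine ⟨C + C', fun k hk y hy => ?_⟩
  rw [add_mul]
  exact (norm_add_le _ _).trans (add_le_add (hC k hk y hy) (hC' k hk y hy))

lemma IsNegligibleOn.sum {ι : Type*} (s : Finset ι) {S : Set Plane} {r : ι → ℕ → Plane → ℂ}
    (h : ∀ i ∈ s, IsNegligibleOn S (r i)) : IsNegligibleOn S (fun k y => ∑ i ∈ s, r i k y) := by
  classical
  induction s using Finset.induction_on with
  | empty => simpa using isNegligibleOn_zero S
  | insert i s hi ih =>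
    simp only [Finset.sum_insert hi]
    exact (h i (Finset.mem_insert_self i s)).add (ih fun j hj => h j (Finset.mem_insert_of_mem hj))

lemma IsNegligibleOn.mul_left {S : Set Plane} {r s : ℕ → Plane → ℂ} (h : IsNegligibleOn S r)
    (M : ℕ) (B : ℝ) (hs : ∀ k : ℕ, 1 ≤ k → ∀ y ∈ S, ‖s k y‖ ≤ B * (k : ℝ) ^ M) :
    IsNegligibleOn S (fun k y => s k y * r k y) := fun N => by
  obtain ⟨C, hC⟩ := h (N + M)
  refine ⟨B * C, fun k hk y hy => ?_⟩
  have hk0 : (0 : ℝ) < k := by exact_mod_cast hk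
  rw [norm_mul]
  calc _ ≤ B * (k : ℝ) ^ M * (C * ((k : ℝ) ^ (N + M))⁻¹) :=
        mul_le_mul (hs k hk y hy) (hC k hk y hy) (norm_nonneg _) ((norm_nonneg _).trans (hs k hk y hy))
    _ = _ := by rw [pow_add]; field_simp

/-! ### Local form of Gaussian sums -/

lemma HolExp.mono {B B' : Set ℂ} {f F : ℕ → ℂ → ℂ} (h : HolExp B f F) (hB : B' ⊆ B) :
    HolExp B' f F :=
  ⟨fun k hk => (h.differentiableOn k hk).mono hB, fun l => (h.differentiableOn_coeff l).mono hB,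
    fun L => by
      obtain ⟨C, hC, hb⟩ := h.bound L
      exact ⟨C, hC, fun k hk z hz => hb k hk z (hB hz)⟩⟩

/-- A Gaussian sum whose coefficients sample `b` is an exponential times a holomorphic function with an
expansion starting with `b` when its frequency is near `0`, and negligible when its frequency is away
from the integers. -/
lemma IsSampled.exists_expansion {a : ℕ → ℤ → ℂ} {b : ℂ → ℂ} {x₀ r : ℝ} {M : ℕ}
    (h : IsSampled a b x₀ r M) {c : ℂ} (hc : 0 < c.re) : ∃ (B : Set ℂ) (ρ : ℝ) (f F : ℕ → ℂ → ℂ),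
      IsOpen B ∧ 0 < ρ ∧ HolExp B f F ∧ F 0 = b ∧
      (∀ P Q : ℝ, |P - x₀| < ρ → |Q| < ρ → (P : ℂ) + 2 * Real.pi * Complex.I * Q / c ∈ B) ∧
      (∀ L : ℕ, ∃ C : ℝ, 0 < C ∧ ∀ k : ℕ, 1 ≤ k → ∀ P Q : ℝ, |P - x₀| < ρ → |Q| < ρ →
        ‖gaussSum a c k P Q - 2 * (Real.sqrt k : ℝ) * gaussMass c * leadingExp c k P Q *
          f k (P + 2 * Real.pi * Complex.I * Q / c)‖ ≤ C * ((k : ℝ) ^ L)⁻¹) ∧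
      ∀ d : ℝ, 0 < d → ∀ L : ℕ, ∃ C : ℝ, 0 < C ∧ ∀ k : ℕ, 1 ≤ k → ∀ P Q : ℝ, |P - x₀| < ρ →
        (∀ n : ℤ, d ≤ |n - Q|) → ‖gaussSum a c k P Q‖ ≤ C * ((k : ℝ) ^ L)⁻¹ := by
  obtain ⟨ε, ρ, hε, hr, hρ, hball, hle⟩ := h.exists_gaussSum_sub_le hc
  obtain ⟨ρ', hρ', hle'⟩ := h.exists_gaussSum_le hc
  obtain ⟨F, hF, hF0⟩ := exists_holExp_localAverage hε hr h.differentiableOn hc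
  refine ⟨_, min ρ ρ', _, F, Metric.isOpen_ball, lt_min hρ hρ', hF, hF0, fun P Q hP hQ =>
    hball P Q (hP.trans_le (min_le_left _ _)) (hQ.trans_le (min_le_left _ _)), fun L => ?_,
    fun d hd L => ?_⟩
  · obtain ⟨C, hC, hb⟩ := hle L
    exact ⟨C, hC, fun k hk P Q hP hQ => hb k hk P Q (hP.trans_le (min_le_left _ _))
      (hQ.trans_le (min_le_left _ _))⟩
  · obtain ⟨C, hC, hb⟩ := hle' d hd L
    exact ⟨C, hC, fun k hk P Q hP hQ => hb k hk P Q (hP.trans_le (min_le_right _ _)) hQ⟩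

lemma leadingExp_pow (c : ℂ) (k : ℕ) (P Q : ℝ) : leadingExp c k P Q = leadingExp c 1 P Q ^ k := by
  rw [leadingExp, leadingExp, ← Complex.exp_nat_mul]
  congr 1
  push_cast
  ring

lemma norm_leadingExp_lt_one {c : ℂ} (hc : 0 < c.re) (P : ℝ) {Q : ℝ} (hQ : Q ≠ 0) :
    ‖leadingExp c 1 P Q‖ < 1 := by
  have := inv_re_pos hc
  have hpi := Real.pi_pos
  rw [norm_leadingExp, Real.exp_lt_one_iff]
  have h : 0 < 4 * Real.pi ^ 2 * (1 / c).re * ((1 : ℕ) : ℝ) * Q ^ 2 := by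
    have : 0 < Q ^ 2 := by positivity
    push_cast
    positivity
  linarith

lemma norm_exp_two_pi_I_mul (x : ℝ) : ‖Complex.exp (2 * Real.pi * Complex.I * x)‖ = 1 := by
  simpa using norm_exp_two_pi_mul 1 x

/-! ### The state as a Gaussian sum in the position representation -/

/-- The quadratic coefficient of the Gaussian sum giving the state. -/
noncomputable def positionCoeff (τ : ℂ) : ℂ := -(2 * Real.pi * Complex.I * τ)

lemma positionCoeff_re_pos {τ : ℂ} (hτ : 0 < τ.im) : 0 < (positionCoeff τ).re := by
  have : (positionCoeff τ).re = 2 * Real.pi * τ.im := by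
    rw [positionCoeff, show -(2 * Real.pi * Complex.I * τ) = ((2 * Real.pi : ℝ) : ℂ) * (-(Complex.I * τ)) by
      push_cast; ring, Complex.re_ofReal_mul]
    simp
  rw [this]
  have := Real.pi_pos
  positivity

lemma coeffZ_neg (g k : ℕ) (n : ℤ) : coeffZ g k (-n) = -coeffZ g k n := by
  rw [coeffZ, coeffZ, sineSum_neg]
  ring

lemma gaussZ_eq_gaussSum (g : ℕ) (τ : ℂ) {k : ℕ} (hk : 1 ≤ k) (y : Plane) :
    gaussZ g τ k y = -(Complex.exp (2 * Real.pi * Complex.I * (y.1 * y.2 : ℝ)) ^ k *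
      gaussSum (fun k N => (coeffZ g k N : ℂ)) (positionCoeff τ) k y.2 (-y.1)) := by
  have hk0 : (k : ℂ) ≠ 0 := by exact_mod_cast (by omega : k ≠ 0)
  rw [gaussZ, ← (Equiv.neg ℤ).tsum_eq, gaussSum, ← tsum_mul_left, ← tsum_neg]
  refine tsum_congr fun N => ?_
  rw [Equiv.neg_apply, coeffZ_neg, Complex.ofReal_neg, neg_mul, neg_inj, mul_left_comm]
  congr 1
  rw [thetaTerm, gaussTerm, positionCoeff, ← Complex.exp_nat_mul, ← Complex.exp_add]
  congr 1
  push_cast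
  field_simp
  ring

/-- The periodic extension of the values at `l / k` of a polynomial. -/
noncomputable def periodicCoeff (p : Polynomial ℝ) (k : ℕ) (N : ℤ) : ℂ :=
  ((p.eval (2 * Int.fract ((N : ℝ) / (2 * k))) : ℝ) : ℂ)

/-- The coefficients are defined for colours of all parities, but those of even colours vanish: no
colouring is admissible then. The polynomials are therefore multiplied by `(1 - (-1) ^ N) / 2`. -/
lemma coeffZ_eq_sum {g : ℕ} {P : Fin g → Polynomial ℝ}
    (hP : ∀ k i : ℕ, i < k → ((k : ℝ) / 2) ^ (g - 1) * sineSum (2 * g - 1) k (2 * i + 1)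
        = ((k : ℝ) / (2 * Real.pi)) ^ (3 * g - 2) *
          ∑ m : Fin g, ((k : ℝ) ^ (2 * (m : ℕ)))⁻¹ * (P m).eval ((2 * i + 1 : ℝ) / k))
    {k : ℕ} (hk : 1 ≤ k) (N : ℤ) :
    (coeffZ g k N : ℂ) = (((k : ℝ) / (2 * Real.pi)) ^ (3 * g - 2) : ℝ) *
      ∑ m : Fin g, ((k : ℂ) ^ (2 * (m : ℕ)))⁻¹ * ((1 - (-1) ^ N) / 2 * periodicCoeff (P m) k N) := by
  have hk0 : (0 : ℝ) < k := by exact_mod_cast hk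
  rcases Int.even_or_odd N with hN | hN
  · rw [coeffZ, sineSum_even _ _ _ hN, hN.neg_one_zpow]
    simp
  · set r := N % (2 * k) with hr
    have hr0 : 0 ≤ r := Int.emod_nonneg _ (by omega)
    have hr1 : r < 2 * k := Int.emod_lt_of_pos _ (by omega)
    have hdiv := Int.emod_add_mul_ediv N (2 * k)
    have hro : Odd r := by
      rcases hN with ⟨j, hj⟩
      refine ⟨j - k * (N / (2 * k)), ?_⟩
      rw [← hr] at hdiv
      linear_combination hdiv + hj
    obtain ⟨i, hi⟩ := hro
    lift i to ℕ using by omega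
    have hik : i < k := by omega
    have hNr : N = (2 * i + 1) + 2 * k * (N / (2 * k)) := by rw [← hr, hi] at hdiv; linarith
    have hfr : 2 * Int.fract ((N : ℝ) / (2 * k)) = (2 * i + 1 : ℝ) / k := by
      have hi' : ((2 * i + 1 : ℤ) : ℝ) < 2 * k := by exact_mod_cast hi ▸ hr1
      push_cast at hi'
      have e : Int.fract ((N : ℝ) / (2 * k)) = (2 * i + 1 : ℝ) / (2 * k) := by
        rw [Int.fract_eq_iff]
        refine ⟨by positivity, by rw [div_lt_one (by positivity)]; exact hi', N / (2 * k), ?_⟩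
        have : (N : ℝ) = (2 * i + 1) + 2 * k * ((N / (2 * k) : ℤ) : ℝ) := by exact_mod_cast hNr
        rw [div_sub_div_same, div_eq_iff (by positivity)]
        linarith
      rw [e]
      field_simp
    have hc : coeffZ g k N = coeffZ g k (2 * i + 1) := by
      conv_lhs => rw [hNr]
      exact coeffZ_add_period g k _ _
    have h2 := hP k i hik
    rw [hc, coeffZ, h2, hN.neg_one_zpow]
    simp only [periodicCoeff, hfr]
    push_cast
    congr 1
    refine Finset.sum_congr rfl fun m _ => ?_
    norm_num

lemma gaussTerm_add_half (c : ℂ) (k : ℕ) (P Q : ℝ) (N : ℤ) :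
    gaussTerm c k P (Q + 1 / 2) N = (-1) ^ N * gaussTerm c k P Q N := by
  rw [← Complex.exp_pi_mul_I, ← Complex.exp_int_mul, gaussTerm, gaussTerm, ← Complex.exp_add]
  congr 1
  push_cast
  ring

lemma exists_norm_periodicCoeff_le (p : Polynomial ℝ) : ∃ C : ℝ, 0 < C ∧ ∀ (k : ℕ) (N : ℤ),
    ‖periodicCoeff p k N‖ ≤ C := by
  obtain ⟨C, hC⟩ := isCompact_Icc.exists_bound_of_continuousOn (s := Set.Icc (0 : ℝ) 2)
    (f := fun x => p.eval x) p.continuous.continuousOn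
  refine ⟨max C 1, lt_of_lt_of_le one_pos (le_max_right _ _), fun k N => ?_⟩
  rw [periodicCoeff, Complex.norm_real]
  refine (hC _ ⟨?_, ?_⟩).trans (le_max_left _ _)
  · linarith [Int.fract_nonneg ((N : ℝ) / (2 * k))]
  · linarith [Int.fract_lt_one ((N : ℝ) / (2 * k))]

/-- The sign `(-1) ^ N` in the coefficients shifts the frequency by one half. -/
lemma gaussSum_coeffZ {g : ℕ} {P : Fin g → Polynomial ℝ}
    (hP : ∀ k i : ℕ, i < k → ((k : ℝ) / 2) ^ (g - 1) * sineSum (2 * g - 1) k (2 * i + 1)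
        = ((k : ℝ) / (2 * Real.pi)) ^ (3 * g - 2) *
          ∑ m : Fin g, ((k : ℝ) ^ (2 * (m : ℕ)))⁻¹ * (P m).eval ((2 * i + 1 : ℝ) / k))
    {c : ℂ} (hc : 0 < c.re) {k : ℕ} (hk : 1 ≤ k) (x Q : ℝ) :
    gaussSum (fun k N => (coeffZ g k N : ℂ)) c k x Q
      = (((k : ℝ) / (2 * Real.pi)) ^ (3 * g - 2) : ℝ) / 2 * ∑ m : Fin g, ((k : ℂ) ^ (2 * (m : ℕ)))⁻¹ *
        (gaussSum (periodicCoeff (P m)) c k x Q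
          - gaussSum (periodicCoeff (P m)) c k x (Q + 1 / 2)) := by
  have hs : ∀ (m : Fin g) (Q : ℝ), Summable fun N : ℤ => periodicCoeff (P m) k N * gaussTerm c k x Q N := by
    intro m Q
    obtain ⟨C, -, hC⟩ := exists_norm_periodicCoeff_le (P m)
    exact summable_mul_gaussTerm hc hk x Q fun N => hC k N
  have hd : ∀ m : Fin g, gaussSum (periodicCoeff (P m)) c k x Q
      - gaussSum (periodicCoeff (P m)) c k x (Q + 1 / 2)
      = ∑' N : ℤ, (1 - (-1) ^ N) * periodicCoeff (P m) k N * gaussTerm c k x Q N := by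
    intro m
    rw [gaussSum, gaussSum, ← (hs m Q).tsum_sub (hs m _)]
    refine tsum_congr fun N => ?_
    rw [gaussTerm_add_half]
    ring
  have hsd : ∀ m : Fin g, Summable fun N : ℤ =>
      (1 - (-1) ^ N) * periodicCoeff (P m) k N * gaussTerm c k x Q N := by
    intro m
    refine ((hs m Q).sub (hs m (Q + 1 / 2))).congr fun N => ?_
    rw [gaussTerm_add_half]
    ring
  simp only [hd, ← tsum_mul_left]
  rw [← Summable.tsum_finsetSum fun m _ => (hsd m).mul_left _, ← tsum_mul_left, gaussSum]
  refine tsum_congr fun N => ?_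
  rw [coeffZ_eq_sum hP hk N, Finset.mul_sum, Finset.mul_sum, Finset.sum_mul]
  refine Finset.sum_congr rfl fun m _ => ?_
  ring

/-! ### The state near the circles of `A₂` -/

lemma floor_eq_of_abs_sub_lt {x x₀ : ℝ} (h : |x - x₀| < min (Int.fract x₀) (1 - Int.fract x₀)) :
    ⌊x⌋ = ⌊x₀⌋ := by
  have h1 := (abs_lt.1 h).1
  have h2 := (abs_lt.1 h).2
  have h3 := min_le_left (Int.fract x₀) (1 - Int.fract x₀)
  have h4 := min_le_right (Int.fract x₀) (1 - Int.fract x₀)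
  have h5 := Int.self_sub_floor x₀
  rw [Int.floor_eq_iff]
  constructor <;> linarith

lemma isSampled_periodicCoeff (p : Polynomial ℝ) {x₀ : ℝ} (hx₀ : ∀ n : ℤ, x₀ ≠ n) : ∃ r : ℝ,
    IsSampled (periodicCoeff p)
      (fun z => (p.map Complex.ofRealHom).eval (2 * (z - (⌊x₀⌋ : ℂ)))) x₀ r 0 := by
  have h0 : 0 < Int.fract x₀ := by
    refine lt_of_le_of_ne (Int.fract_nonneg _) fun h => hx₀ ⌊x₀⌋ ?_
    rw [Int.fract] at h
    linarith
  refine ⟨min (Int.fract x₀) (1 - Int.fract x₀), lt_min h0 (by linarith [Int.fract_lt_one x₀]), ?_, ?_,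
    fun k hk N hN => ?_⟩
  · exact ((p.map Complex.ofRealHom).differentiable.comp (by fun_prop)).differentiableOn
  · obtain ⟨C, hC, hb⟩ := exists_norm_periodicCoeff_le p
    exact ⟨C, hC, fun k _ N => by simpa using hb k N⟩
  · rw [periodicCoeff, Int.fract, floor_eq_of_abs_sub_lt hN]
    have := Polynomial.eval_map_apply (p := p) Complex.ofRealHom
      (2 * ((N : ℝ) / (2 * k) - (⌊x₀⌋ : ℝ)))
    simp only [Complex.ofRealHom_eq_coe] at this
    rw [← this]
    push_cast
    rfl

/-- Both circles of `A₂` can be treated at once: moving by `m / 2` in the direction of `μ` exchanges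
the two Gaussian sums up to the sign `(-1) ^ m`. -/
lemma gaussSum_sub_half (a : ℕ → ℤ → ℂ) (c : ℂ) (k : ℕ) (P p : ℝ) (m : ℤ) :
    gaussSum a c k P (-p) - gaussSum a c k P (-p + 1 / 2)
      = (-1) ^ m * (gaussSum a c k P (m / 2 - p) - gaussSum a c k P (m / 2 - p + 1 / 2)) := by
  rcases Int.even_or_odd' m with ⟨n, rfl | rfl⟩
  · rw [(even_two_mul n).neg_one_zpow, one_mul, ← gaussSum_sub_int a c k P ((2 * n : ℤ) / 2 - p) n,
      ← gaussSum_sub_int a c k P ((2 * n : ℤ) / 2 - p + 1 / 2) n]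
    push_cast
    congr 2 <;> ring
  · rw [(odd_two_mul_add_one n).neg_one_zpow,
      ← gaussSum_sub_int a c k P ((2 * n + 1 : ℤ) / 2 - p) n,
      ← gaussSum_sub_int a c k P ((2 * n + 1 : ℤ) / 2 - p + 1 / 2) (n + 1)]
    push_cast
    rw [show (2 * (n : ℝ) + 1) / 2 - p - n = -p + 1 / 2 by ring,
      show (2 * (n : ℝ) + 1) / 2 - p + 1 / 2 - (n + 1) = -p by ring]
    ring

lemma quarter_le_abs_sub_half {Q : ℝ} (hQ : |Q| < 1 / 4) (n : ℤ) : 1 / 4 ≤ |(n : ℝ) - (Q + 1 / 2)| := by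
  rw [abs_lt] at hQ
  rcases le_or_gt n 0 with h | h
  · have : (n : ℝ) ≤ 0 := by exact_mod_cast h
    rw [abs_of_nonpos (by linarith)]
    linarith
  · have : (1 : ℝ) ≤ n := by exact_mod_cast h
    rw [abs_of_nonneg (by linarith)]
    linarith

lemma rpow_mul_sqrt {g : ℕ} (hg : 1 ≤ g) {k : ℕ} (hk : 1 ≤ k) :
    ((k : ℝ) / (2 * Real.pi)) ^ (3 * g - 2) * Real.sqrt k
      = ((k : ℝ) / (2 * Real.pi)) ^ (3 * (g : ℝ) - 3 / 2) * Real.sqrt (2 * Real.pi) := by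
  have hk0 : (0 : ℝ) < k := by exact_mod_cast hk
  have hpi := Real.pi_pos
  have hx : 0 < (k : ℝ) / (2 * Real.pi) := by positivity
  have h1 : Real.sqrt k = ((k : ℝ) / (2 * Real.pi)) ^ (1 / 2 : ℝ) * Real.sqrt (2 * Real.pi) := by
    rw [← Real.sqrt_eq_rpow, ← Real.sqrt_mul hx.le]
    congr 1
    field_simp
  have h2 : ((3 * g - 2 : ℕ) : ℝ) = 3 * g - 2 := by
    rw [Nat.cast_sub (by omega)]
    push_cast
    ring
  rw [h1, ← mul_assoc, ← Real.rpow_natCast, ← Real.rpow_add hx, h2]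
  congr 2
  ring

/-- The section of `L_E`, equal to the flat section along the line `p = m / 2`, that carries the
oscillations of the state near this line. -/
noncomputable def positionPhase (τ : ℂ) (m : ℤ) (y : Plane) : ℂ :=
  Complex.exp (2 * Real.pi * Complex.I * (y.1 * y.2 : ℝ)) *
    leadingExp (positionCoeff τ) 1 y.2 (m / 2 - y.1)

/-- The state near a point of the line `p = m / 2`. -/
lemma exists_local_form_position {g : ℕ} (hg : 1 ≤ g) {P : Fin g → Polynomial ℝ}
    (hP : ∀ k i : ℕ, i < k → ((k : ℝ) / 2) ^ (g - 1) * sineSum (2 * g - 1) k (2 * i + 1)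
        = ((k : ℝ) / (2 * Real.pi)) ^ (3 * g - 2) *
          ∑ m : Fin g, ((k : ℝ) ^ (2 * (m : ℕ)))⁻¹ * (P m).eval ((2 * i + 1 : ℝ) / k))
    {τ : ℂ} (hτ : 0 < τ.im) (m₀ : ℤ) {q₀ : ℝ} (hq₀ : ∀ n : ℤ, q₀ ≠ n) :
    ∃ (V : Set Plane) (f F : ℕ → Plane → ℂ), IsOpen V ∧ ((m₀ : ℝ) / 2, q₀) ∈ V ∧
      HasSmoothExpansion V f F ∧
      (∀ y ∈ V, y.1 = m₀ / 2 → F 0 y = -((-1) ^ m₀ * (Real.sqrt (2 * Real.pi) : ℝ) *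
        gaussMass (positionCoeff τ)) * (((P ⟨0, hg⟩).eval (2 * Int.fract y.2) : ℝ) : ℂ)) ∧
      IsNegligibleOn V (fun k y => gaussZ g τ k y -
        ((((k : ℝ) / (2 * Real.pi)) ^ (3 * (g : ℝ) - 3 / 2) : ℝ) : ℂ) *
          positionPhase τ m₀ y ^ k * f k y) := by
  set c := positionCoeff τ with hc_def
  have hc : 0 < c.re := positionCoeff_re_pos hτ
  choose r hr using fun m : Fin g => isSampled_periodicCoeff (P m) hq₀
  choose B ρ f F hB hρ hf hF0 hball hmain hneg using fun m : Fin g => (hr m).exists_expansion hc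
  choose F' hF' hF'0 using fun m : Fin g => (hf m).exists_inv_pow_mul (2 * (m : ℕ))
  set κ : ℂ := -((-1) ^ m₀ * (Real.sqrt (2 * Real.pi) : ℝ) * gaussMass c) with hκ
  set V : Set Plane := (⋂ m : Fin g, {y : Plane | |y.2 - q₀| < ρ m ∧ |(m₀ : ℝ) / 2 - y.1| < ρ m}) ∩
    {y : Plane | |(m₀ : ℝ) / 2 - y.1| < 1 / 4 ∧ (⌊q₀⌋ : ℝ) < y.2 ∧ y.2 < ⌊q₀⌋ + 1} with hV
  have hVo : IsOpen V := by
    refine (isOpen_iInter_of_finite fun m => ?_).inter ?_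
    · exact (isOpen_lt (by fun_prop : Continuous fun y : Plane => |y.2 - q₀|) continuous_const).inter
        (isOpen_lt (by fun_prop : Continuous fun y : Plane => |(m₀ : ℝ) / 2 - y.1|) continuous_const)
    · exact (isOpen_lt (by fun_prop : Continuous fun y : Plane => |(m₀ : ℝ) / 2 - y.1|)
        continuous_const).inter
          ((isOpen_lt continuous_const continuous_snd).inter (isOpen_lt continuous_snd continuous_const))
  have hx₀ : ((m₀ : ℝ) / 2, q₀) ∈ V := by
    refine ⟨Set.mem_iInter.2 fun m => ⟨by simpa using hρ m, by simpa using hρ m⟩, by simp, ?_,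
      Int.lt_floor_add_one q₀⟩
    exact lt_of_le_of_ne (Int.floor_le q₀) fun h => hq₀ _ h.symm
  set z : Plane → ℂ := fun y => y.2 + 2 * Real.pi * Complex.I * ((m₀ / 2 - y.1 : ℝ) : ℂ) / c with hz
  set ℓ : Plane →L[ℝ] ℂ := Complex.ofRealCLM.comp (ContinuousLinearMap.snd ℝ ℝ ℝ)
    + (-(2 * Real.pi * Complex.I / c)) • Complex.ofRealCLM.comp (ContinuousLinearMap.fst ℝ ℝ ℝ) with hℓ
  set w : ℂ := 2 * Real.pi * Complex.I * (m₀ / 2) / c with hw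
  have hzℓ : ∀ y, ℓ y + w = z y := by
    intro y
    simp only [hℓ, hw, hz, add_apply, ContinuousLinearMap.comp_apply,
      ContinuousLinearMap.coe_snd', ContinuousLinearMap.coe_fst', smul_apply,
      Complex.ofRealCLM_apply, smul_eq_mul]
    push_cast
    ring
  have hmem : ∀ y ∈ V, ∀ m : Fin g, |y.2 - q₀| < ρ m ∧ |(m₀ : ℝ) / 2 - y.1| < ρ m :=
    fun y hy m => Set.mem_iInter.1 hy.1 m
  have hzB : ∀ y ∈ V, z y ∈ ⋂ m, B m := fun y hy =>
    Set.mem_iInter.2 fun m => hball m _ _ (hmem y hy m).1 (hmem y hy m).2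
  have hexp : HolExp (⋂ m, B m)
      (fun k z => κ * ∑ m : Fin g, ((k : ℂ) ^ (2 * (m : ℕ)))⁻¹ * f m k z)
      (fun l z => κ * ∑ m : Fin g, F' m l z) :=
    (HolExp.sum Finset.univ fun m _ => (hF' m).mono (Set.iInter_subset _ m)).const_mul κ
  refine ⟨V, fun k y => κ * ∑ m : Fin g, ((k : ℂ) ^ (2 * (m : ℕ)))⁻¹ * f m k (z y),
    fun l y => κ * ∑ m : Fin g, F' m l (z y), hVo, hx₀, ?_, fun y hy hy1 => ?_, ?_⟩
  · have := hexp.hasSmoothExpansion (isOpen_iInter_of_finite hB) ℓ w (V := V)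
      (fun y hy => by rw [hzℓ]; exact hzB y hy)
    simpa only [hzℓ] using this
  · simp only [hF'0]
    congr 1
    rw [Finset.sum_eq_single ⟨0, hg⟩]
    · rw [if_pos (by simp), hF0]
      have hzy : z y = ((y.2 : ℝ) : ℂ) := by simp [hz, hy1]
      have hfl : ⌊y.2⌋ = ⌊q₀⌋ := Int.floor_eq_iff.2 ⟨hy.2.2.1.le, hy.2.2.2⟩
      have h2 : (2 * (z y - (⌊q₀⌋ : ℂ))) = ((2 * Int.fract y.2 : ℝ) : ℂ) := by
        rw [Int.fract, hfl, hzy]; push_cast; ring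
      beta_reduce
      rw [h2]
      have := Polynomial.eval_map_apply (p := P ⟨0, hg⟩) Complex.ofRealHom (2 * Int.fract y.2)
      simpa only [Complex.ofRealHom_eq_coe] using this
    · intro m _ hm
      have : (m : ℕ) ≠ 0 := fun h => hm (Fin.ext h)
      rw [if_neg (by omega)]
    · simp
  · -- each polynomial contributes a leading part, up to a negligible term
    have hm : ∀ m : Fin g, IsNegligibleOn V (fun k y =>
        (gaussSum (periodicCoeff (P m)) c k y.2 (-y.1)
          - gaussSum (periodicCoeff (P m)) c k y.2 (-y.1 + 1 / 2))
        - (-1) ^ m₀ * (2 * (Real.sqrt k : ℝ) * gaussMass c * leadingExp c k y.2 (m₀ / 2 - y.1) *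
            f m k (z y))) := by
      intro m L
      obtain ⟨C₁, hC₁, h1⟩ := hmain m L
      obtain ⟨C₂, hC₂, h2⟩ := hneg m (1 / 4) (by norm_num) L
      refine ⟨C₁ + C₂, fun k hk y hy => ?_⟩
      obtain ⟨hy1, hy2⟩ := hmem y hy m
      beta_reduce
      rw [gaussSum_sub_half _ _ _ _ _ m₀, ← mul_sub, norm_mul, norm_zpow, norm_neg, norm_one, one_zpow,
        one_mul, sub_right_comm, add_mul]
      exact (norm_sub_le _ _).trans (add_le_add (h1 k hk _ _ hy1 hy2)
        (h2 k hk _ _ hy1 (quarter_le_abs_sub_half hy.2.1)))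
    have hpi := Real.pi_pos
    have hsum : IsNegligibleOn V (fun k y => ∑ m : Fin g, ((k : ℂ) ^ (2 * (m : ℕ)))⁻¹ *
        ((gaussSum (periodicCoeff (P m)) c k y.2 (-y.1)
          - gaussSum (periodicCoeff (P m)) c k y.2 (-y.1 + 1 / 2))
        - (-1) ^ m₀ * (2 * (Real.sqrt k : ℝ) * gaussMass c * leadingExp c k y.2 (m₀ / 2 - y.1) *
            f m k (z y)))) := by
      refine IsNegligibleOn.sum _ fun m _ => (hm m).mul_left 0 1 fun k hk y _ => ?_
      have hk1 : (1 : ℝ) ≤ k := by exact_mod_cast hk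
      rw [norm_inv, norm_pow, Complex.norm_natCast, pow_zero, mul_one]
      exact inv_le_one_of_one_le₀ (one_le_pow₀ hk1)
    refine ((hsum.mul_left (s := fun k y => -(Complex.exp (2 * Real.pi * Complex.I * (y.1 * y.2 : ℝ)) ^ k *
      ((((k : ℝ) / (2 * Real.pi)) ^ (3 * g - 2) : ℝ) / 2)))
      (3 * g - 2) (1 / (2 * Real.pi) ^ (3 * g - 2)) fun k hk y _ => ?_)).congr
      fun k hk y hy => ?_
    · rw [norm_neg, norm_mul, norm_pow, norm_exp_two_pi_I_mul, one_pow, one_mul, norm_div,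
        Complex.norm_real, Real.norm_of_nonneg (by positivity), Complex.norm_ofNat, div_pow]
      have : 0 ≤ (k : ℝ) ^ (3 * g - 2) / (2 * Real.pi) ^ (3 * g - 2) := by positivity
      calc _ ≤ (k : ℝ) ^ (3 * g - 2) / (2 * Real.pi) ^ (3 * g - 2) := by linarith
        _ = _ := by ring
    · have hrp := rpow_mul_sqrt hg hk
      have hrp' : ((((k : ℝ) / (2 * Real.pi)) ^ (3 * g - 2) : ℝ) : ℂ) * ((Real.sqrt k : ℝ) : ℂ)
          = ((((k : ℝ) / (2 * Real.pi)) ^ (3 * (g : ℝ) - 3 / 2) : ℝ) : ℂ)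
            * ((Real.sqrt (2 * Real.pi) : ℝ) : ℂ) := by
        exact_mod_cast congrArg (fun x : ℝ => (x : ℂ)) hrp
      rw [gaussZ_eq_gaussSum g τ hk, gaussSum_coeffZ hP hc hk, positionPhase, mul_pow,
        ← leadingExp_pow, hκ]
      simp only [mul_sub (((k : ℂ) ^ (2 * _))⁻¹), Finset.sum_sub_distrib]
      have hfs : ∑ m : Fin g, ((k : ℂ) ^ (2 * (m : ℕ)))⁻¹ * ((-1) ^ m₀ * (2 * (Real.sqrt k : ℝ) *
          gaussMass c * leadingExp c k y.2 (m₀ / 2 - y.1) * f m k (z y)))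
          = (-1) ^ m₀ * (2 * (Real.sqrt k : ℝ) * gaussMass c * leadingExp c k y.2 (m₀ / 2 - y.1)) *
            ∑ m : Fin g, ((k : ℂ) ^ (2 * (m : ℕ)))⁻¹ * f m k (z y) := by
        rw [Finset.mul_sum]
        exact Finset.sum_congr rfl fun m _ => by ring
      rw [hfs]
      linear_combination (-(Complex.exp (2 * Real.pi * Complex.I * (y.1 * y.2 : ℝ)) ^ k * (-1) ^ m₀ *
        gaussMass c * leadingExp c k y.2 (m₀ / 2 - y.1) *
          ∑ m : Fin g, ((k : ℂ) ^ (2 * (m : ℕ)))⁻¹ * f m k (z y))) * hrp'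

/-- The state is negligible away from the circles of `A₁` and `A₂`. -/
lemma exists_isNegligibleOn_position {g : ℕ} {P : Fin g → Polynomial ℝ}
    (hP : ∀ k i : ℕ, i < k → ((k : ℝ) / 2) ^ (g - 1) * sineSum (2 * g - 1) k (2 * i + 1)
        = ((k : ℝ) / (2 * Real.pi)) ^ (3 * g - 2) *
          ∑ m : Fin g, ((k : ℝ) ^ (2 * (m : ℕ)))⁻¹ * (P m).eval ((2 * i + 1 : ℝ) / k))
    {τ : ℂ} (hτ : 0 < τ.im) {x : Plane} (hx1 : ∀ m : ℤ, 2 * x.1 ≠ m) (hx2 : ∀ n : ℤ, x.2 ≠ n) :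
    ∃ V : Set Plane, IsOpen V ∧ x ∈ V ∧ IsNegligibleOn V (gaussZ g τ) := by
  set c := positionCoeff τ with hc_def
  have hc : 0 < c.re := positionCoeff_re_pos hτ
  choose r hr using fun m : Fin g => isSampled_periodicCoeff (P m) hx2
  choose ρ hρ hneg using fun m : Fin g => (hr m).exists_gaussSum_le hc
  set d := min (Int.fract (2 * x.1)) (1 - Int.fract (2 * x.1)) / 4 with hd
  have hfl : 0 < Int.fract (2 * x.1) := by
    refine lt_of_le_of_ne (Int.fract_nonneg _) fun h => hx1 ⌊2 * x.1⌋ ?_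
    rw [Int.fract] at h
    linarith
  have hd0 : 0 < d := by
    have : 0 < 1 - Int.fract (2 * x.1) := by linarith [Int.fract_lt_one (2 * x.1)]
    positivity
  -- the frequencies stay at distance at least `d` from the half-integers
  have hdist : ∀ y : Plane, |y.1 - x.1| < d → ∀ m : ℤ, 2 * d ≤ |(m : ℝ) - 2 * y.1| := by
    intro y hy m
    have h1 := min_le_left (Int.fract (2 * x.1)) (1 - Int.fract (2 * x.1))
    have h2 := min_le_right (Int.fract (2 * x.1)) (1 - Int.fract (2 * x.1))
    have h3 := Int.self_sub_floor (2 * x.1)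
    rw [abs_lt] at hy
    rcases le_or_gt m ⌊2 * x.1⌋ with h | h
    · have : (m : ℝ) ≤ ⌊2 * x.1⌋ := by exact_mod_cast h
      rw [abs_of_nonpos (by linarith)]
      linarith
    · have : (⌊2 * x.1⌋ : ℝ) + 1 ≤ m := by exact_mod_cast h
      rw [abs_of_nonneg (by linarith)]
      linarith
  set V : Set Plane := (⋂ m : Fin g, {y : Plane | |y.2 - x.2| < ρ m}) ∩ {y : Plane | |y.1 - x.1| < d}
    with hV
  have hVo : IsOpen V := (isOpen_iInter_of_finite fun m =>
    isOpen_lt (by fun_prop) continuous_const).inter (isOpen_lt (by fun_prop) continuous_const)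
  refine ⟨V, hVo, ⟨Set.mem_iInter.2 fun m => by simpa using hρ m, by simpa using hd0⟩, ?_⟩
  have hm : ∀ m : Fin g, IsNegligibleOn V (fun k y =>
      gaussSum (periodicCoeff (P m)) c k y.2 (-y.1)
        - gaussSum (periodicCoeff (P m)) c k y.2 (-y.1 + 1 / 2)) := by
    intro m L
    obtain ⟨C, hC, h⟩ := hneg m d hd0 L
    refine ⟨C + C, fun k hk y hy => ?_⟩
    have hy1 := Set.mem_iInter.1 hy.1 m
    have hy2 := hdist y hy.2
    rw [add_mul]
    refine (norm_sub_le _ _).trans (add_le_add (h k hk _ _ hy1 fun n => ?_) (h k hk _ _ hy1 fun n => ?_))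
    · have := hy2 (-2 * n)
      rw [show (((-2 * n : ℤ) : ℝ)) - 2 * y.1 = -2 * (n - -y.1) by push_cast; ring, abs_mul] at this
      norm_num at this ⊢
      linarith
    · have := hy2 (-2 * n + 1)
      rw [show (((-2 * n + 1 : ℤ) : ℝ)) - 2 * y.1 = -2 * (n - (-y.1 + 1 / 2)) by push_cast; ring,
        abs_mul] at this
      norm_num at this ⊢
      linarith
  have hsum : IsNegligibleOn V (fun k y => ∑ m : Fin g, ((k : ℂ) ^ (2 * (m : ℕ)))⁻¹ *
      (gaussSum (periodicCoeff (P m)) c k y.2 (-y.1)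
        - gaussSum (periodicCoeff (P m)) c k y.2 (-y.1 + 1 / 2))) := by
    refine IsNegligibleOn.sum _ fun m _ => (hm m).mul_left 0 1 fun k hk y _ => ?_
    have hk1 : (1 : ℝ) ≤ k := by exact_mod_cast hk
    rw [norm_inv, norm_pow, Complex.norm_natCast, pow_zero, mul_one]
    exact inv_le_one_of_one_le₀ (one_le_pow₀ hk1)
  have hpi := Real.pi_pos
  refine ((hsum.mul_left (s := fun k y => -(Complex.exp (2 * Real.pi * Complex.I * (y.1 * y.2 : ℝ)) ^ k *
    ((((k : ℝ) / (2 * Real.pi)) ^ (3 * g - 2) : ℝ) / 2)))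
    (3 * g - 2) (1 / (2 * Real.pi) ^ (3 * g - 2)) fun k hk y _ => ?_)).congr fun k hk y hy => ?_
  · rw [norm_neg, norm_mul, norm_pow, norm_exp_two_pi_I_mul, one_pow, one_mul, norm_div,
      Complex.norm_real, Real.norm_of_nonneg (by positivity), Complex.norm_ofNat, div_pow]
    have : 0 ≤ (k : ℝ) ^ (3 * g - 2) / (2 * Real.pi) ^ (3 * g - 2) := by positivity
    calc _ ≤ (k : ℝ) ^ (3 * g - 2) / (2 * Real.pi) ^ (3 * g - 2) := by linarith
      _ = _ := by ring
  · rw [gaussZ_eq_gaussSum g τ hk, gaussSum_coeffZ hP hc hk]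
    ring

/-! ### The state in the momentum representation -/

/-- The quadratic coefficient of the Gaussian sum dual to the one with coefficient
`positionCoeff τ`. -/
noncomputable def momentumCoeff (τ : ℂ) : ℂ := 2 * Real.pi * Complex.I / τ

lemma ne_zero_of_im_pos {τ : ℂ} (hτ : 0 < τ.im) : τ ≠ 0 := by
  rintro rfl
  simp at hτ

lemma momentumCoeff_re_pos {τ : ℂ} (hτ : 0 < τ.im) : 0 < (momentumCoeff τ).re := by
  have hn : 0 < Complex.normSq τ := Complex.normSq_pos.2 (ne_zero_of_im_pos hτ)
  have : (momentumCoeff τ).re = 2 * Real.pi * (τ.im / Complex.normSq τ) := by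
    rw [momentumCoeff, show 2 * Real.pi * Complex.I / τ = ((2 * Real.pi : ℝ) : ℂ) * (Complex.I * τ⁻¹) by
      push_cast; ring, Complex.re_ofReal_mul, Complex.I_mul_re, Complex.inv_im]
    ring
  rw [this]
  have := Real.pi_pos
  positivity

lemma positionCoeff_mul_momentumCoeff {τ : ℂ} (hτ : 0 < τ.im) :
    positionCoeff τ * momentumCoeff τ = 4 * Real.pi ^ 2 := by
  have := ne_zero_of_im_pos hτ
  rw [positionCoeff, momentumCoeff]
  field_simp
  rw [Complex.I_sq]
  ring

lemma gaussMass_mul_gaussMass {τ : ℂ} (hτ : 0 < τ.im) :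
    gaussMass (positionCoeff τ) * gaussMass (momentumCoeff τ) = 1 / 2 ∨
      gaussMass (positionCoeff τ) * gaussMass (momentumCoeff τ) = -(1 / 2) := by
  have hc := positionCoeff_re_pos hτ
  have hc' := momentumCoeff_re_pos hτ
  have hpi : (Real.pi : ℂ) ≠ 0 := by exact_mod_cast Real.pi_ne_zero
  refine sq_eq_sq_iff_eq_or_eq_neg.1 ?_
  rw [mul_pow, gaussMass_sq hc, gaussMass_sq hc', div_mul_div_comm, positionCoeff_mul_momentumCoeff hτ]
  field_simp
  norm_num

/-- The inverse powers of sines that occur in the Verlinde formula. -/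
noncomputable def sineCoeff (g k : ℕ) (N : ℤ) : ℂ :=
  (((Real.sin (Real.pi * N / k) ^ (2 * g - 1))⁻¹ : ℝ) : ℂ)

lemma odd_two_mul_sub_one {g : ℕ} (hg : 1 ≤ g) : Odd (2 * g - 1) := ⟨g - 1, by omega⟩

lemma sineCoeff_neg {g : ℕ} (hg : 1 ≤ g) (k : ℕ) (N : ℤ) : sineCoeff g k (-N) = -sineCoeff g k N := by
  have : Real.pi * ((-N : ℤ) : ℝ) / k = -(Real.pi * N / k) := by push_cast; ring
  rw [sineCoeff, sineCoeff, this, Real.sin_neg, (odd_two_mul_sub_one hg).neg_pow, inv_neg]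
  push_cast
  rfl

lemma sineCoeff_add_period (g : ℕ) {k : ℕ} (hk : 1 ≤ k) (N ν : ℤ) :
    sineCoeff g k (N + 2 * k * ν) = sineCoeff g k N := by
  have hk0 : (k : ℝ) ≠ 0 := by exact_mod_cast (by omega : k ≠ 0)
  have : Real.pi * ((N + 2 * k * ν : ℤ) : ℝ) / k = Real.pi * N / k + ν * (2 * Real.pi) := by
    push_cast
    field_simp
  rw [sineCoeff, sineCoeff, this, Real.sin_add_int_mul_two_pi]

lemma sineCoeff_zero {g : ℕ} (hg : 1 ≤ g) (k : ℕ) : sineCoeff g k 0 = 0 := by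
  have : 2 * g - 1 ≠ 0 := by omega
  simp [sineCoeff, this]

lemma sineCoeff_self {g : ℕ} (hg : 1 ≤ g) {k : ℕ} (hk : 1 ≤ k) : sineCoeff g k k = 0 := by
  have h1 : 2 * g - 1 ≠ 0 := by omega
  have hk0 : (k : ℝ) ≠ 0 := by exact_mod_cast (by omega : k ≠ 0)
  have : Real.pi * ((k : ℤ) : ℝ) / k = Real.pi := by push_cast; field_simp
  rw [sineCoeff, this, Real.sin_pi, zero_pow h1]
  simp

/-- The sum of sines as a sum of characters over a full period. -/
lemma sineSum_eq_sum_exp {g : ℕ} (hg : 1 ≤ g) {k : ℕ} (hk : 1 ≤ k) (l : ℤ) :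
    (sineSum (2 * g - 1) k l : ℂ) = Complex.I / 2 * ∑ n ∈ Finset.range (2 * k),
      sineCoeff g k n * Complex.exp (-(Real.pi * Complex.I * l * n / k)) := by
  have hk0 : (k : ℂ) ≠ 0 := by exact_mod_cast (by omega : k ≠ 0)
  have hpair : ∀ r ∈ Finset.Ico 1 k,
      sineCoeff g k r * Complex.exp (-(Real.pi * Complex.I * l * r / k))
        + sineCoeff g k ((2 * k - r : ℕ) : ℤ) *
          Complex.exp (-(Real.pi * Complex.I * l * ((2 * k - r : ℕ) : ℂ) / k))
      = -2 * Complex.I * (((Real.sin (Real.pi * l * r / k) *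
        (Real.sin (Real.pi * r / k) ^ (2 * g - 1))⁻¹ : ℝ)) : ℂ) := by
    intro r hr
    rw [Finset.mem_Ico] at hr
    have h1 : ((2 * k - r : ℕ) : ℤ) = -r + 2 * k * 1 := by omega
    have h2 : Complex.exp (-(Real.pi * Complex.I * l * ((2 * k - r : ℕ) : ℂ) / k))
        = Complex.exp (Real.pi * Complex.I * l * r / k) := by
      refine exp_eq_exp_of_eq_add (-l) ?_
      rw [Nat.cast_sub (by omega)]
      push_cast
      field_simp
      ring
    rw [h1, sineCoeff_add_period g hk, sineCoeff_neg hg, h2]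
    have h3 : (Real.pi * Complex.I * l * r / k : ℂ) = (Real.pi * l * r / k : ℂ) * Complex.I := by ring
    rw [h3, ← neg_mul, Complex.exp_mul_I, Complex.exp_mul_I, Complex.cos_neg, Complex.sin_neg]
    rw [sineCoeff]
    push_cast
    ring
  rw [sum_range_two_mul_eq hk, Finset.sum_congr rfl hpair, ← Finset.mul_sum]
  rw [Nat.cast_zero, sineCoeff_zero hg, sineCoeff_self hg hk, zero_mul, zero_mul, add_zero, zero_add,
    sineSum, Finset.range_eq_Ico, Finset.sum_eq_sum_Ico_succ_bot (by omega)]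
  push_cast
  simp only [mul_zero, zero_div, Complex.sin_zero, zero_mul, zero_add]
  linear_combination (∑ x ∈ Finset.Ico 1 k, Complex.sin (Real.pi * l * x / k) *
    (Complex.sin (Real.pi * x / k) ^ (2 * g - 1))⁻¹) * Complex.I_sq

lemma summable_dualTerm {c : ℂ} (hc : 0 < c.re) {k : ℕ} (hk : 1 ≤ k) (P Q : ℝ) :
    Summable (dualTerm c k P Q) := by
  have hκ := inv_re_pos hc
  have hk0 : (0 : ℝ) < k := by exact_mod_cast hk
  have hpi := Real.pi_pos
  obtain ⟨C, -, h⟩ := exists_gaussian_sum_bound (a := 4 * Real.pi ^ 2 * (1 / c).re * k) (by positivity)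
  refine Summable.of_norm ((h Q).1.congr fun m => ?_)
  rw [norm_dualTerm]

lemma gaussSum_coeffZ_eq_sum {g : ℕ} (hg : 1 ≤ g) {c : ℂ} (hc : 0 < c.re) {k : ℕ} (hk : 1 ≤ k)
    (P Q : ℝ) : gaussSum (fun k N => (coeffZ g k N : ℂ)) c k P Q
      = ((k : ℂ) / 2) ^ (g - 1) * (Complex.I / 2) * ∑ n ∈ Finset.range (2 * k),
        sineCoeff g k n * ∑' N : ℤ, gaussTerm c k P (Q - n / (2 * k)) N := by
  have hk0 : (k : ℂ) ≠ 0 := by exact_mod_cast (by omega : k ≠ 0)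
  have hs : ∀ n ∈ Finset.range (2 * k), Summable fun N : ℤ =>
      sineCoeff g k n * gaussTerm c k P (Q - n / (2 * k)) N := fun n _ =>
    (summable_gaussTerm hc hk P _).mul_left _
  simp only [← tsum_mul_left (a := sineCoeff g k _)]
  rw [← Summable.tsum_finsetSum hs, ← tsum_mul_left, gaussSum]
  refine tsum_congr fun N => ?_
  rw [coeffZ, Complex.ofReal_mul, sineSum_eq_sum_exp hg hk, mul_assoc (((k : ℂ) / 2) ^ (g - 1))]
  push_cast
  rw [mul_assoc, mul_assoc, Finset.sum_mul]
  congr 2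
  refine Finset.sum_congr rfl fun n _ => ?_
  rw [mul_assoc, gaussTerm, gaussTerm, ← Complex.exp_add]
  congr 2
  push_cast
  field_simp
  ring

/-- Poisson summation exchanges the roles of the two circles: the coefficients of the dual Gaussian
sum are the inverse powers of sines. -/
lemma gaussZ_eq_gaussSum_sineCoeff {g : ℕ} (hg : 1 ≤ g) {τ : ℂ} (hτ : 0 < τ.im) {k : ℕ} (hk : 1 ≤ k)
    (y : Plane) : gaussZ g τ k y = ((k : ℂ) / 2) ^ (g - 1) * (Complex.I * (Real.sqrt k : ℝ) *
      gaussMass (positionCoeff τ)) * (Complex.exp (2 * Real.pi * Complex.I * (-(y.1 * y.2) : ℝ)) ^ k *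
        gaussSum (sineCoeff g) (momentumCoeff τ) k y.1 y.2) := by
  have hk0 : (k : ℂ) ≠ 0 := by exact_mod_cast (by omega : k ≠ 0)
  have hk0' : (k : ℝ) ≠ 0 := by exact_mod_cast (by omega : k ≠ 0)
  have hτ0 := ne_zero_of_im_pos hτ
  have hpi : (Real.pi : ℂ) ≠ 0 := by exact_mod_cast Real.pi_ne_zero
  have hc := positionCoeff_re_pos hτ
  set c := positionCoeff τ with hcdef
  have hc0 := ne_zero_of_re_pos hc
  have hcc : momentumCoeff τ = 4 * Real.pi ^ 2 / c := by
    rw [eq_div_iff hc0, mul_comm]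
    exact positionCoeff_mul_momentumCoeff hτ
  -- the dual sums for the frequencies `-p - n / 2k`, `0 ≤ n < 2k`, combine into one sum over `ℤ`
  set D : ℤ → ℂ := fun N => sineCoeff g k N * dualTerm c k y.2 (-y.1 - N / (2 * k)) 0 with hD
  have hres : ∀ n < 2 * k, HasSum (fun ν : ℤ => D (n + (2 * k : ℕ) * ν))
      (sineCoeff g k n * ∑' m : ℤ, dualTerm c k y.2 (-y.1 - n / (2 * k)) m) := by
    intro n _
    have h := ((summable_dualTerm hc hk y.2 (-y.1 - n / (2 * k))).hasSum).mul_left (sineCoeff g k n)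
    refine h.congr_fun fun ν => ?_
    simp only [hD]
    have e : ((n : ℤ) + (2 * k : ℕ) * ν : ℤ) = n + 2 * k * ν := by push_cast; ring
    rw [e, sineCoeff_add_period g hk]
    congr 1
    rw [dualTerm, dualTerm]
    congr 1
    push_cast
    field_simp
    ring
  have hsum := hasSum_int_of_residues (by omega : 1 ≤ 2 * k) hres
  have hterm : ∀ N : ℤ, D (-N) = -(Complex.exp (2 * Real.pi * Complex.I * (-(y.1 * y.2) : ℝ)) ^ (2 * k)
      * (sineCoeff g k N * gaussTerm (momentumCoeff τ) k y.1 y.2 N)) := by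
    intro N
    simp only [hD]
    rw [sineCoeff_neg hg, neg_mul, mul_left_comm]
    congr 2
    rw [dualTerm, gaussTerm, hcc, ← Complex.exp_nat_mul, ← Complex.exp_add]
    congr 1
    push_cast
    field_simp
    ring
  have hfin : ∑ n ∈ Finset.range (2 * k), sineCoeff g k n *
      ∑' m : ℤ, dualTerm c k y.2 (-y.1 - n / (2 * k)) m
      = -(Complex.exp (2 * Real.pi * Complex.I * (-(y.1 * y.2) : ℝ)) ^ (2 * k) *
        gaussSum (sineCoeff g) (momentumCoeff τ) k y.1 y.2) := by
    rw [← hsum.tsum_eq, ← (Equiv.neg ℤ).tsum_eq, gaussSum, ← tsum_mul_left, ← tsum_neg]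
    exact tsum_congr fun N => hterm N
  rw [gaussZ_eq_gaussSum g τ hk, gaussSum_coeffZ_eq_sum hg hc hk]
  simp only [tsum_gaussTerm hc hk]
  have hpull : ∑ n ∈ Finset.range (2 * k), sineCoeff g k n * (2 * (Real.sqrt k : ℝ) * gaussMass c *
      ∑' m : ℤ, dualTerm c k y.2 (-y.1 - n / (2 * k)) m)
      = 2 * (Real.sqrt k : ℝ) * gaussMass c * ∑ n ∈ Finset.range (2 * k), sineCoeff g k n *
        ∑' m : ℤ, dualTerm c k y.2 (-y.1 - n / (2 * k)) m := by
    rw [Finset.mul_sum]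
    exact Finset.sum_congr rfl fun n _ => by ring
  have hphase : Complex.exp (2 * Real.pi * Complex.I * (y.1 * y.2 : ℝ)) ^ k *
      Complex.exp (2 * Real.pi * Complex.I * (-(y.1 * y.2) : ℝ)) ^ (2 * k)
      = Complex.exp (2 * Real.pi * Complex.I * (-(y.1 * y.2) : ℝ)) ^ k := by
    rw [← Complex.exp_nat_mul, ← Complex.exp_nat_mul, ← Complex.exp_nat_mul, ← Complex.exp_add]
    congr 1
    push_cast
    ring
  rw [hpull, hfin, ← hphase]
  ring

/-! ### The state near the circle `A₁` -/

lemma isSampled_sineCoeff {g : ℕ} {x₀ : ℝ} (hx₀ : ∀ m : ℤ, 2 * x₀ ≠ m) : ∃ r : ℝ,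
    IsSampled (sineCoeff g) (fun z => (Complex.sin (2 * Real.pi * z) ^ (2 * g - 1))⁻¹) x₀ r
      (2 * g - 1) := by
  have hpi := Real.pi_pos
  have h0 : Complex.sin (2 * Real.pi * (x₀ : ℂ)) ≠ 0 := by
    rw [show (2 * Real.pi * (x₀ : ℂ)) = ((2 * Real.pi * x₀ : ℝ) : ℂ) by push_cast; ring,
      ← Complex.ofReal_sin, Complex.ofReal_ne_zero]
    intro h
    obtain ⟨m, hm⟩ := Real.sin_eq_zero_iff.1 h
    refine hx₀ m ?_
    have : Real.pi * (2 * x₀ - m) = 0 := by linarith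
    rcases mul_eq_zero.1 this with h | h
    · exact absurd h hpi.ne'
    · linarith
  have hev : ∀ᶠ z in nhds (x₀ : ℂ), Complex.sin (2 * Real.pi * z) ≠ 0 :=
    (by fun_prop : Continuous fun z : ℂ => Complex.sin (2 * Real.pi * z)).continuousAt.eventually_ne h0
  obtain ⟨r, hr, hb⟩ := Metric.eventually_nhds_iff_ball.1 hev
  refine ⟨r, hr, fun z hz => ?_, ⟨1, one_pos, fun k hk N => ?_⟩, fun k hk N _ => ?_⟩
  · refine DifferentiableAt.differentiableWithinAt (DifferentiableAt.inv ?_ (pow_ne_zero _ (hb z hz)))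
    fun_prop
  · rw [sineCoeff, Complex.norm_real, Real.norm_eq_abs, one_mul]
    exact abs_inv_sin_pow_le hk _ N
  · have hk0 : (k : ℂ) ≠ 0 := by exact_mod_cast (by omega : k ≠ 0)
    rw [sineCoeff]
    push_cast
    congr 3
    field_simp

/-- The section of `L_E`, equal to the flat section along the line `q = n`, that carries the
oscillations of the state near this line. -/
noncomputable def momentumPhase (τ : ℂ) (n : ℤ) (y : Plane) : ℂ :=
  Complex.exp (2 * Real.pi * Complex.I * (-(y.1 * y.2) : ℝ)) *
    leadingExp (momentumCoeff τ) 1 y.1 (y.2 - n)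

/-- The state near a point of the line `q = n`. -/
lemma exists_local_form_momentum {g : ℕ} (hg : 1 ≤ g) {τ : ℂ} (hτ : 0 < τ.im) {p₀ : ℝ}
    (hp₀ : ∀ m : ℤ, 2 * p₀ ≠ m) (n₀ : ℤ) :
    ∃ (V : Set Plane) (f F : ℕ → Plane → ℂ), IsOpen V ∧ (p₀, (n₀ : ℝ)) ∈ V ∧
      HasSmoothExpansion V f F ∧
      (∀ y ∈ V, y.2 = n₀ → F 0 y = 4 * Complex.I * (Real.pi : ℂ) ^ g *
        (gaussMass (positionCoeff τ) * gaussMass (momentumCoeff τ)) *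
          (((Real.sin (2 * Real.pi * y.1) ^ (2 * g - 1))⁻¹ : ℝ) : ℂ)) ∧
      IsNegligibleOn V (fun k y => gaussZ g τ k y -
        ((((k : ℝ) / (2 * Real.pi)) ^ (g : ℝ) : ℝ) : ℂ) * momentumPhase τ n₀ y ^ k * f k y) := by
  set c := momentumCoeff τ with hc_def
  have hc : 0 < c.re := momentumCoeff_re_pos hτ
  obtain ⟨r, hr⟩ := isSampled_sineCoeff (g := g) hp₀
  obtain ⟨B, ρ, f, F, hB, hρ, hf, hF0, hball, hmain, -⟩ := hr.exists_expansion hc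
  set κ : ℂ := 4 * Complex.I * (Real.pi : ℂ) ^ g * (gaussMass (positionCoeff τ) * gaussMass c) with hκ
  set V : Set Plane := {y : Plane | |y.1 - p₀| < ρ ∧ |y.2 - (n₀ : ℝ)| < ρ} with hV
  have hVo : IsOpen V :=
    (isOpen_lt (by fun_prop : Continuous fun y : Plane => |y.1 - p₀|) continuous_const).inter
      (isOpen_lt (by fun_prop : Continuous fun y : Plane => |y.2 - (n₀ : ℝ)|) continuous_const)
  set z : Plane → ℂ := fun y => y.1 + 2 * Real.pi * Complex.I * ((y.2 - n₀ : ℝ) : ℂ) / c with hz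
  set ℓ : Plane →L[ℝ] ℂ := Complex.ofRealCLM.comp (ContinuousLinearMap.fst ℝ ℝ ℝ)
    + (2 * Real.pi * Complex.I / c) • Complex.ofRealCLM.comp (ContinuousLinearMap.snd ℝ ℝ ℝ) with hℓ
  set w : ℂ := -(2 * Real.pi * Complex.I * n₀ / c) with hw
  have hzℓ : ∀ y, ℓ y + w = z y := by
    intro y
    simp only [hℓ, hw, hz, add_apply, ContinuousLinearMap.comp_apply,
      ContinuousLinearMap.coe_snd', ContinuousLinearMap.coe_fst', smul_apply,
      Complex.ofRealCLM_apply, smul_eq_mul]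
    push_cast
    ring
  refine ⟨V, fun k y => κ * f k (z y), fun l y => κ * F l (z y), hVo, by simp [hV, hρ], ?_,
    fun y hy hy2 => ?_, ?_⟩
  · have := (hf.const_mul κ).hasSmoothExpansion hB ℓ w (V := V)
      (fun y hy => by rw [hzℓ]; exact hball _ _ hy.1 hy.2)
    simpa only [hzℓ] using this
  · have hzy : z y = ((y.1 : ℝ) : ℂ) := by simp [hz, hy2]
    beta_reduce
    rw [hF0]
    beta_reduce
    rw [hzy]
    push_cast
    rfl
  · have hpi := Real.pi_pos
    have hm : IsNegligibleOn V (fun k y => gaussSum (sineCoeff g) c k y.1 y.2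
        - 2 * (Real.sqrt k : ℝ) * gaussMass c * leadingExp c k y.1 (y.2 - n₀) * f k (z y)) := by
      intro L
      obtain ⟨C, hC, h⟩ := hmain L
      refine ⟨C, fun k hk y hy => ?_⟩
      beta_reduce
      rw [← gaussSum_sub_int _ _ _ _ y.2 n₀]
      exact h k hk _ _ hy.1 hy.2
    refine (hm.mul_left (s := fun k y => ((k : ℂ) / 2) ^ (g - 1) * (Complex.I * (Real.sqrt k : ℝ) *
      gaussMass (positionCoeff τ)) * Complex.exp (2 * Real.pi * Complex.I * (-(y.1 * y.2) : ℝ)) ^ k)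
      g ‖gaussMass (positionCoeff τ)‖ fun k hk y _ => ?_).congr fun k hk y _ => ?_
    · have hk1 : (1 : ℝ) ≤ k := by exact_mod_cast hk
      rw [norm_mul, norm_mul, norm_mul, norm_mul, norm_pow, norm_pow, norm_exp_two_pi_I_mul, one_pow,
        mul_one, norm_div, Complex.norm_natCast, Complex.norm_ofNat, Complex.norm_I, one_mul]
      calc _ ≤ (k : ℝ) ^ (g - 1) * (k * ‖gaussMass (positionCoeff τ)‖) := by
            gcongr
            · linarith
            · exact norm_sqrt_natCast_le hk
        _ = ‖gaussMass (positionCoeff τ)‖ * (k : ℝ) ^ (g - 1 + 1) := by rw [pow_succ]; ring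
        _ = _ := by rw [Nat.sub_add_cancel hg]
    · have hk0 : (0 : ℝ) < k := by exact_mod_cast hk
      have hpic : (Real.pi : ℂ) ≠ 0 := by exact_mod_cast hpi.ne'
      have hsq : ((Real.sqrt k : ℝ) : ℂ) ^ 2 = k := by
        rw [← Complex.ofReal_pow, Real.sq_sqrt hk0.le]; simp
      have hpw : ((k : ℂ) / 2) ^ (g - 1) * k * 2
          = 4 * (Real.pi : ℂ) ^ g * ((k : ℂ) / (2 * Real.pi)) ^ g := by
        obtain ⟨i, rfl⟩ : ∃ i, g = i + 1 := ⟨g - 1, by omega⟩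
        rw [mul_assoc 4, ← mul_pow, Nat.add_sub_cancel,
          show (Real.pi : ℂ) * (k / (2 * Real.pi)) = k / 2 by field_simp, pow_succ]
        ring
      rw [gaussZ_eq_gaussSum_sineCoeff hg hτ hk, momentumPhase, mul_pow, ← leadingExp_pow, hκ,
        Real.rpow_natCast]
      push_cast
      linear_combination (Complex.I * gaussMass (positionCoeff τ) * gaussMass c *
        Complex.exp (2 * Real.pi * Complex.I * -(y.1 * y.2)) ^ k *
          leadingExp c k y.1 (y.2 - n₀) * f k (z y)) * (hpw + 2 * ((k : ℂ) / 2) ^ (g - 1) * hsq)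

/-! ### Local forms and microsupport of the state -/

lemma HasSmoothExpansion.mono {V V' : Set Plane} {f F : ℕ → Plane → ℂ} (h : HasSmoothExpansion V f F)
    (hV : V' ⊆ V) : HasSmoothExpansion V' f F :=
  ⟨fun k hk => (h.1 k hk).mono hV, fun l => (h.2.1 l).mono hV,
    fun L m K hK hKV => h.2.2 L m K hK (hKV.trans hV)⟩

lemma HasSmoothExpansion.const_mul {V : Set Plane} (hV : IsOpen V) {f F : ℕ → Plane → ℂ}
    (h : HasSmoothExpansion V f F) (a : ℂ) :
    HasSmoothExpansion V (fun k y => a * f k y) (fun l y => a * F l y) := by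
  refine ⟨fun k hk => contDiffOn_const.mul (h.1 k hk), fun l => contDiffOn_const.mul (h.2.1 l),
    fun L m K hK hKV => ?_⟩
  obtain ⟨C, hC⟩ := h.2.2 L m K hK hKV
  refine ⟨‖a‖ * C, fun k hk y hy => ?_⟩
  set r : Plane → ℂ := fun z => f k z - ∑ l ∈ Finset.range L, ((k : ℂ) ^ l)⁻¹ * F l z with hr
  have e : (fun z => a * f k z - ∑ l ∈ Finset.range L, ((k : ℂ) ^ l)⁻¹ * (a * F l z)) = a • r := by
    ext z
    simp only [hr, Pi.smul_apply, smul_eq_mul, mul_sub, Finset.mul_sum]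
    congr 1
    exact Finset.sum_congr rfl fun l _ => by ring
  have hcd : ContDiffAt ℝ m r y := by
    have h1 : ContDiffOn ℝ ∞ r V := (h.1 k hk).sub
      (ContDiffOn.sum fun l _ => contDiffOn_const.mul (h.2.1 l))
    exact (h1.contDiffAt (hV.mem_nhds (hKV hy))).of_le (by exact_mod_cast le_top)
  rw [e, iteratedFDeriv_const_smul_apply hcd, norm_smul, mul_assoc]
  exact mul_le_mul_of_nonneg_left (hC k hk y hy) (norm_nonneg a)

/-- The conditions on a local form only have to be checked in a small neighbourhood. -/
lemma exists_localForm {j : Plane →ₗ[ℝ] Plane} {U G : Set Torus} {Theta : Plane → ℂ} {sigma : Torus → ℂ}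
    {N : ℝ} {xi : ℕ → Plane → ℂ} (hU : IsOpen U) {x₀ : Plane} (hx₀ : proj x₀ ∈ U) {V : Set Plane}
    (hV : IsOpen V) (hxV : x₀ ∈ V) {e : Plane → ℂ} {f F : ℕ → Plane → ℂ} (he : ContDiff ℝ ∞ e)
    (hdbar : ∀ v y, dbar j 1 e v y = 0)
    (hev : ∀ᶠ y in nhds x₀, (proj y ∈ G → e y = Theta y) ∧ (proj y ∉ G → ‖e y‖ < 1) ∧
      (y ∈ V → proj y ∈ G → F 0 y = sigma (proj y)))
    (hexp : HasSmoothExpansion V f F)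
    (hneg : IsNegligibleOn V (fun k y =>
      xi k y - ((((k : ℝ) / (2 * Real.pi)) ^ (1 / 4 + N) : ℝ) : ℂ) * (e y) ^ k * f k y)) :
    ∃ V : Set Plane, IsOpen V ∧ x₀ ∈ V ∧ V ⊆ proj ⁻¹' U ∧
      ∃ (e : Plane → ℂ) (f F : ℕ → Plane → ℂ),
        ContDiffOn ℝ ∞ e V ∧
        (∀ y ∈ V, proj y ∈ G → e y = Theta y) ∧
        (∀ y ∈ V, proj y ∉ G → ‖e y‖ < 1) ∧
        (∀ (v : Plane) (n : ℕ), ∀ y ∈ V, proj y ∈ G → iteratedFDeriv ℝ n (dbar j 1 e v) y = 0) ∧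
        HasSmoothExpansion V f F ∧
        (∀ y ∈ V, proj y ∈ G → F 0 y = sigma (proj y)) ∧
        IsNegligibleOn V (fun k y =>
          xi k y - ((((k : ℝ) / (2 * Real.pi)) ^ (1 / 4 + N) : ℝ) : ℂ) * (e y) ^ k * f k y) := by
  obtain ⟨W, hW, hWo, hxW⟩ := eventually_nhds_iff.1
    (hev.and ((hU.preimage continuous_proj).mem_nhds hx₀))
  refine ⟨V ∩ W, hV.inter hWo, ⟨hxV, hxW⟩, fun y hy => (hW y hy.2).2, e, f, F, he.contDiffOn,
    fun y hy => (hW y hy.2).1.1, fun y hy => (hW y hy.2).1.2.1, fun v n y _ _ => ?_,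
    hexp.mono Set.inter_subset_left, fun y hy => (hW y hy.2).1.2.2 hy.1,
    hneg.mono Set.inter_subset_left⟩
  have : dbar j 1 e v = fun _ => 0 := funext fun y => hdbar v y
  rw [this, iteratedFDeriv_fun_zero]
  rfl

lemma differentiable_cexp_quadratic (a b d : ℂ) :
    Differentiable ℂ fun z : ℂ => Complex.exp (a * z ^ 2 + b * z + d) := by fun_prop

lemma positionPhase_eq_holoSection {τ : ℂ} (hτ : 0 < τ.im) (m : ℤ) :
    positionPhase τ m = holoSection τ 1 (fun z => Complex.exp (-(2 * Real.pi * Complex.I / τ) * z ^ 2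
      + 2 * Real.pi * Complex.I / τ * m * z + -(2 * Real.pi * Complex.I / τ * m ^ 2 / 4))) := by
  have hτ0 := ne_zero_of_im_pos hτ
  have hpi : (Real.pi : ℂ) ≠ 0 := by exact_mod_cast Real.pi_ne_zero
  ext y
  rw [positionPhase, holoSection, leadingExp, positionCoeff, zcoord_apply, ← Complex.exp_add,
    ← Complex.exp_add]
  congr 1
  push_cast
  field_simp
  ring_nf
  simp only [Complex.I_sq]
  ring

lemma momentumPhase_eq_holoSection {τ : ℂ} (hτ : 0 < τ.im) (n : ℤ) :
    momentumPhase τ n = holoSection τ 1 (fun z => Complex.exp (0 * z ^ 2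
      + -(4 * Real.pi * Complex.I * n) * z + 2 * Real.pi * Complex.I * τ * n ^ 2)) := by
  have hτ0 := ne_zero_of_im_pos hτ
  have hpi : (Real.pi : ℂ) ≠ 0 := by exact_mod_cast Real.pi_ne_zero
  ext y
  rw [momentumPhase, holoSection, leadingExp, momentumCoeff, zcoord_apply, ← Complex.exp_add,
    ← Complex.exp_add]
  congr 1
  push_cast
  field_simp
  ring_nf
  simp only [Complex.I_sq]
  ring

/-- The function on the torus induced by a periodic function on the plane. -/
noncomputable def descend (s : Plane → ℂ) (x : Torus) : ℂ := s (Quotient.out x)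

lemma descend_proj {s : Plane → ℂ} (hs : ∀ (y : Plane) (m n : ℤ), s (y.1 + m, y.2 + n) = s y)
    (y : Plane) :
    descend s (proj y) = s y := by
  have h : proj (Quotient.out (proj y)) = proj y := QuotientAddGroup.out_eq' _
  obtain ⟨m, n, hmn⟩ := proj_eq_proj_iff.1 h
  rw [descend, ← hs _ m n, ← hmn]

lemma rpow_quarter_le {k : ℕ} (hk : 1 ≤ k) : ((k : ℝ) / (2 * Real.pi)) ^ (1 / 4 : ℝ) ≤ k := by
  have hpi := Real.pi_gt_three
  have hk1 : (1 : ℝ) ≤ k := by exact_mod_cast hk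
  calc ((k : ℝ) / (2 * Real.pi)) ^ (1 / 4 : ℝ) ≤ (k : ℝ) ^ (1 / 4 : ℝ) := by
        gcongr
        exact div_le_self (by linarith) (by linarith)
    _ ≤ (k : ℝ) ^ (1 : ℝ) := Real.rpow_le_rpow_of_exponent_le hk1 (by norm_num)
    _ = k := Real.rpow_one _

/-- Replacing the state by the Gaussian sum that represents it. -/
lemma isNegligibleOn_of_gaussZ {g : ℕ} (hg : 1 ≤ g) {τ : ℂ} (hτ : 0 < τ.im) {u : ℕ → ℂ} {C δ : ℝ}
    (hδ : 0 < δ) (hu : ∀ k : ℕ, 1 ≤ k → ‖u k - 1‖ ≤ C * Real.exp (-δ * k)) {Om : ℂ}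
    {xi : ℕ → Plane → ℂ} (hxi : ∀ k : ℕ, 1 ≤ k → ∀ y, xi k y
      = ((((k : ℝ) / (2 * Real.pi)) ^ (1 / 4 : ℝ) : ℝ) * Om * u k : ℂ)
        * (((Real.sqrt 2 : ℝ) : ℂ)⁻¹ * gaussZ g τ k y)) {V : Set Plane} {s : ℕ → Plane → ℂ}
    (h : IsNegligibleOn V (fun k y => gaussZ g τ k y - s k y)) :
    IsNegligibleOn V (fun k y => xi k y - ((((k : ℝ) / (2 * Real.pi)) ^ (1 / 4 : ℝ) : ℝ) : ℂ) *
      (Om * ((Real.sqrt 2 : ℝ) : ℂ)⁻¹) * s k y) := by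
  have hpi := Real.pi_gt_three
  obtain ⟨D, hD, hgz⟩ := exists_norm_gaussZ_le hg hτ
  have h1 : IsNegligibleOn V (fun k y => gaussZ g τ k y * (u k - 1)) := by
    have h0 : IsNegligibleOn V (fun k _ => u k - 1) := by
      intro N
      obtain ⟨D', hD', he⟩ := exists_exp_neg_le hδ N
      refine ⟨|C| * D', fun k hk y _ => (hu k hk).trans ?_⟩
      rw [mul_assoc]
      exact mul_le_mul (le_abs_self C) (he k hk) (Real.exp_pos _).le (abs_nonneg C)
    exact h0.mul_left (3 * g + 1) D fun k hk y _ => hgz k hk y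
  refine ((h1.add h).mul_left (s := fun k _ => ((((k : ℝ) / (2 * Real.pi)) ^ (1 / 4 : ℝ) : ℝ) : ℂ) *
    (Om * ((Real.sqrt 2 : ℝ) : ℂ)⁻¹)) 1 ‖Om * ((Real.sqrt 2 : ℝ) : ℂ)⁻¹‖ fun k hk y _ => ?_).congr
    fun k hk y _ => ?_
  · have hk1 : (1 : ℝ) ≤ k := by exact_mod_cast hk
    have hle := rpow_quarter_le hk
    rw [norm_mul, Complex.norm_real, Real.norm_of_nonneg (by positivity), pow_one, mul_comm]
    gcongr
  · rw [hxi k hk]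
    ring

lemma isAdmissible_stateZ {g : ℕ} (hg : 1 ≤ g) (G : PantsDecomposition g) {j : Plane →ₗ[ℝ] Plane}
    (hj : IsCompatible j) {kappa : Plane →ₗ[ℝ] ℂ} (hkappa : IsHalfFormLine j kappa) {Om : ℂ}
    (hOm : IsHalfForm kappa mu Om) {Psi : (k : ℕ) → ZMod (2 * k) → Plane → ℂ}
    (hPsi : ∀ k, 1 ≤ k → IsPsiBasis j kappa Om k (Psi k)) :
    IsAdmissible j kappa (stateZ G Psi) := by
  refine ⟨fun k hk => stateZ_mem_quantumSpace G (hPsi k hk), ?_⟩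
  have hτ := modulus_im_pos hj hkappa hOm.ne_zero
  have hpi := Real.pi_gt_three
  obtain ⟨u, C, δ, hδ, hu, hZ⟩ := exists_stateZ_eq hg G hj hkappa hOm hPsi
  obtain ⟨D, hD, hgz⟩ := exists_norm_gaussZ_le hg hτ
  set A := ‖Om‖ * (|C| + 1) * (‖((Real.sqrt 2 : ℝ) : ℂ)⁻¹‖ * D) with hA
  refine ⟨3 * g + 2, Real.sqrt (4 * Real.pi * halfFormNormSq kappa) * A, fun k hk => ?_⟩
  have hk1 : (1 : ℝ) ≤ k := by exact_mod_cast hk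
  have hle := rpow_quarter_le hk
  have hun : ‖u k‖ ≤ |C| + 1 := by
    have h1 : Real.exp (-δ * k) ≤ 1 := Real.exp_le_one_iff.2 (by nlinarith)
    calc ‖u k‖ = ‖(u k - 1) + 1‖ := by congr 1; ring
      _ ≤ ‖u k - 1‖ + 1 := (norm_add_le _ _).trans_eq (by rw [norm_one])
      _ ≤ |C| * 1 + 1 := by
        gcongr
        exact (hu k hk).trans (mul_le_mul (le_abs_self C) h1 (Real.exp_pos _).le (abs_nonneg C))
      _ = _ := by ring
  refine (quantumNorm_le (by positivity : 0 ≤ A * (k : ℝ) ^ (3 * g + 2)) fun y => ?_).trans_eq (by ring)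
  rw [hZ k hk, norm_mul, norm_mul, norm_mul, norm_mul, Complex.norm_real,
    Real.norm_of_nonneg (by positivity)]
  calc _ ≤ (k : ℝ) * ‖Om‖ * (|C| + 1) * (‖((Real.sqrt 2 : ℝ) : ℂ)⁻¹‖ * (D * (k : ℝ) ^ (3 * g + 1))) := by
        gcongr
        exact hgz k hk y
    _ = _ := by rw [hA, pow_succ (k : ℝ) (3 * g + 1)]; ring

/-- The microsupport of the state is contained in the union of the three circles. -/
lemma microsupport_stateZ_subset {g : ℕ} (hg : 1 ≤ g) (G : PantsDecomposition g)
    {j : Plane →ₗ[ℝ] Plane} (hj : IsCompatible j) {kappa : Plane →ₗ[ℝ] ℂ}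
    (hkappa : IsHalfFormLine j kappa) {Om : ℂ} (hOm : IsHalfForm kappa mu Om)
    {Psi : (k : ℕ) → ZMod (2 * k) → Plane → ℂ}
    (hPsi : ∀ k, 1 ≤ k → IsPsiBasis j kappa Om k (Psi k)) :
    microsupport (stateZ G Psi) ⊆ A1 ∪ A2 := by
  intro x hx
  obtain ⟨y, rfl⟩ := QuotientAddGroup.mk_surjective x
  by_contra hy
  rw [Set.mem_union, not_or] at hy
  have h1 : ∀ n : ℤ, y.2 ≠ n := fun n h => hy.1 (proj_mem_A1_iff.2 ⟨n, h⟩)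
  have h2 : ∀ m : ℤ, 2 * y.1 ≠ m := fun m h => hy.2 (proj_mem_A2_iff.2 ⟨m, h⟩)
  have hτ := modulus_im_pos hj hkappa hOm.ne_zero
  obtain ⟨u, C, δ, hδ, hu, hZ⟩ := exists_stateZ_eq hg G hj hkappa hOm hPsi
  obtain ⟨P, -, hP⟩ := exists_isCountingFamily hg G
  obtain ⟨V, hV, hyV, hneg⟩ := exists_isNegligibleOn_position hP hτ h2 h1
  have h3 := isNegligibleOn_of_gaussZ hg hτ hδ hu hZ (s := fun _ _ => 0)
    (hneg.congr fun k _ y _ => sub_zero _)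
  refine notMem_microsupport (fun k hk => (stateZ_mem_quantumSpace G (hPsi k hk)).2.1) hV hyV
    (h3.congr fun k _ y _ => ?_) hx
  ring

/-! ### Lagrangian states -/

lemma rpow_quarter_mul {k : ℕ} (hk : 1 ≤ k) (N : ℝ) :
    ((((k : ℝ) / (2 * Real.pi)) ^ (1 / 4 : ℝ) : ℝ) : ℂ) * ((((k : ℝ) / (2 * Real.pi)) ^ N : ℝ) : ℂ)
      = ((((k : ℝ) / (2 * Real.pi)) ^ (1 / 4 + N) : ℝ) : ℂ) := by
  have hk0 : (0 : ℝ) < k := by exact_mod_cast hk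
  have hpi := Real.pi_pos
  rw [← Complex.ofReal_mul, ← Real.rpow_add (by positivity)]

/-- The symbol of the state along `A₁`, as a function on the plane. -/
noncomputable def symbolA1 (g : ℕ) (a : ℂ) (y : Plane) : ℂ :=
  a * (((Real.sin (2 * Real.pi * y.1) ^ (2 * g - 1))⁻¹ : ℝ) : ℂ)

lemma descend_symbolA1 (g : ℕ) (a : ℂ) (y : Plane) :
    descend (symbolA1 g a) (proj y) = symbolA1 g a y := by
  refine descend_proj (fun y m n => ?_) y
  simp only [symbolA1]
  rw [mul_add, show 2 * Real.pi * (m : ℝ) = m * (2 * Real.pi) by ring, Real.sin_add_int_mul_two_pi]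

/-- The symbol of the state along `A₂`, as a function on the plane: it changes sign from one line
`p = m / 2` to the next one. -/
noncomputable def symbolA2 (p : Polynomial ℝ) (a : ℂ) (y : Plane) : ℂ :=
  a * (-1) ^ ⌊2 * y.1⌋ * ((p.eval (2 * Int.fract y.2) : ℝ) : ℂ)

lemma descend_symbolA2 (p : Polynomial ℝ) (a : ℂ) (y : Plane) :
    descend (symbolA2 p a) (proj y) = symbolA2 p a y := by
  refine descend_proj (fun y m n => ?_) y
  have h : 2 * (y.1 + m) = 2 * y.1 + ((2 * m : ℤ) : ℝ) := by push_cast; ring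
  simp only [symbolA2]
  rw [h, Int.floor_add_intCast, Int.fract_add_intCast, zpow_add₀ (by norm_num),
    (even_two_mul m).neg_one_zpow, mul_one]

/-- Over the complement of `A₂`, the state is a Lagrangian state supported by `A₁`. -/
lemma isLagrangianState_A1 {g : ℕ} (hg : 1 ≤ g) (G : PantsDecomposition g)
    {j : Plane →ₗ[ℝ] Plane} (hj : IsCompatible j) {kappa : Plane →ₗ[ℝ] ℂ}
    (hkappa : IsHalfFormLine j kappa) {Om : ℂ} (hOm : IsHalfForm kappa mu Om)
    {Psi : (k : ℕ) → ZMod (2 * k) → Plane → ℂ}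
    (hPsi : ∀ k, 1 ≤ k → IsPsiBasis j kappa Om k (Psi k)) :
    IsLagrangianState j kappa A2ᶜ (A1 \ A2) flatSection
      (descend (symbolA1 g (Om * ((Real.sqrt 2 : ℝ) : ℂ)⁻¹ * (4 * Complex.I * (Real.pi : ℂ) ^ g *
        (gaussMass (positionCoeff (modulus kappa)) * gaussMass (momentumCoeff (modulus kappa)))))))
      g (stateZ G Psi) where
  isOpen := isOpen_compl_A2
  isCurve := isCurveIn_A1
  flat := isFlatUnitSection_flatSection.mono fun x hx => Or.inl hx.1
  admissible := isAdmissible_stateZ hg G hj hkappa hOm hPsi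
  microsupport_subset := fun x hx =>
    ⟨(microsupport_stateZ_subset hg G hj hkappa hOm hPsi hx.1).resolve_right hx.2, hx.2⟩
  localForm := by
    intro x₀ hx₀
    set τ := modulus kappa with hτdef
    have hτ : 0 < τ.im := modulus_im_pos hj hkappa hOm.ne_zero
    obtain ⟨n₀, hn₀⟩ := proj_mem_A1_iff.1 hx₀.1
    have hp₀ : ∀ m : ℤ, 2 * x₀.1 ≠ m := fun m h => hx₀.2 (proj_mem_A2_iff.2 ⟨m, h⟩)
    obtain ⟨u, C, δ, hδ, hu, hZ⟩ := exists_stateZ_eq hg G hj hkappa hOm hPsi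
    obtain ⟨V, f, F, hV, hxV, hexp, hF, hneg⟩ := exists_local_form_momentum hg hτ hp₀ n₀
    have hx : (x₀.1, (n₀ : ℝ)) = x₀ := by rw [← hn₀]
    rw [hx] at hxV
    refine exists_localForm (V := V) (e := momentumPhase τ n₀)
      (f := fun k y => Om * ((Real.sqrt 2 : ℝ) : ℂ)⁻¹ * f k y)
      (F := fun l y => Om * ((Real.sqrt 2 : ℝ) : ℂ)⁻¹ * F l y) isOpen_compl_A2 hx₀.2 hV hxV ?_ ?_ ?_
      (hexp.const_mul hV _) ?_
    · rw [momentumPhase_eq_holoSection hτ]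
      exact contDiff_holoSection τ 1 (differentiable_cexp_quadratic _ _ _)
    · intro v y
      rw [momentumPhase_eq_holoSection hτ]
      exact dbar_holoSection (zcoord_modulus_complex hkappa hOm.ne_zero) 1
        (differentiable_cexp_quadratic _ _ _) v y
    · filter_upwards [eventually_mem_circles x₀,
        (isOpen_compl_A2.preimage continuous_proj).mem_nhds hx₀.2] with y hy hy2
      rw [hn₀] at hy
      refine ⟨fun h => ?_, fun h => ?_, fun hyV h => ?_⟩
      · have h2 := hy.1 h.1
        rw [flatSection_of_snd ⟨n₀, h2⟩, momentumPhase, leadingExp, h2, sub_self, ← Complex.exp_add]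
        congr 1
        push_cast
        ring
      · have h2 : y.2 - n₀ ≠ 0 := fun h0 =>
          h ⟨proj_mem_A1_iff.2 ⟨n₀, by linarith⟩, hy2⟩
        rw [momentumPhase, norm_mul, norm_exp_two_pi_I_mul, one_mul]
        exact norm_leadingExp_lt_one (momentumCoeff_re_pos hτ) _ h2
      · rw [descend_symbolA1, symbolA1, hF y hyV (hy.1 h.1)]
        ring
    · refine (isNegligibleOn_of_gaussZ hg hτ hδ hu hZ hneg).congr fun k hk y _ => ?_
      rw [← rpow_quarter_mul hk]
      ring

/-- Over the complement of `A₁`, the state is a Lagrangian state supported by `A₂`. -/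
lemma isLagrangianState_A2 {g : ℕ} (hg : 1 ≤ g) (G : PantsDecomposition g)
    {j : Plane →ₗ[ℝ] Plane} (hj : IsCompatible j) {kappa : Plane →ₗ[ℝ] ℂ}
    (hkappa : IsHalfFormLine j kappa) {Om : ℂ} (hOm : IsHalfForm kappa mu Om)
    {Psi : (k : ℕ) → ZMod (2 * k) → Plane → ℂ}
    (hPsi : ∀ k, 1 ≤ k → IsPsiBasis j kappa Om k (Psi k)) {P : Fin g → Polynomial ℝ}
    (hP : IsCountingFamily G P) :
    IsLagrangianState j kappa A1ᶜ (A2 \ A1) flatSection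
      (descend (symbolA2 (P ⟨0, hg⟩) (-(Om * ((Real.sqrt 2 : ℝ) : ℂ)⁻¹ *
        ((Real.sqrt (2 * Real.pi) : ℝ) * gaussMass (positionCoeff (modulus kappa)))))))
      (3 * (g : ℝ) - 3 / 2) (stateZ G Psi) where
  isOpen := isOpen_compl_A1
  isCurve := isCurveIn_A2
  flat := isFlatUnitSection_flatSection.mono fun x hx => Or.inr hx.1
  admissible := isAdmissible_stateZ hg G hj hkappa hOm hPsi
  microsupport_subset := fun x hx =>
    ⟨(microsupport_stateZ_subset hg G hj hkappa hOm hPsi hx.1).resolve_left hx.2, hx.2⟩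
  localForm := by
    intro x₀ hx₀
    set τ := modulus kappa with hτdef
    have hτ : 0 < τ.im := modulus_im_pos hj hkappa hOm.ne_zero
    obtain ⟨m₀, hm₀⟩ := proj_mem_A2_iff.1 hx₀.1
    have hq₀ : ∀ n : ℤ, x₀.2 ≠ n := fun n h => hx₀.2 (proj_mem_A1_iff.2 ⟨n, h⟩)
    obtain ⟨u, C, δ, hδ, hu, hZ⟩ := exists_stateZ_eq hg G hj hkappa hOm hPsi
    obtain ⟨P', hP', hPf⟩ := exists_isCountingFamily hg G
    obtain rfl := isCountingFamily_ext hP hP'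
    obtain ⟨V, f, F, hV, hxV, hexp, hF, hneg⟩ := exists_local_form_position hg hPf hτ m₀ hq₀
    have hx1 : x₀.1 = m₀ / 2 := by linarith
    have hx : ((m₀ : ℝ) / 2, x₀.2) = x₀ := by rw [← hx1]
    rw [hx] at hxV
    refine exists_localForm (V := V) (e := positionPhase τ m₀)
      (f := fun k y => Om * ((Real.sqrt 2 : ℝ) : ℂ)⁻¹ * f k y)
      (F := fun l y => Om * ((Real.sqrt 2 : ℝ) : ℂ)⁻¹ * F l y) isOpen_compl_A1 hx₀.2 hV hxV ?_ ?_ ?_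
      (hexp.const_mul hV _) ?_
    · rw [positionPhase_eq_holoSection hτ]
      exact contDiff_holoSection τ 1 (differentiable_cexp_quadratic _ _ _)
    · intro v y
      rw [positionPhase_eq_holoSection hτ]
      exact dbar_holoSection (zcoord_modulus_complex hkappa hOm.ne_zero) 1
        (differentiable_cexp_quadratic _ _ _) v y
    · filter_upwards [eventually_mem_circles x₀,
        (isOpen_compl_A1.preimage continuous_proj).mem_nhds hx₀.2] with y hy hy2
      rw [hx1] at hy
      refine ⟨fun h => ?_, fun h => ?_, fun hyV h => ?_⟩
      · have h2 := hy.2 h.1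
        rw [flatSection_of_fst ⟨m₀, by linarith⟩, positionPhase, leadingExp, h2, sub_self,
          ← Complex.exp_add]
        congr 1
        push_cast
        ring
      · have h2 : (m₀ : ℝ) / 2 - y.1 ≠ 0 := fun h0 =>
          h ⟨proj_mem_A2_iff.2 ⟨m₀, by linarith⟩, hy2⟩
        rw [positionPhase, norm_mul, norm_exp_two_pi_I_mul, one_mul]
        exact norm_leadingExp_lt_one (positionCoeff_re_pos hτ) _ h2
      · have h2 := hy.2 h.1
        have h3 : ⌊2 * y.1⌋ = m₀ := by
          rw [h2, mul_div_cancel₀ _ (two_ne_zero : (2 : ℝ) ≠ 0), Int.floor_intCast]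
        rw [descend_symbolA2, symbolA2, hF y hyV h2, h3]
        ring
    · refine (isNegligibleOn_of_gaussZ hg hτ hδ hu hZ hneg).congr fun k hk y _ => ?_
      rw [← rpow_quarter_mul hk]
      ring

/-- The constant of the symbol along `A₁`. -/
lemma symbolA1_const {kappa : Plane →ₗ[ℝ] ℂ} (hτ : 0 < (modulus kappa).im) (g : ℕ) (Om : ℂ) :
    ∃ eps : ℂ, (eps = 1 ∨ eps = -1) ∧ Om * ((Real.sqrt 2 : ℝ) : ℂ)⁻¹ * (4 * Complex.I *
      (Real.pi : ℂ) ^ g * (gaussMass (positionCoeff (modulus kappa)) *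
        gaussMass (momentumCoeff (modulus kappa))))
      = eps * (Complex.I * (Real.sqrt 2 : ℝ) * (Real.pi : ℂ) ^ g * Om) := by
  have h2 : ((Real.sqrt 2 : ℝ) : ℂ)⁻¹ * 2 = (Real.sqrt 2 : ℝ) := by
    have h0 : ((Real.sqrt 2 : ℝ) : ℂ) ≠ 0 := by
      exact_mod_cast (Real.sqrt_pos.2 (by norm_num : (0 : ℝ) < 2)).ne'
    rw [inv_mul_eq_iff_eq_mul₀ h0, ← Complex.ofReal_mul, Real.mul_self_sqrt (by norm_num)]
    norm_num
  rcases gaussMass_mul_gaussMass hτ with h | h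
  · refine ⟨1, Or.inl rfl, ?_⟩
    rw [h]
    linear_combination (Om * Complex.I * (Real.pi : ℂ) ^ g) * h2
  · refine ⟨-1, Or.inr rfl, ?_⟩
    rw [h]
    linear_combination (-(Om * Complex.I * (Real.pi : ℂ) ^ g)) * h2

/-- The constant of the symbol along `A₂`. -/
lemma symbolA2_const {kappa : Plane →ₗ[ℝ] ℂ} (hτ : 0 < (modulus kappa).im) {Ommu Omlam : ℂ}
    (hmu : IsHalfForm kappa mu Ommu) (hlam : IsHalfForm kappa lam Omlam) :
    ∃ eps : ℂ, (eps = 1 ∨ eps = -1) ∧ -(Ommu * ((Real.sqrt 2 : ℝ) : ℂ)⁻¹ *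
      ((Real.sqrt (2 * Real.pi) : ℝ) * gaussMass (positionCoeff (modulus kappa))))
      = eps * (Complex.exp (Complex.I * Real.pi / 4) * (Real.sqrt (Real.pi / 2) : ℝ) * Omlam) := by
  have hpi := Real.pi_pos
  have hpic : (Real.pi : ℂ) ≠ 0 := by exact_mod_cast hpi.ne'
  have h1 := hmu.ne_zero
  have h2 := hlam.ne_zero
  have hO1 : Ommu ^ 2 = (kappa mu)⁻¹ := eq_inv_of_mul_eq_one_left hmu
  have hO2 : Omlam ^ 2 = (kappa lam)⁻¹ := eq_inv_of_mul_eq_one_left hlam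
  have hs : ∀ x : ℝ, 0 ≤ x → ((Real.sqrt x : ℝ) : ℂ) ^ 2 = x := fun x hx => by
    rw [← Complex.ofReal_pow, Real.sq_sqrt hx]
  have hexp : Complex.exp (Complex.I * Real.pi / 4) ^ 2 = Complex.I := by
    rw [← Complex.exp_nat_mul, show ((2 : ℕ) : ℂ) * (Complex.I * Real.pi / 4) = Real.pi / 2 * Complex.I by
      push_cast; ring, Complex.exp_pi_div_two_mul_I]
  have hsq : (-(Ommu * ((Real.sqrt 2 : ℝ) : ℂ)⁻¹ *
      ((Real.sqrt (2 * Real.pi) : ℝ) * gaussMass (positionCoeff (modulus kappa))))) ^ 2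
      = (Complex.exp (Complex.I * Real.pi / 4) * (Real.sqrt (Real.pi / 2) : ℝ) * Omlam) ^ 2 := by
    rw [neg_sq, mul_pow, mul_pow, mul_pow, mul_pow, mul_pow, inv_pow, hs 2 (by norm_num),
      hs _ (by positivity), hs _ (by positivity), hexp, hO1, hO2,
      gaussMass_sq (positionCoeff_re_pos hτ), positionCoeff, modulus]
    push_cast
    field_simp
    rw [Complex.I_sq]
  rcases sq_eq_sq_iff_eq_or_eq_neg.1 hsq with h | h
  · exact ⟨1, Or.inl rfl, by rw [h, one_mul]⟩
  · exact ⟨-1, Or.inr rfl, by rw [h, neg_one_mul]⟩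

end TorusQuantization

theorem mainTheorem4 (g : ℕ) (hg : 1 ≤ g) (G : PantsDecomposition g)
    (j : Plane →ₗ[ℝ] Plane) (hj : IsCompatible j)
    (kappa : Plane →ₗ[ℝ] ℂ) (hkappa : IsHalfFormLine j kappa)
    (Ommu Omlam : ℂ) (hmu : IsHalfForm kappa mu Ommu) (hlam : IsHalfForm kappa lam Omlam)
    (Psi : (k : ℕ) → ZMod (2 * k) → Plane → ℂ)
    (hPsi : ∀ k, 1 ≤ k → IsPsiBasis j kappa Ommu k (Psi k)) :
    ∃ Theta : Plane → ℂ, IsFlatUnitSection (A1 ∪ A2) Theta ∧ Theta 0 = 1 ∧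
      (∃ sigma1 : Torus → ℂ,
        IsLagrangianState j kappa A2ᶜ (A1 \ A2) Theta sigma1 (g : ℝ) (stateZ G Psi) ∧
        ∃ eps : ℂ, (eps = 1 ∨ eps = -1) ∧
          ∀ p : ℝ, proj (p • mu) ∉ A2 →
            sigma1 (proj (p • mu)) = eps * (Complex.I * (Real.sqrt 2 : ℝ) * (Real.pi : ℂ) ^ g *
              (((Real.sin (2 * Real.pi * p)) ^ (2 * g - 1))⁻¹ : ℝ) * Ommu)) ∧
      (∃! P : Fin g → Polynomial ℝ, IsCountingFamily G P) ∧
      ∀ P : Fin g → Polynomial ℝ, IsCountingFamily G P →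
        ∃ sigma2 : Torus → ℂ,
          IsLagrangianState j kappa A1ᶜ (A2 \ A1) Theta sigma2 (3 * (g : ℝ) - 3 / 2)
            (stateZ G Psi) ∧
          (∃ eps : ℂ, (eps = 1 ∨ eps = -1) ∧
            ∀ q : ℝ, 0 < q → q < 1 →
              sigma2 (proj (q • lam)) = eps * (Complex.exp (Complex.I * Real.pi / 4) *
                (Real.sqrt (Real.pi / 2) : ℝ) * ((P ⟨0, hg⟩).eval (2 * q) : ℝ) * Omlam)) ∧
          ∀ q : ℝ, 0 < q → q < 1 →
            sigma2 (proj ((1 / 2 : ℝ) • mu + q • lam)) = -sigma2 (proj (q • lam)) := by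
  have hτ := modulus_im_pos hj hkappa hmu.ne_zero
  refine ⟨flatSection, isFlatUnitSection_flatSection, flatSection_zero, ?_, ?_, fun P hP => ?_⟩
  · refine ⟨_, isLagrangianState_A1 hg G hj hkappa hmu hPsi, ?_⟩
    obtain ⟨eps, heps, h⟩ := symbolA1_const hτ g Ommu
    refine ⟨eps, heps, fun p _ => ?_⟩
    rw [descend_symbolA1, symbolA1, h]
    simp only [mu, Prod.smul_mk, smul_eq_mul, mul_one]
    ring
  · obtain ⟨P, hP, -⟩ := exists_isCountingFamily hg G
    exact ⟨P, hP, fun P' hP' => isCountingFamily_ext hP' hP⟩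
  · obtain ⟨eps, heps, h⟩ := symbolA2_const hτ hmu hlam
    have hfract : ∀ q : ℝ, 0 < q → q < 1 → Int.fract q = q := fun q h0 h1 =>
      Int.fract_eq_self.2 ⟨h0.le, h1⟩
    refine ⟨_, isLagrangianState_A2 hg G hj hkappa hmu hPsi hP, ⟨eps, heps, fun q h0 h1 => ?_⟩,
      fun q h0 h1 => ?_⟩
    · rw [descend_symbolA2, symbolA2, h]
      simp only [lam, Prod.smul_mk, smul_eq_mul, mul_one, mul_zero, Int.floor_zero, zpow_zero,
        hfract q h0 h1]
      ring
    · rw [descend_symbolA2, descend_symbolA2, symbolA2, symbolA2]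
      simp only [mu, lam, Prod.smul_mk, Prod.mk_add_mk, smul_eq_mul, mul_one, mul_zero, add_zero,
        zero_add, Int.floor_zero, zpow_zero]
      norm_num
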